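/- **Theorem (decomposition error of the $C^1$ sum-of-Gaussians splitting in quasi-2D systems).** Let $L_x,L_y,L_z>0$ and let charges $q_1,\dots,q_N\in\mathbb R$ with $\sum_i q_i=0$ be located at points $\boldsymbol r_1,\dots,\boldsymbol r_N$ of the box $[-\tfrac{L_x}2,\tfrac{L_x}2]\times[-\tfrac{L_y}2,\tfrac{L_y}2]\times[-\tfrac{L_z}2,\tfrac{L_z}2]$, repeated periodically in $x$ and $y$. For $b>1$, $\sigma>0$ and $\ell\in\mathbb Z$ put $$w_\ell=(\pi/2)^{-1/2}\,b^{-\ell}\sigma^{-1}\log b,\qquad s_\ell=\sqrt2\,b^{\ell}\sigma .$$ For $\omega\in\mathbb R$, $M\in\mathbb N$ and a cutoff $r_c>0$ define the far part, the near part and the error kernel $$\mathcal F(r)=\omega w_0e^{-r^2/s_0^2}+\sum_{\ell=1}^{M}w_\ell e^{-r^2/s_\ell^2},\qquad \mathcal N(r)=\begin{cases}1/r-\mathcal F(r),&r<r_c\\0,&r\ge r_c\end{cases},\qquad K(r)=\frac1r-\mathcal N(r)-\mathcal F(r)$$ (so that $K(r)=0$ for $r<r_c$; in particular $K(0)=0$).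 Let $$\Phi_{\rm err}(\boldsymbol r)=\lim_{R\to\infty}\ \sum_{n_x,n_y=-R}^{R}\ \sum_{j=1}^N q_j\,K\big(|\boldsymbol r_j-\boldsymbol r+(n_xL_x,n_yL_y,0)|\big),$$ $$U_{\rm err}=\frac12\sum_{i=1}^N q_i\Phi_{\rm err}(\boldsymbol r_i),\qquad \boldsymbol F_{\rm err}(\boldsymbol r_i)=-q_i\nabla\Phi_{\rm err}(\boldsymbol r_i).$$ For every $r_{\min}>0$ there are constants $C>0$ and $b_0>1$, depending only on the charges, their positions, $L_x,L_y,L_z$ and $r_{\min}$, such that the following holds for all $b\in(1,b_0)$, $\sigma>0$, $\omega\in\mathbb R$, $M\in\mathbb N$ and $r_c\ge r_{\min}$ which satisfy * ($C^1$ continuity) $\ \frac1r-\mathcal F(r)$ and its derivative $\frac{d}{dr}\big[\frac1r-\mathcal F(r)\big]$ both vanish at $r=r_c$; * $s_0<r_c$ and $2r_c\le\max\{L_x,L_y\}\le s_{M+1}$. The limit $\Phi_{\rm err}(\boldsymbol r)$ exists for every $\boldsymbol r\in\mathbb R^3$, the function $\Phi_{\rm err}$ is differentiable on $\mathbb R^3$,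 and $$|U_{\rm err}|\le C\Big((\log b)^{-3/2}e^{-\pi^2/(2\log b)}+b^{-M}+\Big|w_{-1}e^{-r_c^2/s_{-1}^2}-(\omega-1)w_0e^{-r_c^2/s_0^2}\Big|\Big),$$ and, for every $i$, $$|\boldsymbol F_{\rm err}(\boldsymbol r_i)|\le C\Big((\log b)^{-3/2}e^{-\pi^2/(2\log b)}+b^{-3M}+\Big|\frac{w_{-1}}{s_{-1}^2}e^{-r_c^2/s_{-1}^2}-\frac{(\omega-1)w_0}{s_0^2}e^{-r_c^2/s_0^2}\Big|\Big).$$ -/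

import Mathlib

open Filter Topology

noncomputable section

/-- Three-dimensional Euclidean space; the coordinates `0, 1, 2` are `x, y, z`. -/
abbrev Space : Type := EuclideanSpace ℝ (Fin 3)

/-- The weight `w_ℓ = (π/2)^{-1/2} b^{-ℓ} σ⁻¹ log b` of the bilateral series approximation of `1/r`,
for every integer `ℓ`. -/
def sogWeight (b σ : ℝ) (l : ℤ) : ℝ :=
  (√(Real.pi / 2))⁻¹ * b ^ (-l) * σ⁻¹ * Real.log b

/-- The bandwidth `s_ℓ = √2 b^ℓ σ`, for every integer `ℓ`. -/
def sogWidth (b σ : ℝ) (l : ℤ) : ℝ :=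
  √2 * b ^ l * σ

/-- The weights used in the far part: the narrowest Gaussian `ℓ = 0` has its weight multiplied
by `ω`. -/
def farWeight (b σ ω : ℝ) (l : ℕ) : ℝ :=
  if l = 0 then ω * sogWeight b σ 0 else sogWeight b σ l

/-- The far part: a sum of the `M + 1` Gaussians `ℓ = 0, …, M`. -/
def farPart (b σ ω : ℝ) (M : ℕ) (r : ℝ) : ℝ :=
  ∑ l ∈ Finset.range (M + 1), farWeight b σ ω l * Real.exp (-(r ^ 2 / sogWidth b σ l ^ 2))

/-- The near part: `1/r` minus the far part inside the cutoff radius `rc`, and zero outside. -/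
def nearPart (b σ ω : ℝ) (M : ℕ) (rc r : ℝ) : ℝ :=
  if r < rc then 1 / r - farPart b σ ω M r else 0

/-- The kernel of the decomposition error, `1/r` minus near part minus far part. -/
def errKernel (b σ ω : ℝ) (M : ℕ) (rc r : ℝ) : ℝ :=
  1 / r - nearPart b σ ω M rc r - farPart b σ ω M r

/-- The decomposition is `C¹` across the cutoff: `1/r` minus the far part vanishes at `rc` together
with its derivative. -/
structure IsC1Splitting (b σ ω : ℝ) (M : ℕ) (rc : ℝ) : Prop where
  value_eq : 1 / rc - farPart b σ ω M rc = 0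
  deriv_eq : deriv (fun r : ℝ => 1 / r - farPart b σ ω M r) rc = 0

/-- The lattice translation `n ∘ L` for `n = (n_x, n_y, 0)`. -/
def latticeShift (Lx Ly : ℝ) (n : ℤ × ℤ) : Space :=
  !₂[(n.1 : ℝ) * Lx, (n.2 : ℝ) * Ly, 0]

/-- The contribution to the error potential at `x` of the periodic images
`n ∈ {-R, …, R}² × {0}` of all charges. -/
def errPotentialPartial {N : ℕ} (q : Fin N → ℝ) (pos : Fin N → Space) (Lx Ly : ℝ)
    (b σ ω : ℝ) (M : ℕ) (rc : ℝ) (R : ℕ) (x : Space) : ℝ :=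
  ∑ n ∈ Finset.Icc (-(R : ℤ)) R ×ˢ Finset.Icc (-(R : ℤ)) R,
    ∑ j, q j * errKernel b σ ω M rc ‖pos j - x + latticeShift Lx Ly n‖

/-- The error potential at `x`, the limit of the sums over the images in growing squares. -/
def errPotential {N : ℕ} (q : Fin N → ℝ) (pos : Fin N → Space) (Lx Ly : ℝ)
    (b σ ω : ℝ) (M : ℕ) (rc : ℝ) (x : Space) : ℝ :=
  limUnder atTop fun R : ℕ => errPotentialPartial q pos Lx Ly b σ ω M rc R x

/-- The decomposition error of the energy, `½ ∑ᵢ qᵢ Φ_err(rᵢ)`. -/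
def errEnergy {N : ℕ} (q : Fin N → ℝ) (pos : Fin N → Space) (Lx Ly : ℝ)
    (b σ ω : ℝ) (M : ℕ) (rc : ℝ) : ℝ :=
  1 / 2 * ∑ i, q i * errPotential q pos Lx Ly b σ ω M rc (pos i)

/-- The decomposition error of the force on particle `i`, `-qᵢ ∇Φ_err(rᵢ)`. -/
def errForce {N : ℕ} (q : Fin N → ℝ) (pos : Fin N → Space) (Lx Ly : ℝ)
    (b σ ω : ℝ) (M : ℕ) (rc : ℝ) (i : Fin N) : Space :=
  -(q i • gradient (errPotential q pos Lx Ly b σ ω M rc) (pos i))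

/-- The bound for the energy error. -/
def energyBound (b σ ω : ℝ) (M : ℕ) (rc : ℝ) : ℝ :=
  Real.log b ^ (-(3 / 2) : ℝ) * Real.exp (-(Real.pi ^ 2 / (2 * Real.log b)))
    + b ^ (-(M : ℤ))
    + |sogWeight b σ (-1) * Real.exp (-(rc ^ 2 / sogWidth b σ (-1) ^ 2))
        - (ω - 1) * sogWeight b σ 0 * Real.exp (-(rc ^ 2 / sogWidth b σ 0 ^ 2))|

/-- The bound for the force error. -/
def forceBound (b σ ω : ℝ) (M : ℕ) (rc : ℝ) : ℝ :=
  Real.log b ^ (-(3 / 2) : ℝ) * Real.exp (-(Real.pi ^ 2 / (2 * Real.log b)))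
    + b ^ (-(3 * M : ℤ))
    + |sogWeight b σ (-1) / sogWidth b σ (-1) ^ 2
          * Real.exp (-(rc ^ 2 / sogWidth b σ (-1) ^ 2))
        - (ω - 1) * sogWeight b σ 0 / sogWidth b σ 0 ^ 2
          * Real.exp (-(rc ^ 2 / sogWidth b σ 0 ^ 2))|

end

noncomputable section

/-! Everything is written in the squared distance `s`. Up to a constant, the bilateral series of
Gaussians is the trapezoidal rule, with step `2 log b` in a logarithmic variable, for the Gamma
integral representing `s ^ (-1/2)`. By Poisson summation its error is a sum of values of `Γ` on a
vertical line, whose decay gives `exp (-π² / (2 log b))`. The same holds for all derivatives, with a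
factor `(log b)⁻¹` for each (`abs_tsum_gammaProfile_sub_le`, `abs_sogResidual_one_le`).

Outside the cutoff the kernel is therefore a quadrature residual, plus the omitted wide Gaussians `ℓ
> M` (tail), plus the missing narrow ones: `ℓ < -1` (deep), `ℓ = -1`, and `1 - ω` times `ℓ = 0`. The
last two make up the mismatch in the bound. The `C¹` conditions say that residual + tail + deep +
mismatch vanishes at `rc`, for the function and for its derivative. Tail and deep part are
nonnegative, so each is bounded by residual and mismatch. The term `ℓ = -1` is controlled by its
neighbour `ℓ = -2` or is already as small as the residual (`gaussTerm_neg_one_le`), and then the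
term `ℓ = 0` is controlled too. So every piece at `rc` is at most a constant times quadrature error
plus mismatch (`exists_size_bounds`).

It remains to sum over the images with constants independent of the parameters. Pairing `n` with
`-n` and using neutrality turns the potential into second differences; for the gradient the pairing
alone suffices. The residual is then summed by interpolating between two estimates
(`le_quadSize_mul_rpow`), the tail by a theta function bound (`exists_sum_tailSize_le`), and the
narrow part by its Gaussian decay. The finitely many near images are bounded by the supremum of the
kernel (`exists_abs_cutBelow_sogResidual_le`). The `C¹` conditions also make the kernel, cut off to
zero below `rc`, differentiable, so the image sum can be differentiated term by term. -/

/-! ### Decay of the Gamma function on vertical lines -/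

lemma norm_Gamma_half_add_mul_I_le (t : ℝ) :
    ‖Complex.Gamma (1 / 2 + t * Complex.I)‖ ≤ √(2 * Real.pi) * Real.exp (-(Real.pi * |t| / 2)) := by
  have key : ‖Complex.Gamma (1 / 2 + t * Complex.I)‖ ^ 2 = Real.pi / Real.cosh (Real.pi * t) := by
    have h1 := Complex.Gamma_mul_Gamma_one_sub (1 / 2 + t * Complex.I)
    -- On the critical line `1 - z` is the conjugate of `z`, so the reflection formula computes the
    -- modulus exactly.
    have h2 : (1 : ℂ) - (1 / 2 + t * Complex.I)
        = (starRingEnd ℂ) (1 / 2 + t * Complex.I) := by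
      apply Complex.ext <;> (simp; try norm_num)
    have h3 : Complex.sin (Real.pi * (1 / 2 + t * Complex.I))
        = ((Real.cosh (Real.pi * t) : ℝ) : ℂ) := by
      have : (Real.pi : ℂ) * (1 / 2 + t * Complex.I)
          = ((Real.pi * t : ℝ) : ℂ) * Complex.I + Real.pi / 2 := by push_cast; ring
      rw [this, Complex.sin_add_pi_div_two, Complex.cos_mul_I, Complex.ofReal_cosh]
    rw [h2, Complex.Gamma_conj, Complex.mul_conj, h3, Complex.normSq_eq_norm_sq] at h1
    exact_mod_cast h1
  have hc : Real.exp (Real.pi * |t|) / 2 ≤ Real.cosh (Real.pi * t) := by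
    have : Real.cosh (Real.pi * t) = Real.cosh (Real.pi * |t|) := by
      rw [← Real.cosh_abs, abs_mul, abs_of_pos Real.pi_pos]
    rw [this, Real.cosh_eq]
    have := Real.exp_pos (-(Real.pi * |t|))
    linarith
  refine le_of_sq_le_sq ?_ (by positivity)
  rw [key, mul_pow, Real.sq_sqrt (by positivity), ← Real.exp_nat_mul]
  calc Real.pi / Real.cosh (Real.pi * t) ≤ Real.pi / (Real.exp (Real.pi * |t|) / 2) := by
        gcongr
    _ = 2 * Real.pi * (Real.exp (Real.pi * |t|))⁻¹ := by field_simp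
    _ = _ := by rw [← Real.exp_neg]; congr 2; push_cast; ring

/-- The functional equation moves the line by one unit at the cost of one factor `1 + |t|`; this
factor later becomes a power of `(log b)⁻¹`. -/
lemma norm_Gamma_nat_add_half_add_mul_I_le (m : ℕ) : ∃ C : ℝ, 0 < C ∧ ∀ t : ℝ,
    ‖Complex.Gamma (m + 1 / 2 + t * Complex.I)‖
      ≤ C * (1 + |t|) ^ m * Real.exp (-(Real.pi * |t| / 2)) := by
  induction m with
  | zero =>
    refine ⟨√(2 * Real.pi), by positivity, fun t => ?_⟩
    simpa using norm_Gamma_half_add_mul_I_le t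
  | succ m ih =>
    obtain ⟨C, hC, ih⟩ := ih
    refine ⟨C * (m + 1), by positivity, fun t => ?_⟩
    have hz : (m + 1 / 2 + t * Complex.I : ℂ) ≠ 0 := by
      intro h
      have := congrArg Complex.re h
      simp at this
      have h0 : (0 : ℝ) ≤ m := by positivity
      linarith
    have he : ((m + 1 : ℕ) + 1 / 2 + t * Complex.I : ℂ) = (m + 1 / 2 + t * Complex.I) + 1 := by
      push_cast; ring
    rw [he, Complex.Gamma_add_one _ hz, norm_mul]
    have hn : ‖(m + 1 / 2 + t * Complex.I : ℂ)‖ ≤ (m + 1) * (1 + |t|) := by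
      have h1 : ‖(m + 1 / 2 + t * Complex.I : ℂ)‖ ≤ (m + 1 / 2 : ℝ) + |t| := by
        have e : (m + 1 / 2 + t * Complex.I : ℂ) = ((m + 1 / 2 : ℝ) : ℂ) + t * Complex.I := by
          push_cast; ring
        rw [e]
        refine (norm_add_le _ _).trans ?_
        rw [norm_mul, Complex.norm_I, Complex.norm_real, Complex.norm_real, Real.norm_eq_abs,
          Real.norm_eq_abs, abs_of_pos (by positivity), mul_one]
      have h0 : (0 : ℝ) ≤ m * |t| := by positivity
      nlinarith
    calc _ ≤ ((m + 1) * (1 + |t|)) * (C * (1 + |t|) ^ m * Real.exp (-(Real.pi * |t| / 2))) := by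
          gcongr; exact ih t
      _ = _ := by ring

/-! ### Poisson summation and the trapezoidal rule -/

/-- The integrand of the Gamma integral in exponential variables. -/
def gammaProfile (m : ℕ) (h x : ℝ) : ℝ :=
  Real.exp (-(2 * h * (m + 1 / 2) * x)) * Real.exp (-Real.exp (-(2 * h * x)))

/-- For `x ≥ 0` the first exponential decays at rate at least `h`. For `x ≤ 0` it grows, but the
double exponential wins through `y ^ (m + 2) * exp (-y) ≤ (m + 2)!` with `y = exp (-2hx)`. -/
lemma gammaProfile_le (m : ℕ) {h : ℝ} (hh : 0 < h) (x : ℝ) :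
    gammaProfile m h x ≤ (m + 2).factorial * Real.exp (-(h * |x|)) := by
  have hf : (1 : ℝ) ≤ (m + 2).factorial := by exact_mod_cast Nat.factorial_pos _
  unfold gammaProfile
  rcases le_total 0 x with hx | hx
  · rw [abs_of_nonneg hx]
    have h1 : Real.exp (-(2 * h * (m + 1 / 2) * x)) ≤ Real.exp (-(h * x)) := by
      apply Real.exp_le_exp.2
      have : 0 ≤ h * m * x := by positivity
      nlinarith
    have h2 : Real.exp (-Real.exp (-(2 * h * x))) ≤ 1 := by
      apply Real.exp_le_one_iff.2
      have := Real.exp_pos (-(2 * h * x)); linarith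
    calc _ ≤ Real.exp (-(h * x)) * 1 := by gcongr
      _ ≤ _ := by nlinarith [Real.exp_pos (-(h * x))]
  · rw [abs_of_nonpos hx]
    set v := -(2 * h * x) with hv
    have hv0 : 0 ≤ v := by rw [hv]; nlinarith [mul_nonneg hh.le (neg_nonneg.2 hx)]
    have h3 := Real.pow_div_factorial_le_exp (Real.exp v) (Real.exp_pos v).le (m + 2)
    have h4 : Real.exp v ^ (m + 2) * Real.exp (-Real.exp v) ≤ (m + 2).factorial := by
      rw [Real.exp_neg (Real.exp v), ← div_eq_mul_inv, div_le_iff₀ (Real.exp_pos _)]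
      rwa [div_le_iff₀ (by positivity), mul_comm] at h3
    have h5 : Real.exp (-(2 * h * (m + 1 / 2) * x))
        ≤ Real.exp v ^ (m + 2) * Real.exp (-(h * -x)) := by
      rw [← Real.exp_nat_mul, ← Real.exp_add]
      apply Real.exp_le_exp.2
      push_cast
      have : h * -x = v / 2 := by rw [hv]; ring
      have h6 : -(2 * h * (m + 1 / 2) * x) = (m + 1 / 2) * v := by rw [hv]; ring
      rw [this, h6]; nlinarith
    calc _ ≤ Real.exp v ^ (m + 2) * Real.exp (-(h * -x)) * Real.exp (-Real.exp v) := by gcongr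
      _ = Real.exp v ^ (m + 2) * Real.exp (-Real.exp v) * Real.exp (-(h * -x)) := by ring
      _ ≤ _ := by gcongr

/-- Poisson summation asks for decay of some order above `1`; order `2` is enough. -/
lemma gammaProfile_isBigO (m : ℕ) {h : ℝ} (hh : 0 < h) :
    (fun x : ℝ => (gammaProfile m h x : ℂ)) =O[cocompact ℝ] fun x : ℝ => |x| ^ (-2 : ℝ) := by
  refine Asymptotics.IsBigO.of_bound ((m + 2).factorial * (2 / h ^ 2)) ?_
  have : ∀ᶠ x : ℝ in cocompact ℝ, x ≠ 0 := by
    have := (isCompact_singleton (x := (0 : ℝ))).compl_mem_cocompact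
    filter_upwards [this] with x hx using hx
  filter_upwards [this] with x hx
  have hp : 0 ≤ gammaProfile m h x := by unfold gammaProfile; positivity
  rw [Complex.norm_real, Real.norm_eq_abs, abs_of_nonneg hp, Real.norm_eq_abs,
    abs_of_nonneg (by positivity), Real.rpow_neg (abs_nonneg x)]
  refine (gammaProfile_le m hh x).trans ?_
  rw [mul_assoc]
  gcongr
  have hx' : 0 < |x| := abs_pos.2 hx
  have := Real.pow_div_factorial_le_exp (h * |x|) (by positivity) 2
  rw [Real.exp_neg]
  norm_num at this ⊢
  rw [show (2 : ℝ) / h ^ 2 * (x ^ 2)⁻¹ = (((h * |x|) ^ 2) / 2)⁻¹ by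
    rw [mul_pow, sq_abs]; field_simp]
  exact inv_anti₀ (by positivity) this

open FourierTransform in
-- The profile is `t ↦ exp (-t ^ (2h))` in the variable `t = exp (-x)`, so its Fourier transform is
-- a Mellin transform, and rescaling the exponent reduces this to the Gamma integral.
lemma fourier_gammaProfile (m : ℕ) {h : ℝ} (hh : 0 < h) (k : ℤ) :
    𝓕 (fun x : ℝ => (gammaProfile m h x : ℂ)) k
      = (1 / (2 * h) : ℝ) * Complex.Gamma (m + 1 / 2 + (Real.pi * k / h : ℝ) * Complex.I) := by
  set s : ℂ := (2 * h * (m + 1 / 2) : ℝ) + (2 * Real.pi * k : ℝ) * Complex.I with hs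
  have hre : s.re = 2 * h * (m + 1 / 2) := by simp [hs]
  have him : s.im = 2 * Real.pi * k := by simp [hs]
  have h1 := mellin_eq_fourier (fun t : ℝ => Complex.exp (-((t ^ (2 * h) : ℝ) : ℂ))) (s := s)
  have h2 : (fun u : ℝ => Real.exp (-s.re * u) •
      (fun t : ℝ => Complex.exp (-((t ^ (2 * h) : ℝ) : ℂ))) (Real.exp (-u)))
      = fun x : ℝ => (gammaProfile m h x : ℂ) := by
    funext u
    simp only [gammaProfile, hre, Complex.real_smul]
    rw [← Real.exp_mul]
    push_cast
    congr 2
    · ring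
    · congr 3; ring
  rw [h2, him] at h1
  have h3 : 2 * Real.pi * (k : ℝ) / (2 * Real.pi) = k := by
    field_simp
  rw [h3] at h1
  rw [← h1]
  have h4 := mellin_comp_rpow (fun t : ℝ => Complex.exp (-(t : ℂ))) s (2 * h)
  rw [h4]
  have h5 : s / ((2 * h : ℝ) : ℂ) = m + 1 / 2 + (Real.pi * k / h : ℝ) * Complex.I := by
    rw [hs]
    have : (h : ℂ) ≠ 0 := by exact_mod_cast hh.ne'
    push_cast; field_simp
  rw [h5, Complex.Gamma_eq_integral (by simp; positivity), Complex.GammaIntegral_eq_mellin,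
    abs_of_pos (by positivity)]
  simp [Complex.real_smul]

/-- Sum over the nonzero Fourier modes. -/
lemma sum_modes_le (m : ℕ) : ∃ C : ℝ, 0 < C ∧ ∀ h : ℝ, 0 < h → h < 1 →
    ∃ u : ℤ → ℝ, Summable u ∧
      (∀ k : ℤ, k ≠ 0 →
        ‖Complex.Gamma (m + 1 / 2 + (Real.pi * k / h : ℝ) * Complex.I)‖ ≤ u k) ∧
      u 0 = 0 ∧ ∑' k, u k ≤ C * (h⁻¹ ^ m * Real.exp (-(Real.pi ^ 2 / (2 * h)))) := by
  obtain ⟨C, hC, hΓ⟩ := norm_Gamma_nat_add_half_add_mul_I_le m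
  have hsum : Summable fun n : ℕ => ((n : ℝ) ^ m * Real.exp (-1) ^ n) := by
    refine summable_pow_mul_geometric_of_norm_lt_one m ?_
    rw [Real.norm_eq_abs, abs_of_pos (Real.exp_pos _)]
    rw [← Real.exp_zero]
    exact Real.exp_lt_exp.2 (by norm_num)
  set w : ℤ → ℝ := fun k => (k.natAbs : ℝ) ^ m * Real.exp (-1) ^ k.natAbs with hw
  have hwsum : Summable w := by
    apply Summable.of_nat_of_neg <;> simpa [hw] using hsum
  set Z := ∑' k, w k with hZ
  have hZ0 : 0 ≤ Z := tsum_nonneg fun k => by simp only [hw]; positivity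
  refine ⟨C * 5 ^ m * Real.exp 1 * Z + 1, by positivity, fun h h0 h1 => ?_⟩
  set X := Real.pi ^ 2 / (2 * h) with hX
  have hX1 : 1 ≤ X := by
    rw [hX, le_div_iff₀ (by positivity)]
    nlinarith [Real.pi_gt_three]
  set B := C * 5 ^ m * Real.exp 1 * (h⁻¹ ^ m * Real.exp (-X)) with hB
  refine ⟨fun k => if k = 0 then 0 else B * w k, ?_, ?_, by simp, ?_⟩
  · refine Summable.of_nonneg_of_le (fun k => ?_) (fun k => ?_) (hwsum.mul_left B)
    · split_ifs
      · exact le_rfl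
      · simp only [hw, hB]; positivity
    · split_ifs
      · simp only [hw, hB]; positivity
      · exact le_rfl
  · intro k hk
    simp only [hk, if_false]
    refine (hΓ _).trans ?_
    have hn1 : (1 : ℝ) ≤ k.natAbs := by
      exact_mod_cast Nat.one_le_iff_ne_zero.2 (Int.natAbs_ne_zero.2 hk)
    have habs : |Real.pi * k / h| = Real.pi * k.natAbs / h := by
      rw [abs_div, abs_mul, abs_of_pos Real.pi_pos, abs_of_pos h0, Nat.cast_natAbs, Int.cast_abs]
    rw [habs]
    -- The constant `5` exceeds `1 + π`, and `|k| / h ≥ 1`.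
    have e1 : 1 + Real.pi * k.natAbs / h ≤ 5 * (h⁻¹ * k.natAbs) := by
      have : 1 ≤ h⁻¹ * k.natAbs := by
        have := (one_le_inv₀ h0).2 h1.le
        nlinarith
      have h2 : Real.pi * k.natAbs / h = Real.pi * (h⁻¹ * k.natAbs) := by field_simp
      rw [h2]; nlinarith [Real.pi_lt_four]
    -- This is `(X - 1)(|k| - 1) ≥ 0`: one factor `exp (-X)` is extracted for every mode, and `exp
    -- (-|k|)` is left for summation.
    have e2 : Real.exp (-(Real.pi * (Real.pi * k.natAbs / h) / 2))
        ≤ Real.exp 1 * Real.exp (-X) * Real.exp (-1) ^ k.natAbs := by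
      rw [← Real.exp_nat_mul, ← Real.exp_add, ← Real.exp_add]
      apply Real.exp_le_exp.2
      have : Real.pi * (Real.pi * k.natAbs / h) / 2 = X * k.natAbs := by
        rw [hX]; field_simp
      rw [this]; nlinarith
    calc _ ≤ C * (5 * (h⁻¹ * k.natAbs)) ^ m *
          (Real.exp 1 * Real.exp (-X) * Real.exp (-1) ^ k.natAbs) := by gcongr
      _ = _ := by simp only [hw, hB, mul_pow]; ring
  · have : ∑' k, (if k = 0 then 0 else B * w k) ≤ ∑' k, B * w k := by
      refine Summable.tsum_le_tsum (fun k => ?_) ?_ (hwsum.mul_left B)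
      · split_ifs
        · simp only [hw, hB]; positivity
        · exact le_rfl
      · refine Summable.of_nonneg_of_le (fun k => ?_) (fun k => ?_) (hwsum.mul_left B)
        · split_ifs
          · exact le_rfl
          · simp only [hw, hB]; positivity
        · split_ifs
          · simp only [hw, hB]; positivity
          · exact le_rfl
    refine this.trans ?_
    rw [tsum_mul_left, hB]
    have : 0 ≤ h⁻¹ ^ m * Real.exp (-X) := by positivity
    nlinarith

open FourierTransform in
/-- The trapezoidal rule with step `2h` for the Gamma integral is exponentially accurate. -/
theorem abs_tsum_gammaProfile_sub_le (m : ℕ) : ∃ C : ℝ, 0 < C ∧ ∀ h : ℝ, 0 < h → h < 1 →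
    ∀ x : ℝ, |2 * h * ∑' l : ℤ, gammaProfile m h (x + l) - Real.Gamma (m + 1 / 2)|
      ≤ C * (h⁻¹ ^ m * Real.exp (-(Real.pi ^ 2 / (2 * h)))) := by
  obtain ⟨C, hC, H⟩ := sum_modes_le m
  refine ⟨C, hC, fun h h0 h1 x => ?_⟩
  obtain ⟨u, hu, hle, hu0, hus⟩ := H h h0 h1
  have hh2 : (0 : ℝ) < 2 * h := by positivity
  set c : ℤ → ℂ := fun k => 𝓕 (fun x : ℝ => (gammaProfile m h x : ℂ)) k with hc
  have hcle : ∀ k : ℤ, k ≠ 0 → ‖c k‖ ≤ (2 * h)⁻¹ * u k := by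
    intro k hk
    simp only [hc]
    rw [fourier_gammaProfile m h0, norm_mul, Complex.norm_real, one_div, Real.norm_eq_abs,
      abs_of_pos (by positivity)]
    gcongr
    exact hle k hk
  have hcs : Summable c := by
    refine Summable.of_norm_bounded_eventually (g := fun k => (2 * h)⁻¹ * u k) (hu.mul_left _) ?_
    have : ∀ᶠ k : ℤ in cofinite, k ≠ 0 := (Set.finite_singleton (0 : ℤ)).compl_mem_cofinite
    filter_upwards [this] with k hk using hcle k hk
  have hP := Real.tsum_eq_tsum_fourier_of_rpow_decay_of_summable
    (f := fun x : ℝ => (gammaProfile m h x : ℂ)) (by unfold gammaProfile; fun_prop)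
    (b := 2) (by norm_num) (gammaProfile_isBigO m h0) hcs x
  set d : ℤ → ℂ := fun k => c k * fourier k (x : UnitAddCircle) with hd
  have hfn : ∀ k : ℤ, ‖fourier k (x : UnitAddCircle)‖ = 1 := fun k => by
    rw [fourier_apply]; exact Circle.norm_coe _
  have hds : Summable d := by
    refine Summable.of_norm ?_
    have hdc : (fun k => ‖d k‖) = fun k => ‖c k‖ := by
      funext k
      simp only [hd]
      rw [norm_mul, hfn, mul_one]
    rw [hdc]
    exact hcs.norm
  -- The zero mode is the integral itself; the other modes are the quadrature error.
  have hsplit := hds.tsum_eq_add_tsum_ite 0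
  have hd0 : d 0 = ((2 * h)⁻¹ * Real.Gamma (m + 1 / 2) : ℝ) := by
    simp only [hd, hc]
    rw [fourier_gammaProfile m h0, _root_.fourier_zero]
    rw [Complex.ofReal_mul, ← Complex.Gamma_ofReal]
    push_cast
    simp
  have hrest : ‖∑' k, (if k = 0 then 0 else d k)‖ ≤ (2 * h)⁻¹ * ∑' k, u k := by
    rw [← tsum_mul_left]
    refine tsum_of_norm_bounded ((hu.mul_left _).hasSum) fun k => ?_
    by_cases hk : k = 0
    · simp [hk, hu0]
    · simp only [hk, if_false, hd, norm_mul, hfn, mul_one]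
      exact hcle k hk
  have hfin : ‖((∑' l : ℤ, gammaProfile m h (x + l) : ℝ) : ℂ) -
      ((2 * h)⁻¹ * Real.Gamma (m + 1 / 2) : ℝ)‖ ≤ (2 * h)⁻¹ * ∑' k, u k := by
    rw [Complex.ofReal_tsum, ← hd0]
    have : ∑' l : ℤ, ((gammaProfile m h (x + l) : ℝ) : ℂ) = ∑' k, d k := hP
    rw [this, hsplit, add_sub_cancel_left]
    exact hrest
  rw [← Complex.ofReal_sub, Complex.norm_real, Real.norm_eq_abs] at hfin
  have e : 2 * h * ∑' l : ℤ, gammaProfile m h (x + l) - Real.Gamma (m + 1 / 2)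
      = 2 * h * (∑' l : ℤ, gammaProfile m h (x + l) - (2 * h)⁻¹ * Real.Gamma (m + 1 / 2)) := by
    field_simp
  rw [e, abs_mul, abs_of_pos hh2]
  calc _ ≤ 2 * h * ((2 * h)⁻¹ * ∑' k, u k) := by gcongr
    _ = ∑' k, u k := by field_simp
    _ ≤ _ := hus

/-! ### Series of Gaussians in the squared distance -/

/-- The rate `1 / s_ℓ²` at which the `ℓ`-th Gaussian decays in the squared distance. -/
def sogRate (b σ : ℝ) (l : ℤ) : ℝ := (sogWidth b σ l ^ 2)⁻¹

/-- The `m`-th derivative, up to sign, of the `ℓ`-th Gaussian in the squared distance `s`. -/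
def gaussTerm (b σ : ℝ) (m : ℕ) (s : ℝ) (l : ℤ) : ℝ :=
  sogWeight b σ l * sogRate b σ l ^ m * Real.exp (-(s * sogRate b σ l))

/-- The bilateral series of Gaussians with coefficients `c`. -/
def gaussSeries (b σ : ℝ) (c : ℤ → ℝ) (m : ℕ) (s : ℝ) : ℝ := ∑' l, c l * gaussTerm b σ m s l

/-- The function `s ^ (-(m + 1/2))`. -/
def invPow (m : ℕ) (s : ℝ) : ℝ := (√s ^ (2 * m + 1))⁻¹

/-- A sequence of functions on `(0, ∞)` each of which is minus the derivative of the previous one. -/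
def IsDerivChain (f : ℕ → ℝ → ℝ) : Prop :=
  ∀ m s, 0 < s → HasDerivAt (f m) (-f (m + 1) s) s

section basic
variable {b σ : ℝ}

lemma sogWidth_pos (hb : 1 < b) (hσ : 0 < σ) (l : ℤ) : 0 < sogWidth b σ l := by
  unfold sogWidth
  have : 0 < b := by linarith
  positivity

lemma sogRate_pos (hb : 1 < b) (hσ : 0 < σ) (l : ℤ) : 0 < sogRate b σ l := by
  have := sogWidth_pos hb hσ l
  unfold sogRate; positivity

lemma sogWeight_pos (hb : 1 < b) (hσ : 0 < σ) (l : ℤ) : 0 < sogWeight b σ l := by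
  unfold sogWeight
  have : 0 < b := by linarith
  have := Real.log_pos hb
  positivity

lemma gaussTerm_pos (hb : 1 < b) (hσ : 0 < σ) (m : ℕ) (s : ℝ) (l : ℤ) :
    0 < gaussTerm b σ m s l := by
  have := sogWeight_pos hb hσ l
  have := sogRate_pos hb hσ l
  unfold gaussTerm; positivity

lemma sogRate_eq (hb : 1 < b) (l : ℤ) : sogRate b σ l = sogRate b σ 0 * (b ^ (-l)) ^ 2 := by
  have : 0 < b := by linarith
  simp only [sogRate, sogWidth, zpow_neg, zpow_zero, mul_one, mul_pow, mul_inv, inv_pow]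
  ring

lemma sogWeight_eq (l : ℤ) : sogWeight b σ l = sogWeight b σ 0 * b ^ (-l) := by
  simp only [sogWeight, neg_zero, zpow_zero, mul_one]
  ring

lemma gaussTerm_succ (m : ℕ) (s : ℝ) (l : ℤ) :
    gaussTerm b σ (m + 1) s l = sogRate b σ l * gaussTerm b σ m s l := by
  unfold gaussTerm; ring

lemma gaussTerm_anti (hb : 1 < b) (hσ : 0 < σ) (m : ℕ) {s s' : ℝ} (h : s ≤ s') (l : ℤ) :
    gaussTerm b σ m s' l ≤ gaussTerm b σ m s l := by
  have := sogWeight_pos hb hσ l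
  have h2 := sogRate_pos hb hσ l
  unfold gaussTerm
  gcongr

lemma pow_mul_exp_neg_le (k : ℕ) {y : ℝ} (hy : 0 ≤ y) :
    y ^ k * Real.exp (-y) ≤ k.factorial := by
  have h3 := Real.pow_div_factorial_le_exp y hy k
  rw [Real.exp_neg, ← div_eq_mul_inv, div_le_iff₀ (Real.exp_pos _)]
  rwa [div_le_iff₀ (by positivity), mul_comm] at h3

/-- For `ℓ ≥ 0` the weight itself is geometric. For `ℓ = -n` the weight grows like `b ^ n` while the
rate grows like `b ^ (2n)`, so spending the exponential on one rate factor beyond the `m` present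
leaves `b ^ (-n)`. Uniformity in `s ≥ s₀` is what termwise differentiation needs. -/
lemma exists_gaussTerm_le (hb : 1 < b) (hσ : 0 < σ) (m : ℕ) {s₀ : ℝ} (hs₀ : 0 < s₀) :
    ∃ K : ℝ, 0 < K ∧ ∀ s, s₀ ≤ s → ∀ l, gaussTerm b σ m s l ≤ K * b⁻¹ ^ l.natAbs := by
  have hb0 : 0 < b := by linarith
  have hw := sogWeight_pos hb hσ 0
  have ht := sogRate_pos hb hσ 0
  refine ⟨sogWeight b σ 0 * sogRate b σ 0 ^ m
    + sogWeight b σ 0 * (m + 1).factorial / (s₀ ^ (m + 1) * sogRate b σ 0), by positivity,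
    fun s hs l => (gaussTerm_anti hb hσ m hs l).trans ?_⟩
  rcases le_total 0 l with hl | hl
  · obtain ⟨n, rfl⟩ := Int.eq_ofNat_of_zero_le hl
    have e : b ^ (-(n : ℤ)) = b⁻¹ ^ n := by simp
    have hle : b⁻¹ ^ n ≤ 1 := pow_le_one₀ (by positivity) (inv_le_one_of_one_le₀ hb.le)
    have hr : sogRate b σ n ≤ sogRate b σ 0 := by
      rw [sogRate_eq hb, e]
      have : (b⁻¹ ^ n) ^ 2 ≤ 1 := pow_le_one₀ (by positivity) hle
      nlinarith
    have hr0 := sogRate_pos hb hσ n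
    have hx : Real.exp (-(s₀ * sogRate b σ n)) ≤ 1 := by
      apply Real.exp_le_one_iff.2; have := mul_pos hs₀ hr0; linarith
    unfold gaussTerm
    rw [sogWeight_eq, e, Int.natAbs_natCast]
    calc _ ≤ sogWeight b σ 0 * b⁻¹ ^ n * sogRate b σ 0 ^ m * 1 := by gcongr
      _ = sogWeight b σ 0 * sogRate b σ 0 ^ m * b⁻¹ ^ n := by ring
      _ ≤ _ := by
        gcongr
        have : 0 ≤ sogWeight b σ 0 * (m + 1).factorial / (s₀ ^ (m + 1) * sogRate b σ 0) := by
          positivity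
        linarith
  · obtain ⟨n, hn⟩ := Int.eq_ofNat_of_zero_le (neg_nonneg.2 hl)
    have hl' : l = -(n : ℤ) := by omega
    subst hl'
    have e : b ^ (-(-(n : ℤ))) = b ^ n := by simp
    set t := sogRate b σ (-(n : ℤ)) with htdef
    have hr0 : 0 < t := sogRate_pos hb hσ _
    have ht2 : t = sogRate b σ 0 * (b ^ n) ^ 2 := by rw [htdef, sogRate_eq hb, e]
    have h1 := pow_mul_exp_neg_le (m + 1) (y := s₀ * t) (by positivity)
    have h2 : t ^ m * Real.exp (-(s₀ * t)) ≤ (m + 1).factorial / (s₀ ^ (m + 1) * t) := by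
      rw [le_div_iff₀ (by positivity)]
      calc _ = (s₀ * t) ^ (m + 1) * Real.exp (-(s₀ * t)) := by ring
        _ ≤ _ := h1
    unfold gaussTerm
    rw [sogWeight_eq, e, Int.natAbs_neg, Int.natAbs_natCast, mul_assoc]
    calc _ ≤ sogWeight b σ 0 * b ^ n * ((m + 1).factorial / (s₀ ^ (m + 1) * t)) := by gcongr
      _ = sogWeight b σ 0 * (m + 1).factorial / (s₀ ^ (m + 1) * sogRate b σ 0) * b⁻¹ ^ n := by
        rw [ht2, inv_pow]
        field_simp
      _ ≤ _ := by
        gcongr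
        have : 0 ≤ sogWeight b σ 0 * sogRate b σ 0 ^ m := by positivity
        linarith

lemma summable_inv_pow_natAbs (hb : 1 < b) : Summable fun l : ℤ => b⁻¹ ^ l.natAbs := by
  have : Summable fun n : ℕ => b⁻¹ ^ n :=
    summable_geometric_of_lt_one (by have : 0 < b := by linarith
                                     positivity) (inv_lt_one_of_one_lt₀ hb)
  apply Summable.of_nat_of_neg <;> simpa using this

/-- A bounded sequence of coefficients. -/
def IsBoundedCoeff (c : ℤ → ℝ) : Prop := ∃ B : ℝ, ∀ l, |c l| ≤ B

lemma IsBoundedCoeff.pos_bound {c : ℤ → ℝ} (hc : IsBoundedCoeff c) :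
    ∃ B : ℝ, 0 < B ∧ ∀ l, |c l| ≤ B := by
  obtain ⟨B, hB⟩ := hc
  exact ⟨|B| + 1, by positivity, fun l => (hB l).trans (by linarith [le_abs_self B])⟩

lemma summable_gaussTerm (hb : 1 < b) (hσ : 0 < σ) {c : ℤ → ℝ} (hc : IsBoundedCoeff c) (m : ℕ)
    {s : ℝ} (hs : 0 < s) : Summable fun l => c l * gaussTerm b σ m s l := by
  obtain ⟨B, hB0, hB⟩ := hc.pos_bound
  obtain ⟨K, hK, h⟩ := exists_gaussTerm_le hb hσ m hs
  refine Summable.of_norm_bounded ((summable_inv_pow_natAbs hb).mul_left (B * K)) fun l => ?_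
  rw [norm_mul, Real.norm_eq_abs, Real.norm_eq_abs, abs_of_pos (gaussTerm_pos hb hσ m s l),
    mul_assoc]
  have := gaussTerm_pos hb hσ m s l
  gcongr
  · exact hB l
  · exact h s le_rfl l

lemma isDerivChain_gaussSeries (hb : 1 < b) (hσ : 0 < σ) {c : ℤ → ℝ} (hc : IsBoundedCoeff c) :
    IsDerivChain (gaussSeries b σ c) := by
  intro m s hs
  obtain ⟨B, hB0, hB⟩ := hc.pos_bound
  obtain ⟨K, hK, h⟩ := exists_gaussTerm_le hb hσ (m + 1) (half_pos hs)
  have e : -gaussSeries b σ c (m + 1) s = ∑' l, -(c l * gaussTerm b σ (m + 1) s l) := by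
    rw [tsum_neg]; rfl
  rw [e]
  refine hasDerivAt_tsum_of_isPreconnected (u := fun l => B * K * b⁻¹ ^ l.natAbs)
    (t := Set.Ioi (s / 2)) (y₀ := s) ((summable_inv_pow_natAbs hb).mul_left _) isOpen_Ioi
    isPreconnected_Ioi (g := fun l s => c l * gaussTerm b σ m s l)
    (g' := fun l s => -(c l * gaussTerm b σ (m + 1) s l)) ?_ ?_ ?_
    (summable_gaussTerm hb hσ hc m hs) ?_
  · intro l y _
    have h1 : HasDerivAt (fun y : ℝ => Real.exp (-(y * sogRate b σ l)))
        (Real.exp (-(y * sogRate b σ l)) * (-(1 * sogRate b σ l))) y :=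
      (((hasDerivAt_id y).mul_const _).neg).exp
    have h2 := (h1.const_mul (sogWeight b σ l * sogRate b σ l ^ m)).const_mul (c l)
    refine h2.congr_deriv ?_
    unfold gaussTerm; ring
  · intro l y hy
    have := gaussTerm_pos hb hσ (m + 1) y l
    rw [norm_neg, norm_mul, Real.norm_eq_abs, Real.norm_eq_abs, abs_of_pos this, mul_assoc]
    gcongr
    · exact hB l
    · exact h y (le_of_lt hy) l
  · simp [hs]
  · simp [hs]

lemma gaussSeries_add (hb : 1 < b) (hσ : 0 < σ) {c c' : ℤ → ℝ} (hc : IsBoundedCoeff c)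
    (hc' : IsBoundedCoeff c') (m : ℕ) {s : ℝ} (hs : 0 < s) :
    gaussSeries b σ (fun l => c l + c' l) m s
      = gaussSeries b σ c m s + gaussSeries b σ c' m s := by
  unfold gaussSeries
  rw [← (summable_gaussTerm hb hσ hc m hs).tsum_add (summable_gaussTerm hb hσ hc' m hs)]
  simp only [add_mul]

end basic

/-! ### Inverse powers and the residual of the Gaussian series -/

lemma invPow_pos (m : ℕ) {s : ℝ} (hs : 0 < s) : 0 < invPow m s := by
  unfold invPow
  have := Real.sqrt_pos.2 hs
  positivity

lemma invPow_anti (m : ℕ) {s s' : ℝ} (hs : 0 < s) (h : s ≤ s') : invPow m s' ≤ invPow m s := by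
  unfold invPow
  have := Real.sqrt_pos.2 hs
  have := Real.sqrt_le_sqrt h
  gcongr

lemma hasDerivAt_invPow (m : ℕ) {s : ℝ} (hs : 0 < s) :
    HasDerivAt (invPow m) (-((m + 1 / 2) * invPow (m + 1) s)) s := by
  have h1 : HasDerivAt (fun s : ℝ => √s) (1 / (2 * √s)) s := Real.hasDerivAt_sqrt hs.ne'
  have h0 := Real.sqrt_pos.2 hs
  have h2 := (h1.fun_pow (2 * m + 1)).fun_inv (by positivity)
  refine h2.congr_deriv ?_
  unfold invPow
  push_cast
  field_simp
  ring

/-- The coefficients `Γ(m + 1/2) / Γ(1/2)` in the derivatives of `s ^ (-1/2)`. -/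
def halfGamma (m : ℕ) : ℝ := Real.Gamma (m + 1 / 2) / √Real.pi

lemma halfGamma_zero : halfGamma 0 = 1 := by
  unfold halfGamma
  rw [Nat.cast_zero, zero_add, Real.Gamma_one_half_eq, div_self (by positivity)]

lemma halfGamma_succ (m : ℕ) : halfGamma (m + 1) = (m + 1 / 2) * halfGamma m := by
  unfold halfGamma
  rw [show ((m + 1 : ℕ) : ℝ) + 1 / 2 = (m + 1 / 2) + 1 by push_cast; ring,
    Real.Gamma_add_one (by positivity)]
  ring

/-- The difference between `s ^ (-1/2)` and a series of Gaussians, and its derivatives. -/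
def sogResidual (b σ : ℝ) (c : ℤ → ℝ) (m : ℕ) (s : ℝ) : ℝ :=
  halfGamma m * invPow m s - gaussSeries b σ c m s

lemma isDerivChain_sogResidual {b σ : ℝ} (hb : 1 < b) (hσ : 0 < σ) {c : ℤ → ℝ}
    (hc : IsBoundedCoeff c) : IsDerivChain (sogResidual b σ c) := by
  intro m s hs
  refine (((hasDerivAt_invPow m hs).const_mul (halfGamma m)).sub
    (isDerivChain_gaussSeries hb hσ hc m s hs)).congr_deriv ?_
  unfold sogResidual
  rw [halfGamma_succ]
  ring

/-- The weight is a fixed multiple of the square root of the rate. Hence, apart from a power of `s`,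
the `ℓ`-th term depends on `s` and `ℓ` only through `s * sogRate b σ l`. -/
lemma sq_sogWeight {b σ : ℝ} (hb : 1 < b) (hσ : 0 < σ) (l : ℤ) :
    sogWeight b σ l = 2 * Real.log b / √Real.pi * √(sogRate b σ l) := by
  have hb0 : 0 < b := by linarith
  have := sogWidth_pos hb hσ l
  rw [sogRate, Real.sqrt_inv, Real.sqrt_sq this.le, sogWeight, sogWidth, Real.sqrt_div' _ zero_le_two,
    zpow_neg]
  have h2 : √2 ^ 2 = (2 : ℝ) := Real.sq_sqrt zero_le_two
  field_simp
  rw [h2, mul_comm]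

/-- Since `s * sogRate b σ l` is geometric in `ℓ`, its logarithm is affine in `ℓ`: the series
samples a single profile at equidistant points, and `s` and `σ` only shift the grid. The trapezoidal
estimate is uniform in that shift. -/
lemma gaussTerm_eq_gammaProfile {b σ : ℝ} (hb : 1 < b) (hσ : 0 < σ) (m : ℕ) {s : ℝ} (hs : 0 < s)
    (l : ℤ) : gaussTerm b σ m s l = invPow m s / √Real.pi * (2 * Real.log b *
      gammaProfile m (Real.log b) (-(Real.log (s * sogRate b σ 0) / (2 * Real.log b)) + l)) := by
  have hb0 : 0 < b := by linarith
  have hh := Real.log_pos hb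
  have ht0 := sogRate_pos hb hσ 0
  have ht := sogRate_pos hb hσ l
  set h := Real.log b with hhdef
  have e1 : -(2 * h * (-(Real.log (s * sogRate b σ 0) / (2 * h)) + l))
      = Real.log (s * sogRate b σ l) := by
    rw [sogRate_eq hb l, ← mul_assoc,
      Real.log_mul (x := s * sogRate b σ 0) (by positivity) (by positivity), Real.log_pow,
      Real.log_zpow, ← hhdef]
    push_cast
    field_simp
    ring
  have e2 : Real.exp (Real.log (s * sogRate b σ l)) = s * sogRate b σ l :=
    Real.exp_log (by positivity)
  unfold gammaProfile
  have e3 : -(2 * h * (m + 1 / 2) * (-(Real.log (s * sogRate b σ 0) / (2 * h)) + l))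
      = ((2 * m + 1 : ℕ) : ℝ) * (Real.log (s * sogRate b σ l) / 2) := by
    rw [← e1]; push_cast; ring
  rw [e3, e1, Real.exp_nat_mul, Real.exp_half, e2, gaussTerm, sq_sogWeight hb hσ, ← hhdef,
    Real.sqrt_mul hs.le, mul_pow, invPow]
  have h1 := Real.sqrt_pos.2 hs
  have h2 : √(sogRate b σ l) ^ (2 * m + 1) = √(sogRate b σ l) * sogRate b σ l ^ m := by
    rw [pow_succ, pow_mul, Real.sq_sqrt ht.le]; ring
  rw [h2]
  field_simp

/-- The bilateral series of Gaussians approximates `s ^ (-1/2)` exponentially well, together with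
its derivatives. -/
theorem abs_sogResidual_one_le (m : ℕ) : ∃ C : ℝ, 0 < C ∧ ∀ b σ s : ℝ, 1 < b → Real.log b < 1 →
    0 < σ → 0 < s → |sogResidual b σ (fun _ => 1) m s|
      ≤ C * ((Real.log b)⁻¹ ^ m * Real.exp (-(Real.pi ^ 2 / (2 * Real.log b)))) * invPow m s := by
  obtain ⟨C, hC, H⟩ := abs_tsum_gammaProfile_sub_le m
  refine ⟨C / √Real.pi, by positivity, fun b σ s hb hb1 hσ hs => ?_⟩
  have hh := Real.log_pos hb
  have hi := invPow_pos m hs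
  have := H (Real.log b) hh hb1 (-(Real.log (s * sogRate b σ 0) / (2 * Real.log b)))
  unfold sogResidual gaussSeries
  simp only [one_mul]
  simp_rw [gaussTerm_eq_gammaProfile hb hσ m hs]
  rw [tsum_mul_left, tsum_mul_left, halfGamma, abs_sub_comm]
  set A := 2 * Real.log b * ∑' l : ℤ, gammaProfile m (Real.log b)
    (-(Real.log (s * sogRate b σ 0) / (2 * Real.log b)) + l)
  rw [show invPow m s / √Real.pi * A - Real.Gamma (m + 1 / 2) / √Real.pi * invPow m s
    = invPow m s / √Real.pi * (A - Real.Gamma (m + 1 / 2)) by ring, abs_mul,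
    abs_of_pos (by positivity)]
  calc _ ≤ invPow m s / √Real.pi *
        (C * ((Real.log b)⁻¹ ^ m * Real.exp (-(Real.pi ^ 2 / (2 * Real.log b))))) := by gcongr
    _ = _ := by ring

/-! ### Splitting of the residual and the `C¹` conditions -/

/-- The coefficients of the far part. -/
def farCoeff (ω : ℝ) (M : ℕ) (l : ℤ) : ℝ :=
  if l < 0 then 0 else if l = 0 then ω else if l ≤ M then 1 else 0

/-- The coefficients of the truncated tail of wide Gaussians. -/
def tailCoeff (M : ℕ) (l : ℤ) : ℝ := if (M : ℤ) < l then 1 else 0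

/-- The coefficients of the Gaussians `ℓ ≤ 0` missing from the far part. -/
def narrowCoeff (ω : ℝ) (l : ℤ) : ℝ := if l < 0 then 1 else if l = 0 then 1 - ω else 0

/-- The coefficients of the Gaussians `ℓ < -1`. -/
def deepCoeff (l : ℤ) : ℝ := if l < -1 then 1 else 0

lemma isBoundedCoeff_farCoeff (ω : ℝ) (M : ℕ) : IsBoundedCoeff (farCoeff ω M) :=
  ⟨|ω| + 1, fun l => by
    have := abs_nonneg ω
    unfold farCoeff; split_ifs <;> simp <;> linarith⟩

lemma isBoundedCoeff_narrowCoeff (ω : ℝ) : IsBoundedCoeff (narrowCoeff ω) :=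
  ⟨|1 - ω| + 1, fun l => by
    have := abs_nonneg (1 - ω)
    unfold narrowCoeff; split_ifs <;> (simp; try linarith)⟩

lemma isBoundedCoeff_tailCoeff (M : ℕ) : IsBoundedCoeff (tailCoeff M) :=
  ⟨1, fun l => by unfold tailCoeff; split_ifs <;> norm_num⟩

lemma isBoundedCoeff_deepCoeff : IsBoundedCoeff deepCoeff :=
  ⟨1, fun l => by unfold deepCoeff; split_ifs <;> simp⟩

lemma isBoundedCoeff_one : IsBoundedCoeff fun _ => 1 := ⟨1, fun l => by simp⟩

lemma tailCoeff_nonneg (M : ℕ) (l : ℤ) : 0 ≤ tailCoeff M l := by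
  unfold tailCoeff; split_ifs <;> norm_num

lemma deepCoeff_nonneg (l : ℤ) : 0 ≤ deepCoeff l := by
  unfold deepCoeff; split_ifs <;> norm_num

lemma farPart_eq (b σ ω : ℝ) (M : ℕ) (r : ℝ) :
    farPart b σ ω M r = gaussSeries b σ (farCoeff ω M) 0 (r ^ 2) := by
  unfold gaussSeries
  rw [tsum_eq_sum (s := (Finset.range (M + 1)).map Nat.castEmbedding)]
  · rw [Finset.sum_map, farPart]
    refine Finset.sum_congr rfl fun l hl => ?_
    have hl' : l ≤ M := by simpa [Nat.lt_succ_iff] using hl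
    simp only [Nat.castEmbedding_apply, gaussTerm, sogRate, farWeight, farCoeff, pow_zero, mul_one,
      div_eq_mul_inv]
    rcases Nat.eq_zero_or_pos l with rfl | h
    · simp; ring
    · have h1 : l ≠ 0 := h.ne'
      simp [h1, hl']
  · intro l hl
    have : farCoeff ω M l = 0 := by
      unfold farCoeff
      split_ifs with h1 h2 h3
      · rfl
      · exfalso; apply hl; subst h2; simp
      · exfalso; apply hl
        obtain ⟨n, rfl⟩ := Int.eq_ofNat_of_zero_le (not_lt.1 h1)
        simp only [Finset.mem_map, Finset.mem_range, Nat.castEmbedding_apply]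
        exact ⟨n, by omega, rfl⟩
      · rfl
    rw [this, zero_mul]

section
variable {b σ : ℝ}

/-- The three coefficient sequences far, tail and narrow add up to `1`; at `ℓ = 0` this is `ω + (1 -
ω)`. -/
lemma sogResidual_farCoeff (hb : 1 < b) (hσ : 0 < σ) (ω : ℝ) (M m : ℕ) {s : ℝ} (hs : 0 < s) :
    sogResidual b σ (farCoeff ω M) m s = sogResidual b σ (fun _ => 1) m s
      + gaussSeries b σ (tailCoeff M) m s + gaussSeries b σ (narrowCoeff ω) m s := by
  have h1 := gaussSeries_add hb hσ (isBoundedCoeff_tailCoeff M) (isBoundedCoeff_narrowCoeff ω) m hs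
  have hbd : IsBoundedCoeff fun l => tailCoeff M l + narrowCoeff ω l := by
    obtain ⟨B, hB⟩ := isBoundedCoeff_tailCoeff M
    obtain ⟨B', hB'⟩ := isBoundedCoeff_narrowCoeff ω
    exact ⟨B + B', fun l => (abs_add_le _ _).trans (add_le_add (hB l) (hB' l))⟩
  have h2 := gaussSeries_add hb hσ (isBoundedCoeff_farCoeff ω M) hbd m hs
  have h3 : (fun l => farCoeff ω M l + (tailCoeff M l + narrowCoeff ω l)) = fun _ => 1 := by
    funext l
    unfold farCoeff tailCoeff narrowCoeff
    split_ifs <;> first | omega | simp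
  rw [h3, h1] at h2
  unfold sogResidual
  linarith

/-- Isolates the pair of terms that enters the error bound with its sign; what remains is
nonnegative. -/
lemma gaussSeries_narrowCoeff (hb : 1 < b) (hσ : 0 < σ) (ω : ℝ) (m : ℕ) {s : ℝ} (hs : 0 < s) :
    gaussSeries b σ (narrowCoeff ω) m s = gaussSeries b σ deepCoeff m s
      + (gaussTerm b σ m s (-1) + (1 - ω) * gaussTerm b σ m s 0) := by
  have hbd : IsBoundedCoeff fun l => if l = -1 then 1 else if l = 0 then 1 - ω else 0 :=
    ⟨|1 - ω| + 1, fun l => by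
      have := abs_nonneg (1 - ω)
      dsimp only
      split_ifs <;> (simp; try linarith)⟩
  have h1 := gaussSeries_add hb hσ isBoundedCoeff_deepCoeff hbd m hs
  have h3 : (fun l => deepCoeff l + if l = -1 then 1 else if l = 0 then 1 - ω else 0)
      = narrowCoeff ω := by
    funext l
    unfold deepCoeff narrowCoeff
    split_ifs <;> first | omega | simp
  rw [h3] at h1
  rw [h1]
  congr 1
  unfold gaussSeries
  rw [tsum_eq_sum (s := {-1, 0})]
  · rw [Finset.sum_pair (by norm_num)]; simp
  · intro l hl
    simp only [Finset.mem_insert, Finset.mem_singleton, not_or] at hl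
    simp [hl.1, hl.2]

lemma gaussTerm_eq_mul_exp (m : ℕ) (s s' : ℝ) (l : ℤ) :
    gaussTerm b σ m s l = gaussTerm b σ m s' l * Real.exp (-((s - s') * sogRate b σ l)) := by
  unfold gaussTerm
  rw [mul_assoc _ (Real.exp _), ← Real.exp_add]
  congr 2; ring

lemma sogRate_le (hb : 1 < b) (hσ : 0 < σ) {l l' : ℤ} (h : l ≤ l') :
    sogRate b σ l' ≤ sogRate b σ l := by
  have := sogWidth_pos hb hσ l
  unfold sogRate sogWidth at *
  gcongr
  exact hb.le

/-- The size at squared distance `s` of the Gaussians `ℓ ≤ 0` missing from the far part. -/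
def narrowSize (b σ ω : ℝ) (m : ℕ) (s : ℝ) : ℝ :=
  gaussSeries b σ deepCoeff m s + gaussTerm b σ m s (-1) + |1 - ω| * gaussTerm b σ m s 0

lemma gaussSeries_nonneg (hb : 1 < b) (hσ : 0 < σ) {c : ℤ → ℝ} (hc : ∀ l, 0 ≤ c l) (m : ℕ) (s : ℝ) :
    0 ≤ gaussSeries b σ c m s :=
  tsum_nonneg fun l => mul_nonneg (hc l) (gaussTerm_pos hb hσ m s l).le

lemma narrowSize_nonneg (hb : 1 < b) (hσ : 0 < σ) (ω : ℝ) (m : ℕ) (s : ℝ) :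
    0 ≤ narrowSize b σ ω m s := by
  have h1 := gaussSeries_nonneg hb hσ deepCoeff_nonneg m s
  have h2 := gaussTerm_pos hb hσ m s (-1)
  have h3 := gaussTerm_pos hb hσ m s 0
  unfold narrowSize
  positivity

/-- Every Gaussian with `ℓ ≤ 0` decays at least as fast as the one with `ℓ = 0`. -/
lemma abs_gaussSeries_narrowCoeff_le (hb : 1 < b) (hσ : 0 < σ) (ω : ℝ) (m : ℕ) {s s' : ℝ}
    (hs' : 0 < s') (h : s' ≤ s) :
    |gaussSeries b σ (narrowCoeff ω) m s|
      ≤ narrowSize b σ ω m s' * Real.exp (-((s - s') * sogRate b σ 0)) := by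
  have hs : 0 < s := hs'.trans_le h
  set e := Real.exp (-((s - s') * sogRate b σ 0)) with he
  have hterm : ∀ l ≤ 0, gaussTerm b σ m s l ≤ gaussTerm b σ m s' l * e := by
    intro l hl
    rw [gaussTerm_eq_mul_exp m s s' l]
    have := gaussTerm_pos hb hσ m s' l
    have h1 := sogRate_le hb hσ hl
    have h2 : 0 ≤ s - s' := sub_nonneg.2 h
    rw [he]; gcongr
  have hdeep : gaussSeries b σ deepCoeff m s ≤ gaussSeries b σ deepCoeff m s' * e := by
    unfold gaussSeries
    rw [← tsum_mul_right]
    refine (summable_gaussTerm hb hσ isBoundedCoeff_deepCoeff m hs).tsum_le_tsum ?_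
      ((summable_gaussTerm hb hσ isBoundedCoeff_deepCoeff m hs').mul_right _)
    intro l
    unfold deepCoeff
    split_ifs with hl
    · simpa using hterm l (by omega)
    · simp
  rw [gaussSeries_narrowCoeff hb hσ ω m hs]
  have h0 := gaussSeries_nonneg hb hσ deepCoeff_nonneg m s
  have h1 := gaussTerm_pos hb hσ m s (-1)
  have h2 := gaussTerm_pos hb hσ m s 0
  calc _ ≤ |gaussSeries b σ deepCoeff m s| + (|gaussTerm b σ m s (-1)|
        + |(1 - ω) * gaussTerm b σ m s 0|) :=
        (abs_add_le _ _).trans (by gcongr; exact abs_add_le _ _)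
    _ = gaussSeries b σ deepCoeff m s + (gaussTerm b σ m s (-1)
        + |1 - ω| * gaussTerm b σ m s 0) := by
        rw [abs_mul, abs_of_nonneg h0, abs_of_pos h1, abs_of_pos h2]
    _ ≤ gaussSeries b σ deepCoeff m s' * e + (gaussTerm b σ m s' (-1) * e
        + |1 - ω| * (gaussTerm b σ m s' 0 * e)) := by
        gcongr
        · exact hterm _ (by norm_num)
        · exact hterm _ le_rfl
    _ = _ := by unfold narrowSize; ring

lemma sogResidual_sq (ω : ℝ) (M : ℕ) {r : ℝ} (hr : 0 < r) :
    1 / r - farPart b σ ω M r = sogResidual b σ (farCoeff ω M) 0 (r ^ 2) := by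
  rw [farPart_eq, sogResidual, halfGamma_zero, invPow, Real.sqrt_sq hr.le]
  simp

lemma IsC1Splitting.sogResidual_eq_zero (hb : 1 < b) (hσ : 0 < σ) {ω : ℝ} {M : ℕ} {rc : ℝ}
    (hrc : 0 < rc) (h : IsC1Splitting b σ ω M rc) :
    sogResidual b σ (farCoeff ω M) 0 (rc ^ 2) = 0 ∧
      sogResidual b σ (farCoeff ω M) 1 (rc ^ 2) = 0 := by
  refine ⟨by rw [← sogResidual_sq ω M hrc]; exact h.value_eq, ?_⟩
  have h1 : HasDerivAt (fun r : ℝ => sogResidual b σ (farCoeff ω M) 0 (r ^ 2))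
      (-sogResidual b σ (farCoeff ω M) 1 (rc ^ 2) * (2 * rc)) rc := by
    have hd := isDerivChain_sogResidual hb hσ (isBoundedCoeff_farCoeff ω M) 0 (rc ^ 2)
      (by positivity)
    have hp : HasDerivAt (fun r : ℝ => r ^ 2) (2 * rc) rc := by
      simpa using hasDerivAt_pow 2 rc
    exact HasDerivAt.comp (h := fun r : ℝ => r ^ 2) rc hd hp
  have h2 : (fun r : ℝ => 1 / r - farPart b σ ω M r) =ᶠ[𝓝 rc]
      fun r : ℝ => sogResidual b σ (farCoeff ω M) 0 (r ^ 2) := by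
    filter_upwards [lt_mem_nhds hrc] with r hr using sogResidual_sq ω M hr
  have h3 := h.deriv_eq
  rw [h2.deriv_eq, h1.deriv] at h3
  have : (2 * rc) ≠ 0 := by positivity
  simpa [this] using h3

/-! ### Sizes of the pieces at the cutoff -/

/-- The signed contribution at squared distance `s` of the Gaussians `ℓ = -1, 0` missing from the
far part. -/
def mismatch (b σ ω : ℝ) (m : ℕ) (s : ℝ) : ℝ :=
  gaussTerm b σ m s (-1) + (1 - ω) * gaussTerm b σ m s 0

/-- The size of the error of the trapezoidal rule. -/
def quadSize (b : ℝ) : ℝ :=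
  Real.log b ^ (-(3 / 2) : ℝ) * Real.exp (-(Real.pi ^ 2 / (2 * Real.log b)))

lemma quadSize_pos (hb : 1 < b) : 0 < quadSize b := by
  have := Real.log_pos hb
  unfold quadSize; positivity

lemma inv_log_pow_mul_le (hb : 1 < b) (hb1 : Real.log b < 1) {m : ℕ} (hm : m ≤ 1) :
    (Real.log b)⁻¹ ^ m * Real.exp (-(Real.pi ^ 2 / (2 * Real.log b))) ≤ quadSize b := by
  have h0 := Real.log_pos hb
  unfold quadSize
  gcongr
  rw [← Real.rpow_natCast, Real.inv_rpow h0.le, ← Real.rpow_neg h0.le]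
  apply Real.rpow_le_rpow_of_exponent_ge h0 hb1.le
  have : (m : ℝ) ≤ 1 := by exact_mod_cast hm
  linarith

/-- The Gaussian `ℓ = -1` is controlled by the narrower ones, unless it is already as small as the
error of the trapezoidal rule. -/
lemma gaussTerm_neg_one_le (m : ℕ) {rmin : ℝ} (hrmin : 0 < rmin) : ∃ C : ℝ, 0 < C ∧
    ∀ b σ rc : ℝ, 1 < b → b < 2 → 0 < σ → sogWidth b σ 0 < rc → rmin ≤ rc →
      gaussTerm b σ m (rc ^ 2) (-1)
        ≤ C * (gaussSeries b σ deepCoeff m (rc ^ 2) + quadSize b) := by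
  refine ⟨Real.exp (6 * Real.pi ^ 2) + 2 * (2 ^ (m + 1) * (m + 1).factorial) * invPow m (rmin ^ 2),
    by have := invPow_pos m (s := rmin ^ 2) (by positivity)
       positivity, ?_⟩
  intro b σ rc hb hb2 hσ hs0 hrc
  have hrc0 : 0 < rc := hrmin.trans_le hrc
  have hb0 : 0 < b := by linarith
  have hh := Real.log_pos hb
  have hh1 : Real.log b < 1 := by
    have := Real.log_lt_sub_one_of_pos hb0 hb.ne'
    linarith
  set h := Real.log b with hdef
  have hq := quadSize_pos hb
  have hdeep := gaussSeries_nonneg hb hσ deepCoeff_nonneg m (rc ^ 2)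
  have ht := sogRate_pos hb hσ (-1)
  set t := sogRate b σ (-1) with htdef
  set y := rc ^ 2 * t with hy
  have hi := invPow_pos m (s := rmin ^ 2) (by positivity)
  have hy1 : 1 ≤ y := by
    have h1 : 1 ≤ rc ^ 2 * sogRate b σ 0 := by
      have := sogWidth_pos hb hσ 0
      rw [sogRate, ← div_eq_mul_inv, one_le_div (by positivity)]
      gcongr
    have h2 := sogRate_le hb hσ (show (-1 : ℤ) ≤ 0 by norm_num)
    refine h1.trans ?_
    rw [hy]; gcongr
  -- If `h * y ≤ π²`, the exponents for `ℓ = -1` and `ℓ = -2` differ by `(b² - 1) y ≤ 6 h y ≤ 6π²`,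
  -- so the two terms are comparable. Otherwise half of the exponent already gives `exp (-π² /
  -- (2h))`, and the other half absorbs the powers of `y`.
  rcases le_total (h * y) (Real.pi ^ 2) with hc | hc
  · have hterm : gaussTerm b σ m (rc ^ 2) (-2) ≤ gaussSeries b σ deepCoeff m (rc ^ 2) := by
      have := (summable_gaussTerm hb hσ isBoundedCoeff_deepCoeff m
        (s := rc ^ 2) (by positivity)).le_tsum (-2) fun l _ =>
          mul_nonneg (deepCoeff_nonneg l) (gaussTerm_pos hb hσ m (rc ^ 2) l).le
      simpa [deepCoeff, gaussSeries] using this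
    have ht2 : sogRate b σ (-2) = b ^ 2 * t := by
      rw [htdef, sogRate_eq hb (-2), sogRate_eq hb (-1)]
      norm_num
      ring
    have hw2 : sogWeight b σ (-1) ≤ sogWeight b σ (-2) := by
      rw [sogWeight_eq (-1), sogWeight_eq (-2)]
      have := sogWeight_pos hb hσ 0
      gcongr
      · exact hb.le
      · norm_num
    have hbb : b ^ 2 - 1 ≤ 6 * h := by
      have := Real.one_sub_inv_le_log_of_pos hb0
      rw [← hdef] at this
      have h2 : b - 1 ≤ b * h := by
        have e : b * (1 - b⁻¹) = b - 1 := by field_simp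
        nlinarith
      nlinarith
    have hE : Real.exp (-y) ≤ Real.exp (6 * Real.pi ^ 2) *
        Real.exp (-(rc ^ 2 * (b ^ 2 * t))) := by
      rw [← Real.exp_add]
      apply Real.exp_le_exp.2
      have : rc ^ 2 * (b ^ 2 * t) = b ^ 2 * y := by rw [hy]; ring
      rw [this]
      nlinarith
    have : gaussTerm b σ m (rc ^ 2) (-1)
        ≤ Real.exp (6 * Real.pi ^ 2) * gaussTerm b σ m (rc ^ 2) (-2) := by
      have hw := sogWeight_pos hb hσ (-1)
      have hw' := sogWeight_pos hb hσ (-2)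
      unfold gaussTerm
      rw [ht2, ← htdef, ← hy]
      calc _ ≤ sogWeight b σ (-2) * (b ^ 2 * t) ^ m * (Real.exp (6 * Real.pi ^ 2) *
            Real.exp (-(rc ^ 2 * (b ^ 2 * t)))) := by
            gcongr
            exact le_mul_of_one_le_left ht.le (one_le_pow₀ hb.le)
        _ = _ := by ring
    calc _ ≤ Real.exp (6 * Real.pi ^ 2) * gaussTerm b σ m (rc ^ 2) (-2) := this
      _ ≤ Real.exp (6 * Real.pi ^ 2) * (gaussSeries b σ deepCoeff m (rc ^ 2) + quadSize b) := by
        gcongr; linarith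
      _ ≤ _ := by gcongr; linarith [show 0 ≤ 2 * (2 ^ (m + 1) * ((m + 1).factorial : ℝ))
                    * invPow m (rmin ^ 2) by positivity]
  · have hX : Real.pi ^ 2 / (2 * h) ≤ y / 2 := by
      rw [div_le_div_iff₀ (by positivity) (by norm_num)]; nlinarith
    have hp := pow_mul_exp_neg_le (m + 1) (y := y / 2) (by positivity)
    have hsy : √t ^ (2 * m + 1) ≤ y ^ (m + 1) * invPow m (rmin ^ 2) := by
      have h1 : √t = √y * rc⁻¹ := by
        rw [hy, Real.sqrt_mul (by positivity), Real.sqrt_sq hrc0.le]; field_simp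
      have h2 : rc⁻¹ ^ (2 * m + 1) ≤ invPow m (rmin ^ 2) := by
        unfold invPow
        rw [Real.sqrt_sq hrmin.le, ← inv_pow]
        gcongr
      have h3 : √y ^ (2 * m + 1) ≤ y ^ (m + 1) := by
        calc √y ^ (2 * m + 1) ≤ √y ^ (2 * (m + 1)) :=
              pow_le_pow_right₀ (Real.one_le_sqrt.2 hy1) (by omega)
          _ = _ := by rw [pow_mul, Real.sq_sqrt (by positivity)]
      rw [h1, mul_pow]
      gcongr
    have hc2 : 2 * h / √Real.pi ≤ 2 := by
      have : 1 ≤ √Real.pi := Real.one_le_sqrt.2 (by linarith [Real.pi_gt_three])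
      rw [div_le_iff₀ (by positivity)]; nlinarith
    have hq1 := inv_log_pow_mul_le hb hh1 (m := 0) (by norm_num)
    rw [pow_zero, one_mul, ← hdef] at hq1
    have e : gaussTerm b σ m (rc ^ 2) (-1) = 2 * h / √Real.pi * √t ^ (2 * m + 1) *
        (Real.exp (-(y / 2)) * Real.exp (-(y / 2))) := by
      unfold gaussTerm
      rw [sq_sogWeight hb hσ, ← Real.exp_add, ← htdef, ← hy, ← hdef, pow_succ, pow_mul, Real.sq_sqrt ht.le]
      ring_nf
    rw [e]
    calc _ ≤ 2 * (y ^ (m + 1) * invPow m (rmin ^ 2)) *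
          (Real.exp (-(y / 2)) * Real.exp (-(Real.pi ^ 2 / (2 * h)))) := by gcongr
      _ = 2 * (2 ^ (m + 1) * ((y / 2) ^ (m + 1) * Real.exp (-(y / 2)))) * invPow m (rmin ^ 2)
          * Real.exp (-(Real.pi ^ 2 / (2 * h))) := by rw [div_pow]; field_simp
      _ ≤ 2 * (2 ^ (m + 1) * (m + 1).factorial) * invPow m (rmin ^ 2) * quadSize b := by gcongr
      _ ≤ 2 * (2 ^ (m + 1) * (m + 1).factorial) * invPow m (rmin ^ 2) *
          (gaussSeries b σ deepCoeff m (rc ^ 2) + quadSize b) := by gcongr; linarith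
      _ ≤ _ := by gcongr; linarith [Real.exp_pos (6 * Real.pi ^ 2)]

end

/-- The parameters of a `C¹` splitting with cutoff radius at least `rmin`, in a cell whose longest
period is `Λ`. -/
structure IsAdmissible (Λ rmin b σ ω rc : ℝ) (M : ℕ) : Prop where
  one_lt : 1 < b
  lt_two : b < 2
  pos : 0 < σ
  c1 : IsC1Splitting b σ ω M rc
  width_lt : sogWidth b σ 0 < rc
  rmin_le : rmin ≤ rc
  cutoff_le : 2 * rc ≤ Λ
  le_width : Λ ≤ sogWidth b σ (M + 1)

lemma IsAdmissible.log_lt_one {Λ rmin b σ ω rc : ℝ} {M : ℕ}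
    (h : IsAdmissible Λ rmin b σ ω rc M) : Real.log b < 1 := by
  have := Real.log_lt_sub_one_of_pos (by linarith [h.one_lt]) h.one_lt.ne'
  linarith [h.lt_two]

/-- The scale of the error caused by the `m`-th derivatives, with `s` the squared cutoff. -/
def errScale (b σ ω : ℝ) (m : ℕ) (s : ℝ) : ℝ := quadSize b + |mismatch b σ ω m s|

lemma quadSize_le_errScale (b σ ω : ℝ) (m : ℕ) (s : ℝ) : quadSize b ≤ errScale b σ ω m s := by
  unfold errScale; linarith [abs_nonneg (mismatch b σ ω m s)]

/-- The `m`-th `C¹` condition reads `ε + T + D + μ = 0` with residual `ε`, tail `T ≥ 0`, deep part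
`D ≥ 0` and mismatch `μ`, so there is no cancellation between `T` and `D`. The term `A` for `ℓ = -1`
then follows from `D`, and the term for `ℓ = 0` from `μ` and `A`. -/
lemma exists_size_bounds_of_le_one {rmin : ℝ} (hrmin : 0 < rmin) (Λ : ℝ) {m : ℕ} (hm : m ≤ 1) :
    ∃ C : ℝ, 0 < C ∧ ∀ (b σ ω rc : ℝ) (M : ℕ), IsAdmissible Λ rmin b σ ω rc M →
      |sogResidual b σ (fun _ => 1) m (rc ^ 2)| ≤ C * quadSize b ∧
      gaussSeries b σ (tailCoeff M) m (rc ^ 2) ≤ C * errScale b σ ω m (rc ^ 2) ∧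
      gaussSeries b σ deepCoeff m (rc ^ 2) + gaussTerm b σ m (rc ^ 2) (-1)
        ≤ C * errScale b σ ω m (rc ^ 2) ∧
      narrowSize b σ ω m (rc ^ 2) ≤ C * errScale b σ ω m (rc ^ 2) := by
  obtain ⟨ce, hce, Hε⟩ := abs_sogResidual_one_le m
  obtain ⟨ca, hca, HA⟩ := gaussTerm_neg_one_le m hrmin
  have hi := invPow_pos m (s := rmin ^ 2) (by positivity)
  set e := ce * invPow m (rmin ^ 2) with he
  have he0 : 0 < e := by positivity
  refine ⟨e + 2 + 2 * (ca * (e + 2)), by positivity, ?_⟩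
  intro b σ ω rc M h
  have hb := h.one_lt
  have hσ := h.pos
  have hrc : 0 < rc := hrmin.trans_le h.rmin_le
  have hq := quadSize_pos hb
  have h1 : |sogResidual b σ (fun _ => 1) m (rc ^ 2)| ≤ e * quadSize b := by
    refine (Hε b σ (rc ^ 2) hb h.log_lt_one hσ (by positivity)).trans ?_
    have h2 := inv_log_pow_mul_le hb h.log_lt_one hm
    have h3 : invPow m (rc ^ 2) ≤ invPow m (rmin ^ 2) :=
      invPow_anti m (by positivity) (by have := h.rmin_le; gcongr)
    have h4 := invPow_pos m (s := rc ^ 2) (by positivity)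
    calc _ ≤ ce * quadSize b * invPow m (rmin ^ 2) := by gcongr
      _ = _ := by rw [he]; ring
  have hA := HA b σ rc hb h.lt_two hσ h.width_lt h.rmin_le
  have hz : sogResidual b σ (farCoeff ω M) m (rc ^ 2) = 0 := by
    obtain ⟨z0, z1⟩ := h.c1.sogResidual_eq_zero hb hσ hrc
    interval_cases m
    · exact z0
    · exact z1
  rw [sogResidual_farCoeff hb hσ ω M m (by positivity),
    gaussSeries_narrowCoeff hb hσ ω m (by positivity)] at hz
  have hmis : gaussTerm b σ m (rc ^ 2) (-1) + (1 - ω) * gaussTerm b σ m (rc ^ 2) 0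
      = mismatch b σ ω m (rc ^ 2) := rfl
  have hS : errScale b σ ω m (rc ^ 2) = quadSize b + |mismatch b σ ω m (rc ^ 2)| := rfl
  have hT := gaussSeries_nonneg hb hσ (tailCoeff_nonneg M) m (rc ^ 2)
  have hD := gaussSeries_nonneg hb hσ deepCoeff_nonneg m (rc ^ 2)
  have hg1 := gaussTerm_pos hb hσ m (rc ^ 2) (-1)
  have hg0 := gaussTerm_pos hb hσ m (rc ^ 2) 0
  rw [hmis] at hz
  unfold narrowSize
  have hR : |1 - ω| * gaussTerm b σ m (rc ^ 2) 0
      ≤ |mismatch b σ ω m (rc ^ 2)| + gaussTerm b σ m (rc ^ 2) (-1) := by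
    have : (1 - ω) * gaussTerm b σ m (rc ^ 2) 0
        = mismatch b σ ω m (rc ^ 2) - gaussTerm b σ m (rc ^ 2) (-1) := by rw [← hmis]; ring
    have h5 : |1 - ω| * gaussTerm b σ m (rc ^ 2) 0
        = |(1 - ω) * gaussTerm b σ m (rc ^ 2) 0| := by rw [abs_mul, abs_of_pos hg0]
    rw [h5, this]
    refine (abs_sub _ _).trans ?_
    rw [abs_of_pos hg1]
  rw [hS]
  generalize quadSize b = q at *
  generalize mismatch b σ ω m (rc ^ 2) = μ at *
  generalize gaussSeries b σ (tailCoeff M) m (rc ^ 2) = T at *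
  generalize gaussSeries b σ deepCoeff m (rc ^ 2) = D at *
  generalize gaussTerm b σ m (rc ^ 2) (-1) = A at *
  generalize |1 - ω| * gaussTerm b σ m (rc ^ 2) 0 = B at *
  generalize sogResidual b σ (fun _ => 1) m (rc ^ 2) = ε at *
  have hμ0 := abs_nonneg μ
  have hTD : T + D ≤ (e + 1) * (q + |μ|) := by
    have := neg_abs_le ε
    have := neg_abs_le μ
    have : 0 ≤ e * |μ| := by positivity
    nlinarith
  have hA' : A ≤ ca * (e + 2) * (q + |μ|) := by
    refine hA.trans ?_
    rw [mul_assoc]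
    gcongr
    nlinarith
  have hca2 : 0 ≤ ca * (e + 2) * q := by positivity
  have hca3 : 0 ≤ ca * (e + 2) * (q + |μ|) := by positivity
  refine ⟨by nlinarith, by nlinarith, by nlinarith, by nlinarith⟩

/-- The wide Gaussians missing from the far part, and the narrow ones, are bounded by the scale of
the error; by `C¹` continuity the wide ones are even bounded by the scale of the force error. -/
lemma exists_size_bounds {rmin : ℝ} (hrmin : 0 < rmin) {Λ : ℝ} (hΛ : 0 < Λ) :
    ∃ C : ℝ, 0 < C ∧ ∀ (b σ ω rc : ℝ) (M : ℕ), IsAdmissible Λ rmin b σ ω rc M →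
      ∀ m ≤ 1, gaussSeries b σ (tailCoeff M) 0 (rc ^ 2) ≤ C * errScale b σ ω m (rc ^ 2) ∧
        gaussSeries b σ (tailCoeff M) m (rc ^ 2) ≤ C * errScale b σ ω m (rc ^ 2) ∧
        narrowSize b σ ω m (rc ^ 2) ≤ C * errScale b σ ω m (rc ^ 2) := by
  obtain ⟨c0, hc0, H0⟩ := exists_size_bounds_of_le_one hrmin Λ (m := 0) (by norm_num)
  obtain ⟨c1, hc1, H1⟩ := exists_size_bounds_of_le_one hrmin Λ (m := 1) le_rfl
  refine ⟨c0 + c1 + 3 * c1 * Λ ^ 2, by positivity, ?_⟩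
  intro b σ ω rc M h
  have hb := h.one_lt
  have hσ := h.pos
  have hrc : 0 < rc := hrmin.trans_le h.rmin_le
  have hq := quadSize_pos hb
  obtain ⟨e0, T0, D0, R0⟩ := H0 b σ ω rc M h
  obtain ⟨e1, T1, D1, R1⟩ := H1 b σ ω rc M h
  obtain ⟨z0, z1⟩ := h.c1.sogResidual_eq_zero hb hσ hrc
  have hS0 : 0 < errScale b σ ω 0 (rc ^ 2) := hq.trans_le (quadSize_le_errScale ..)
  have hS1 : 0 < errScale b σ ω 1 (rc ^ 2) := hq.trans_le (quadSize_le_errScale ..)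
  have hqS1 := quadSize_le_errScale b σ ω 1 (rc ^ 2)
  -- The term `ℓ = 0` satisfies `g₁ = t₀ g₀` with `t₀` its rate, so subtracting `t₀` times the value
  -- condition from the derivative condition eliminates `ω`. This bounds `t₀ T₀` by first-order
  -- quantities and the residual, and `t₀⁻¹` is the square of a width below `Λ`.
  have key : gaussSeries b σ (tailCoeff M) 0 (rc ^ 2)
      ≤ (c0 + 3 * c1 * Λ ^ 2) * errScale b σ ω 1 (rc ^ 2) := by
    rw [sogResidual_farCoeff hb hσ ω M _ (by positivity),
      gaussSeries_narrowCoeff hb hσ ω _ (by positivity)] at z0 z1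
    have g0 := gaussTerm_succ (b := b) (σ := σ) 0 (rc ^ 2) 0
    have ht := sogRate_pos hb hσ 0
    have htL : (sogRate b σ 0)⁻¹ ≤ Λ ^ 2 := by
      have := sogWidth_pos hb hσ 0
      rw [sogRate, inv_inv]
      have : sogWidth b σ 0 ≤ Λ := by linarith [h.width_lt, h.cutoff_le]
      gcongr
    have hD0 := gaussSeries_nonneg hb hσ deepCoeff_nonneg 0 (rc ^ 2)
    have hg1 := gaussTerm_pos hb hσ 0 (rc ^ 2) (-1)
    rw [zero_add] at g0
    rw [g0] at z1
    have heq : sogRate b σ 0 * gaussSeries b σ (tailCoeff M) 0 (rc ^ 2) ≤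
        3 * c1 * errScale b σ ω 1 (rc ^ 2)
          + sogRate b σ 0 * (c0 * errScale b σ ω 1 (rc ^ 2)) := by
      have a1 := le_abs_self (sogResidual b σ (fun _ => 1) 1 (rc ^ 2))
      have a0 := neg_abs_le (sogResidual b σ (fun _ => 1) 0 (rc ^ 2))
      have q1 : c1 * quadSize b ≤ c1 * errScale b σ ω 1 (rc ^ 2) := by gcongr
      have q0 : c0 * quadSize b ≤ c0 * errScale b σ ω 1 (rc ^ 2) := by gcongr
      have t0 : 0 ≤ sogRate b σ 0 * (sogResidual b σ (fun _ => 1) 0 (rc ^ 2)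
          + c0 * errScale b σ ω 1 (rc ^ 2)) := mul_nonneg ht.le (by linarith)
      have t1 : 0 ≤ sogRate b σ 0 * (gaussSeries b σ deepCoeff 0 (rc ^ 2)
          + gaussTerm b σ 0 (rc ^ 2) (-1)) := by positivity
      have z0' := congrArg (fun x => sogRate b σ 0 * x) z0
      simp only [mul_zero] at z0'
      linarith
    have : gaussSeries b σ (tailCoeff M) 0 (rc ^ 2) ≤
        (sogRate b σ 0)⁻¹ * (3 * c1 * errScale b σ ω 1 (rc ^ 2))
          + c0 * errScale b σ ω 1 (rc ^ 2) := by
      rw [← sub_nonneg] at heq ⊢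
      have e : (sogRate b σ 0)⁻¹ * (3 * c1 * errScale b σ ω 1 (rc ^ 2))
          + c0 * errScale b σ ω 1 (rc ^ 2) - gaussSeries b σ (tailCoeff M) 0 (rc ^ 2)
          = (sogRate b σ 0)⁻¹ * (3 * c1 * errScale b σ ω 1 (rc ^ 2)
          + sogRate b σ 0 * (c0 * errScale b σ ω 1 (rc ^ 2))
          - sogRate b σ 0 * gaussSeries b σ (tailCoeff M) 0 (rc ^ 2)) := by
        field_simp
      rw [e]; positivity
    calc _ ≤ _ := this
      _ ≤ Λ ^ 2 * (3 * c1 * errScale b σ ω 1 (rc ^ 2)) + c0 * errScale b σ ω 1 (rc ^ 2) := by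
        gcongr
      _ = _ := by ring
  have hL : 0 ≤ 3 * c1 * Λ ^ 2 := by positivity
  have up0 : c0 * errScale b σ ω 0 (rc ^ 2)
      ≤ (c0 + c1 + 3 * c1 * Λ ^ 2) * errScale b σ ω 0 (rc ^ 2) := by gcongr; linarith
  have up1 : c1 * errScale b σ ω 1 (rc ^ 2)
      ≤ (c0 + c1 + 3 * c1 * Λ ^ 2) * errScale b σ ω 1 (rc ^ 2) := by gcongr; linarith
  intro m hm
  interval_cases m
  · exact ⟨T0.trans up0, T0.trans up0, R0.trans up0⟩
  · refine ⟨key.trans ?_, T1.trans up1, R1.trans up1⟩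
    gcongr; linarith

/-- The term `b ^ (-M)` is simply dropped: the `C¹` conditions already bound the tail by the two
other terms. -/
lemma errScale_zero_le {b σ ω rc : ℝ} {M : ℕ} (hb : 1 < b) :
    errScale b σ ω 0 (rc ^ 2) ≤ energyBound b σ ω M rc := by
  have : 0 < b := by linarith
  have h2 : 0 < b ^ (-(M : ℤ)) := by positivity
  have e : mismatch b σ ω 0 (rc ^ 2)
      = sogWeight b σ (-1) * Real.exp (-(rc ^ 2 / sogWidth b σ (-1) ^ 2))
        - (ω - 1) * sogWeight b σ 0 * Real.exp (-(rc ^ 2 / sogWidth b σ 0 ^ 2)) := by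
    simp only [mismatch, gaussTerm, sogRate, div_eq_mul_inv, pow_zero, mul_one]
    ring
  rw [errScale, energyBound, e, quadSize]
  linarith

lemma errScale_one_le {b σ ω rc : ℝ} {M : ℕ} (hb : 1 < b) :
    errScale b σ ω 1 (rc ^ 2) ≤ forceBound b σ ω M rc := by
  have : 0 < b := by linarith
  have h2 : 0 < b ^ (-(3 * M : ℤ)) := by positivity
  have e : mismatch b σ ω 1 (rc ^ 2)
      = sogWeight b σ (-1) / sogWidth b σ (-1) ^ 2
          * Real.exp (-(rc ^ 2 / sogWidth b σ (-1) ^ 2))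
        - (ω - 1) * sogWeight b σ 0 / sogWidth b σ 0 ^ 2
          * Real.exp (-(rc ^ 2 / sogWidth b σ 0 ^ 2)) := by
    simp only [mismatch, gaussTerm, sogRate, div_eq_mul_inv, pow_one]
    ring
  rw [errScale, forceBound, e, quadSize]
  linarith

/-! ### First and second differences of radial functions -/

lemma IsDerivChain.abs_sub_le {f : ℕ → ℝ → ℝ} (hf : IsDerivChain f) (m : ℕ) {c K : ℝ} (hc : 0 < c)
    (hK : ∀ s, c ≤ s → |f (m + 1) s| ≤ K) {x y : ℝ} (hx : c ≤ x) (hy : c ≤ y) :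
    |f m x - f m y| ≤ K * |x - y| := by
  have := (convex_Ici c).norm_image_sub_le_of_norm_hasDerivWithin_le (f := f m)
    (f' := fun s => -f (m + 1) s) (C := K)
    (fun s hs => (hf m s (hc.trans_le hs)).hasDerivWithinAt)
    (fun s hs => by rw [norm_neg]; exact hK s hs) (Set.mem_Ici.2 hy) (Set.mem_Ici.2 hx)
  simpa [Real.norm_eq_abs] using this

lemma IsDerivChain.abs_symm_sub_le {f : ℕ → ℝ → ℝ} (hf : IsDerivChain f) {c K : ℝ} (hc : 0 < c)
    (hK : ∀ s, c ≤ s → |f 2 s| ≤ K) {a y : ℝ} (hy : 0 ≤ y) (ha : c ≤ a - y) :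
    |f 0 (a + y) + f 0 (a - y) - 2 * f 0 a| ≤ 2 * K * y ^ 2 := by
  have hK0 : 0 ≤ K := (abs_nonneg _).trans (hK c le_rfl)
  have := (convex_Icc 0 y).norm_image_sub_le_of_norm_hasDerivWithin_le
    (f := fun u => f 0 (a + u) + f 0 (a - u))
    (f' := fun u => -f 1 (a + u) + f 1 (a - u)) (C := 2 * K * y) (x := 0) (y := y)
    (fun u hu => by
      have h1 := (hf 0 (a + u) (by linarith [hu.1])).comp_const_add a u
      have h2 := (hf 0 (a - u) (by linarith [hu.2])).comp_const_sub a u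
      refine ((h1.add h2).congr_deriv ?_).hasDerivWithinAt
      simp)
    (fun u hu => by
      rw [Real.norm_eq_abs, neg_add_eq_sub]
      refine (hf.abs_sub_le 1 hc hK (by linarith [hu.2]) (by linarith [hu.1, hu.2])).trans ?_
      rw [show a - u - (a + u) = -(2 * u) by ring, abs_neg, abs_of_nonneg (by linarith [hu.1])]
      nlinarith [hu.2, hu.1])
    ⟨le_rfl, hy⟩ ⟨hy, le_rfl⟩
  simp only [Real.norm_eq_abs, add_zero, sub_zero, abs_of_nonneg hy] at this
  rw [two_mul (f 0 a)]
  refine this.trans_eq (by ring)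

lemma quarter_le_norm_add_sq {V : Type*} [NormedAddCommGroup V] {n d : V} {D : ℝ} (hd : ‖d‖ ≤ D) (hn : 2 * D ≤ ‖n‖) :
    ‖n‖ ^ 2 / 4 ≤ ‖d + n‖ ^ 2 := by
  have h1 : ‖n‖ - ‖d‖ ≤ ‖d + n‖ := by
    have := norm_sub_norm_le n (-d)
    rwa [norm_neg, sub_neg_eq_add, add_comm n d] at this
  have h2 : ‖n‖ / 2 ≤ ‖d + n‖ := by linarith
  have := pow_le_pow_left₀ (by positivity) h2 2
  linarith

section
variable {V : Type*} [NormedAddCommGroup V] [InnerProductSpace ℝ V]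

/-- With `‖d ± n‖² = a ± w`, the terms linear in `w = 2⟨d, n⟩` cancel. The symmetric difference
costs `β w²`, and replacing `a` by `‖n‖²` costs `α ‖d‖²`. -/
lemma IsDerivChain.second_difference_le {f : ℕ → ℝ → ℝ} (hf : IsDerivChain f) {n d : V}
    {D α β : ℝ} (hd : ‖d‖ ≤ D) (hn : 2 * D ≤ ‖n‖) (hn0 : 0 < ‖n‖)
    (hα : ∀ s, ‖n‖ ^ 2 / 4 ≤ s → |f 1 s| ≤ α) (hβ : ∀ s, ‖n‖ ^ 2 / 4 ≤ s → |f 2 s| ≤ β) :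
    |f 0 (‖d + n‖ ^ 2) + f 0 (‖d - n‖ ^ 2) - 2 * f 0 (‖n‖ ^ 2)|
      ≤ 8 * D ^ 2 * (α + ‖n‖ ^ 2 * β) := by
  have hc : 0 < ‖n‖ ^ 2 / 4 := by positivity
  have hα0 : 0 ≤ α := (abs_nonneg _).trans (hα _ le_rfl)
  have hβ0 : 0 ≤ β := (abs_nonneg _).trans (hβ _ le_rfl)
  have hD : 0 ≤ D := (norm_nonneg d).trans hd
  set a := ‖d‖ ^ 2 + ‖n‖ ^ 2 with ha
  set w := 2 * inner ℝ d n with hw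
  have hp : ‖d + n‖ ^ 2 = a + w := by rw [norm_add_sq_real]; ring
  have hm : ‖d - n‖ ^ 2 = a - w := by rw [norm_sub_sq_real]; ring
  have hwle : |w| ≤ 2 * D * ‖n‖ := by
    rw [hw, abs_mul, abs_two, mul_assoc]
    gcongr
    exact (abs_real_inner_le_norm d n).trans (by gcongr)
  -- By symmetry `w` may be taken nonnegative, as `abs_symm_sub_le` requires.
  have hsym : f 0 (a + w) + f 0 (a - w) = f 0 (a + |w|) + f 0 (a - |w|) := by
    rcases abs_choice w with h | h <;> rw [h]
    rw [← sub_eq_add_neg, sub_neg_eq_add, add_comm]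
  have haw : ‖n‖ ^ 2 / 4 ≤ a - |w| := by
    rcases abs_choice w with h | h <;> rw [h]
    · rw [← hm, sub_eq_add_neg, ← norm_neg n]
      exact quarter_le_norm_add_sq hd (by rwa [norm_neg])
    · rw [sub_neg_eq_add, ← hp]; exact quarter_le_norm_add_sq hd hn
  have h1 := hf.abs_symm_sub_le hc hβ (abs_nonneg w) haw
  have h2 := hf.abs_sub_le 0 hc hα (x := a) (y := ‖n‖ ^ 2) (by nlinarith [sq_nonneg ‖d‖])
    (by nlinarith [sq_nonneg ‖n‖])
  have h3 : |a - ‖n‖ ^ 2| ≤ D ^ 2 := by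
    rw [ha, add_sub_cancel_right, abs_of_nonneg (by positivity)]
    gcongr
  rw [hp, hm, hsym]
  have e : f 0 (a + |w|) + f 0 (a - |w|) - 2 * f 0 (‖n‖ ^ 2)
      = (f 0 (a + |w|) + f 0 (a - |w|) - 2 * f 0 a) + 2 * (f 0 a - f 0 (‖n‖ ^ 2)) := by ring
  rw [e]
  refine (abs_add_le _ _).trans ?_
  rw [abs_mul 2 (f 0 a - f 0 (‖n‖ ^ 2)), abs_two]
  have h4 : 2 * β * |w| ^ 2 ≤ 2 * β * (2 * D * ‖n‖) ^ 2 := by gcongr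
  have h5 : α * |a - ‖n‖ ^ 2| ≤ α * D ^ 2 := by gcongr
  have h6 : 0 ≤ α * D ^ 2 := by positivity
  nlinarith

lemma IsDerivChain.first_difference_le {f : ℕ → ℝ → ℝ} (hf : IsDerivChain f) {n d : V}
    {D α β : ℝ} (hd : ‖d‖ ≤ D) (hn : 2 * D ≤ ‖n‖) (hn0 : 0 < ‖n‖)
    (hα : ∀ s, ‖n‖ ^ 2 / 4 ≤ s → |f 1 s| ≤ α) (hβ : ∀ s, ‖n‖ ^ 2 / 4 ≤ s → |f 2 s| ≤ β) :
    ‖f 1 (‖d + n‖ ^ 2) • (d + n) - f 1 (‖n‖ ^ 2) • n‖ ≤ 3 * D * (α + ‖n‖ ^ 2 * β) := by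
  have hc : 0 < ‖n‖ ^ 2 / 4 := by positivity
  have hα0 : 0 ≤ α := (abs_nonneg _).trans (hα _ le_rfl)
  have hβ0 : 0 ≤ β := (abs_nonneg _).trans (hβ _ le_rfl)
  have hD : 0 ≤ D := (norm_nonneg d).trans hd
  have hq := quarter_le_norm_add_sq hd hn
  have h1 := hf.abs_sub_le 1 hc hβ hq (y := ‖n‖ ^ 2) (by nlinarith [sq_nonneg ‖n‖])
  have h2 : |‖d + n‖ ^ 2 - ‖n‖ ^ 2| ≤ 3 * D * ‖n‖ := by
    have e : ‖d + n‖ ^ 2 - ‖n‖ ^ 2 = ‖d‖ ^ 2 + 2 * inner ℝ d n := by rw [norm_add_sq_real]; ring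
    have h3 : |inner ℝ d n| ≤ D * ‖n‖ := (abs_real_inner_le_norm d n).trans (by gcongr)
    rw [e]
    refine (abs_add_le _ _).trans ?_
    rw [abs_mul, abs_two, abs_of_nonneg (by positivity)]
    have h4 : ‖d‖ ^ 2 ≤ D ^ 2 := by gcongr
    nlinarith
  have e : f 1 (‖d + n‖ ^ 2) • (d + n) - f 1 (‖n‖ ^ 2) • n
      = f 1 (‖d + n‖ ^ 2) • d + (f 1 (‖d + n‖ ^ 2) - f 1 (‖n‖ ^ 2)) • n := by
    rw [smul_add, sub_smul]; abel
  rw [e]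
  refine (norm_add_le _ _).trans ?_
  rw [norm_smul, norm_smul, Real.norm_eq_abs, Real.norm_eq_abs]
  have h5 : |f 1 (‖d + n‖ ^ 2)| * ‖d‖ ≤ α * D := by gcongr; exact hα _ hq
  have h6 : |f 1 (‖d + n‖ ^ 2) - f 1 (‖n‖ ^ 2)| * ‖n‖ ≤ β * (3 * D * ‖n‖) * ‖n‖ := by
    gcongr
    exact h1.trans (by gcongr)
  have h7 : 0 ≤ α * D := by positivity
  nlinarith

end

/-! ### Lattice sums -/

/-- The length of a lattice vector is bounded below by a multiple of the sup norm of its index. -/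
lemma exists_le_norm_latticeShift {Lx Ly : ℝ} (hLx : 0 < Lx) (hLy : 0 < Ly) :
    ∃ c : ℝ, 0 < c ∧ ∀ n : ℤ × ℤ, c * ‖n‖ ≤ ‖latticeShift Lx Ly n‖ := by
  refine ⟨min Lx Ly, lt_min hLx hLy, fun n => ?_⟩
  have h0 : ‖(n.1 : ℝ) * Lx‖ ≤ ‖latticeShift Lx Ly n‖ := by
    simpa [latticeShift] using PiLp.norm_apply_le (latticeShift Lx Ly n) 0
  have h1 : ‖(n.2 : ℝ) * Ly‖ ≤ ‖latticeShift Lx Ly n‖ := by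
    simpa [latticeShift] using PiLp.norm_apply_le (latticeShift Lx Ly n) 1
  rw [norm_mul, Real.norm_of_nonneg hLx.le] at h0
  rw [norm_mul, Real.norm_of_nonneg hLy.le] at h1
  rw [Prod.norm_def]
  rcases max_choice ‖n.1‖ ‖n.2‖ with h | h <;> rw [h, Int.norm_eq_abs, ← Real.norm_eq_abs]
  · refine le_trans ?_ h0
    rw [mul_comm]; gcongr; exact min_le_left _ _
  · refine le_trans ?_ h1
    rw [mul_comm]; gcongr; exact min_le_right _ _

lemma norm_latticeShift_sq (Lx Ly : ℝ) (n : ℤ × ℤ) :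
    ‖latticeShift Lx Ly n‖ ^ 2 = (n.1 * Lx) ^ 2 + (n.2 * Ly) ^ 2 := by
  rw [EuclideanSpace.norm_sq_eq]
  simp [latticeShift, Fin.sum_univ_three]

lemma latticeShift_neg (Lx Ly : ℝ) (n : ℤ × ℤ) :
    latticeShift Lx Ly (-n) = -latticeShift Lx Ly n := by
  ext i; fin_cases i <;> simp [latticeShift]

lemma summable_norm_latticeShift_rpow {Lx Ly : ℝ} (hLx : 0 < Lx) (hLy : 0 < Ly) {k : ℝ}
    (hk : 2 < k) : Summable fun n : ℤ × ℤ => ‖latticeShift Lx Ly n‖ ^ (-k) := by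
  obtain ⟨c, hc, h⟩ := exists_le_norm_latticeShift hLx hLy
  have h1 := (finTwoArrowEquiv ℤ).symm.summable_iff.2
    (EisensteinSeries.summable_one_div_norm_rpow hk)
  refine Summable.of_norm_bounded_eventually (h1.mul_left (c ^ (-k))) ?_
  have : ∀ᶠ n : ℤ × ℤ in cofinite, n ≠ 0 := (Set.finite_singleton (0 : ℤ × ℤ)).compl_mem_cofinite
  filter_upwards [this] with n hn
  have hn0 : 0 < ‖n‖ := norm_pos_iff.2 hn
  have e : ‖(finTwoArrowEquiv ℤ).symm n‖ = ‖n‖ := by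
    simp [Prod.norm_def, EisensteinSeries.norm_eq_max_natAbs, Int.norm_eq_abs]
  rw [Function.comp_apply, e, ← Real.mul_rpow hc.le hn0.le, Real.norm_of_nonneg (by positivity)]
  exact Real.rpow_le_rpow_of_nonpos (by positivity) (h n) (by linarith)

lemma finite_norm_latticeShift_lt {Lx Ly : ℝ} (hLx : 0 < Lx) (hLy : 0 < Ly) (R : ℝ) :
    {n : ℤ × ℤ | ‖latticeShift Lx Ly n‖ < R}.Finite := by
  obtain ⟨c, hc, h⟩ := exists_le_norm_latticeShift hLx hLy
  have : {n : ℤ × ℤ | ‖latticeShift Lx Ly n‖ < R} ⊆ Metric.closedBall 0 (R / c) := by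
    intro n hn
    rw [mem_closedBall_zero_iff, le_div_iff₀ hc, mul_comm]
    exact (h n).trans (le_of_lt hn)
  exact (isCompact_closedBall (0 : ℤ × ℤ) (R / c)).finite_of_discrete.subset this

/-- Wide Gaussians on the line: comparison of the sum with the integral. -/
lemma exists_sum_exp_neg_mul_sq_le : ∃ C : ℝ, 0 < C ∧ ∀ a : ℝ, 0 < a → a ≤ 1 →
    ∀ F : Finset ℤ, ∑ n ∈ F, Real.exp (-Real.pi * a * (n : ℝ) ^ 2) ≤ C / √a := by
  have hs : ∀ a : ℝ, 0 < a → Summable fun n : ℤ => Real.exp (-Real.pi * a * (n : ℝ) ^ 2) := by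
    intro a ha
    have hb : 1 < Real.exp (Real.pi * a) := Real.one_lt_exp_iff.2 (by positivity)
    refine Summable.of_nonneg_of_le (fun n => (Real.exp_pos _).le) (fun n => ?_)
      (summable_inv_pow_natAbs hb)
    rw [← Real.exp_neg, ← Real.exp_nat_mul]
    apply Real.exp_le_exp.2
    have h1 : ((n.natAbs : ℕ) : ℝ) ≤ (n : ℝ) ^ 2 := by
      have : n.natAbs ≤ n.natAbs ^ 2 := Nat.le_self_pow (by norm_num) _
      have h2 : ((n.natAbs : ℕ) : ℝ) ^ 2 = (n : ℝ) ^ 2 := by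
        rw [Nat.cast_natAbs, Int.cast_abs, sq_abs]
      rw [← h2]; exact_mod_cast this
    have : 0 ≤ Real.pi * a := by positivity
    nlinarith
  set Z := ∑' n : ℤ, Real.exp (-Real.pi * 1 * (n : ℝ) ^ 2) with hZ
  have hZ0 : 0 < Z := (hs 1 one_pos).tsum_pos (fun n => (Real.exp_pos _).le) 0 (Real.exp_pos _)
  refine ⟨Z, hZ0, fun a ha ha1 F => ?_⟩
  refine ((hs a ha).sum_le_tsum F fun n _ => (Real.exp_pos _).le).trans ?_
  -- Jacobi's transformation turns a wide Gaussian sum into a narrow one, which is at most its value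
  -- at `a = 1`.
  rw [Real.tsum_exp_neg_mul_int_sq ha, ← Real.sqrt_eq_rpow, one_div, div_eq_inv_mul Z]
  gcongr
  have hinv : 1 ≤ a⁻¹ := (one_le_inv₀ ha).2 ha1
  have hs' := hs a⁻¹ (by positivity)
  simp only [div_eq_mul_inv]
  refine hs'.tsum_le_tsum (fun n => ?_) (hs 1 one_pos)
  apply Real.exp_le_exp.2
  have : 0 ≤ Real.pi * (n : ℝ) ^ 2 := by positivity
  nlinarith

/-- The sum factors into two one-dimensional sums of order `t ^ (-1/2)`, whose product is
compensated by the factor `t`. -/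
lemma exists_sum_exp_neg_mul_norm_latticeShift_le {Lx Ly : ℝ} (hLx : 0 < Lx) (hLy : 0 < Ly) :
    ∃ C : ℝ, 0 < C ∧ ∀ t : ℝ, 0 < t → t * max Lx Ly ^ 2 ≤ 1 → ∀ F : Finset (ℤ × ℤ),
      ∑ n ∈ F, t * Real.exp (-(‖latticeShift Lx Ly n‖ ^ 2 * t / 8)) ≤ C := by
  obtain ⟨Z, hZ, H⟩ := exists_sum_exp_neg_mul_sq_le
  refine ⟨Z ^ 2 * (8 * Real.pi) / (Lx * Ly), by positivity, fun t ht htL F => ?_⟩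
  have hx : t * Lx ^ 2 ≤ 1 := le_trans (by gcongr; exact le_max_left _ _) htL
  have hy : t * Ly ^ 2 ≤ 1 := le_trans (by gcongr; exact le_max_right _ _) htL
  have hpi := Real.pi_gt_three
  have key : ∀ L : ℝ, 0 < L → t * L ^ 2 ≤ 1 → ∀ G : Finset ℤ,
      ∑ n ∈ G, Real.exp (-Real.pi * (t * L ^ 2 / (8 * Real.pi)) * (n : ℝ) ^ 2)
        ≤ Z * √(8 * Real.pi) / (√t * L) := by
    intro L hL hL1 G
    refine (H _ (by positivity) ?_ G).trans_eq ?_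
    · rw [div_le_one (by positivity)]; linarith
    · rw [Real.sqrt_div (by positivity), Real.sqrt_mul ht.le, Real.sqrt_sq hL.le]
      field_simp
  set e1 : ℤ → ℝ := fun n => Real.exp (-Real.pi * (t * Lx ^ 2 / (8 * Real.pi)) * (n : ℝ) ^ 2)
  set e2 : ℤ → ℝ := fun n => Real.exp (-Real.pi * (t * Ly ^ 2 / (8 * Real.pi)) * (n : ℝ) ^ 2)
  have hterm : ∀ n : ℤ × ℤ,
      Real.exp (-(‖latticeShift Lx Ly n‖ ^ 2 * t / 8)) = e1 n.1 * e2 n.2 := by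
    intro n
    simp only [e1, e2]
    rw [norm_latticeShift_sq, ← Real.exp_add]
    congr 1
    field_simp
    ring
  have hsub : F ⊆ F.image Prod.fst ×ˢ F.image Prod.snd := by
    intro n hn
    exact Finset.mem_product.2 ⟨Finset.mem_image_of_mem _ hn, Finset.mem_image_of_mem _ hn⟩
  have h1 : ∑ n ∈ F, Real.exp (-(‖latticeShift Lx Ly n‖ ^ 2 * t / 8))
      ≤ (Z * √(8 * Real.pi) / (√t * Lx)) * (Z * √(8 * Real.pi) / (√t * Ly)) := by
    calc _ ≤ ∑ n ∈ F.image Prod.fst ×ˢ F.image Prod.snd, e1 n.1 * e2 n.2 := by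
          simp only [hterm]
          exact Finset.sum_le_sum_of_subset_of_nonneg hsub fun _ _ _ => by positivity
      _ = (∑ n ∈ F.image Prod.fst, e1 n) * ∑ n ∈ F.image Prod.snd, e2 n := by
          rw [Finset.sum_product, Finset.sum_mul_sum]
      _ ≤ _ := by
          gcongr
          · exact key Lx hLx hx _
          · exact key Ly hLy hy _
  rw [← Finset.mul_sum]
  calc _ ≤ t * ((Z * √(8 * Real.pi) / (√t * Lx)) * (Z * √(8 * Real.pi) / (√t * Ly))) := by gcongr
    _ = t / √t ^ 2 * (Z ^ 2 * √(8 * Real.pi) ^ 2 / (Lx * Ly)) := by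
      field_simp
    _ = _ := by
      rw [Real.sq_sqrt ht.le, Real.sq_sqrt (by positivity), div_self ht.ne', one_mul]

/-! ### The cut-off kernel and symmetrised image sums -/

/-- The function `f` cut off to zero on `(-∞, S)`. -/
def cutBelow (f : ℝ → ℝ) (S s : ℝ) : ℝ := if s < S then 0 else f s

lemma cutBelow_of_le {f : ℝ → ℝ} {S s : ℝ} (h : S ≤ s) : cutBelow f S s = f s :=
  if_neg (not_lt.2 h)

/-- The two vanishing conditions make both one-sided derivatives at `S` equal to zero. -/
lemma IsDerivChain.hasDerivAt_cutBelow {f : ℕ → ℝ → ℝ} (hf : IsDerivChain f) {S : ℝ} (hS : 0 < S)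
    (h0 : f 0 S = 0) (h1 : f 1 S = 0) (s : ℝ) :
    HasDerivAt (cutBelow (f 0) S) (-cutBelow (f 1) S s) s := by
  rcases lt_trichotomy s S with h | rfl | h
  · have e : cutBelow (f 0) S =ᶠ[𝓝 s] fun _ => 0 := by
      filter_upwards [gt_mem_nhds h] with u hu using if_pos hu
    rw [cutBelow, if_pos h, neg_zero]
    exact (hasDerivAt_const s (0 : ℝ)).congr_of_eventuallyEq e
  · rw [cutBelow_of_le le_rfl, h1, neg_zero]
    have hl : HasDerivWithinAt (cutBelow (f 0) s) 0 (Set.Iic s) s := by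
      refine (hasDerivWithinAt_const s (Set.Iic s) (0 : ℝ)).congr (fun u hu => ?_) ?_
      · rcases (Set.mem_Iic.1 hu).lt_or_eq with h | rfl
        · exact if_pos h
        · rw [cutBelow_of_le le_rfl, h0]
      · rw [cutBelow_of_le le_rfl, h0]
    have hr : HasDerivWithinAt (cutBelow (f 0) s) 0 (Set.Ici s) s := by
      have := hf 0 s hS
      rw [zero_add, h1, neg_zero] at this
      exact this.hasDerivWithinAt.congr (fun u hu => cutBelow_of_le hu) (cutBelow_of_le le_rfl)
    have := hl.union hr
    rwa [Set.Iic_union_Ici, hasDerivWithinAt_univ] at this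
  · have e : cutBelow (f 0) S =ᶠ[𝓝 s] f 0 := by
      filter_upwards [lt_mem_nhds h] with u hu using cutBelow_of_le (le_of_lt hu)
    rw [cutBelow_of_le h.le]
    exact (hf 0 s (hS.trans h)).congr_of_eventuallyEq e

lemma errKernel_eq (b σ ω : ℝ) (M : ℕ) {rc : ℝ} (hrc : 0 < rc) {r : ℝ} (hr : 0 ≤ r) :
    errKernel b σ ω M rc r = cutBelow (sogResidual b σ (farCoeff ω M) 0) (rc ^ 2) (r ^ 2) := by
  unfold errKernel nearPart
  rcases lt_or_ge r rc with h | h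
  · rw [if_pos h, cutBelow, if_pos (by gcongr)]; ring
  · rw [if_neg (not_lt.2 h), cutBelow_of_le (by gcongr), ← sogResidual_sq ω M (hrc.trans_le h)]
    ring

section
variable {N : ℕ} (q : Fin N → ℝ) (pos : Fin N → Space) (Lx Ly : ℝ)

/-- Half the contribution of the images `n` and `-n` of all charges to the potential at `x` with
kernel `g`, a function of the squared distance. -/
def pairTerm (g : ℝ → ℝ) (n : ℤ × ℤ) (x : Space) : ℝ :=
  1 / 2 * ∑ j, q j * (g (‖pos j - x + latticeShift Lx Ly n‖ ^ 2)
    + g (‖pos j - x - latticeShift Lx Ly n‖ ^ 2))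

/-- The gradient of `pairTerm`, where `g` is minus the derivative of the kernel. -/
def pairGrad (g : ℝ → ℝ) (n : ℤ × ℤ) (x : Space) : Space :=
  ∑ j, q j • (g (‖pos j - x + latticeShift Lx Ly n‖ ^ 2) • (pos j - x + latticeShift Lx Ly n)
    + g (‖pos j - x - latticeShift Lx Ly n‖ ^ 2) • (pos j - x - latticeShift Lx Ly n))

variable {q pos Lx Ly}

lemma pairTerm_add (g g' : ℝ → ℝ) (n : ℤ × ℤ) (x : Space) :
    pairTerm q pos Lx Ly (fun s => g s + g' s) n x
      = pairTerm q pos Lx Ly g n x + pairTerm q pos Lx Ly g' n x := by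
  unfold pairTerm
  rw [← mul_add, ← Finset.sum_add_distrib]
  congr 1
  exact Finset.sum_congr rfl fun j _ => by ring

lemma pairGrad_add (g g' : ℝ → ℝ) (n : ℤ × ℤ) (x : Space) :
    pairGrad q pos Lx Ly (fun s => g s + g' s) n x
      = pairGrad q pos Lx Ly g n x + pairGrad q pos Lx Ly g' n x := by
  unfold pairGrad
  rw [← Finset.sum_add_distrib]
  refine Finset.sum_congr rfl fun j _ => ?_
  rw [← smul_add]
  congr 1
  simp only [add_smul]
  abel

section pointwise
variable {n : ℤ × ℤ} {x : Space} {D : ℝ}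

lemma pairTerm_congr {g g' : ℝ → ℝ} (hD : ∀ j, ‖pos j - x‖ ≤ D)
    (hn : 2 * D ≤ ‖latticeShift Lx Ly n‖)
    (h : ∀ s, ‖latticeShift Lx Ly n‖ ^ 2 / 4 ≤ s → g s = g' s) :
    pairTerm q pos Lx Ly g n x = pairTerm q pos Lx Ly g' n x := by
  unfold pairTerm
  congr 1
  refine Finset.sum_congr rfl fun j _ => ?_
  rw [h _ (quarter_le_norm_add_sq (hD j) hn), h (‖pos j - x - latticeShift Lx Ly n‖ ^ 2)]
  rw [sub_eq_add_neg, ← norm_neg (latticeShift Lx Ly n)]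
  exact quarter_le_norm_add_sq (hD j) (by rwa [norm_neg])

lemma pairGrad_congr {g g' : ℝ → ℝ} (hD : ∀ j, ‖pos j - x‖ ≤ D)
    (hn : 2 * D ≤ ‖latticeShift Lx Ly n‖)
    (h : ∀ s, ‖latticeShift Lx Ly n‖ ^ 2 / 4 ≤ s → g s = g' s) :
    pairGrad q pos Lx Ly g n x = pairGrad q pos Lx Ly g' n x := by
  unfold pairGrad
  refine Finset.sum_congr rfl fun j _ => ?_
  rw [h _ (quarter_le_norm_add_sq (hD j) hn), h (‖pos j - x - latticeShift Lx Ly n‖ ^ 2)]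
  rw [sub_eq_add_neg, ← norm_neg (latticeShift Lx Ly n)]
  exact quarter_le_norm_add_sq (hD j) (by rwa [norm_neg])

lemma abs_pairTerm_le_of_bound {g : ℝ → ℝ} {K : ℝ}
    (h : ∀ j, ∀ v : Space, (v = pos j - x + latticeShift Lx Ly n ∨
      v = pos j - x - latticeShift Lx Ly n) → |g (‖v‖ ^ 2)| ≤ K) :
    |pairTerm q pos Lx Ly g n x| ≤ (∑ j, |q j|) * K := by
  unfold pairTerm
  rw [abs_mul, abs_of_pos (by norm_num : (0 : ℝ) < 1 / 2)]
  have : |∑ j, q j * (g (‖pos j - x + latticeShift Lx Ly n‖ ^ 2)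
      + g (‖pos j - x - latticeShift Lx Ly n‖ ^ 2))| ≤ ∑ j, |q j| * (2 * K) := by
    refine (Finset.abs_sum_le_sum_abs _ _).trans (Finset.sum_le_sum fun j _ => ?_)
    rw [abs_mul]
    gcongr
    refine (abs_add_le _ _).trans ?_
    have h1 := h j _ (Or.inl rfl)
    have h2 := h j _ (Or.inr rfl)
    linarith
  rw [← Finset.sum_mul] at this
  linarith

lemma norm_pairGrad_le_of_bound {g : ℝ → ℝ} {K : ℝ}
    (h : ∀ j, ∀ v : Space, (v = pos j - x + latticeShift Lx Ly n ∨
      v = pos j - x - latticeShift Lx Ly n) → |g (‖v‖ ^ 2)| * ‖v‖ ≤ K) :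
    ‖pairGrad q pos Lx Ly g n x‖ ≤ (∑ j, |q j|) * (2 * K) := by
  unfold pairGrad
  rw [Finset.sum_mul]
  refine (norm_sum_le _ _).trans (Finset.sum_le_sum fun j _ => ?_)
  rw [norm_smul, Real.norm_eq_abs]
  gcongr
  refine (norm_add_le _ _).trans ?_
  rw [norm_smul, norm_smul, Real.norm_eq_abs, Real.norm_eq_abs]
  have h1 := h j _ (Or.inl rfl)
  have h2 := h j _ (Or.inr rfl)
  linarith

lemma IsDerivChain.abs_pairTerm_le {f : ℕ → ℝ → ℝ} (hf : IsDerivChain f) (hq : ∑ j, q j = 0)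
    {α β : ℝ} (hD : ∀ j, ‖pos j - x‖ ≤ D) (hn : 2 * D ≤ ‖latticeShift Lx Ly n‖)
    (hn0 : 0 < ‖latticeShift Lx Ly n‖)
    (hα : ∀ s, ‖latticeShift Lx Ly n‖ ^ 2 / 4 ≤ s → |f 1 s| ≤ α)
    (hβ : ∀ s, ‖latticeShift Lx Ly n‖ ^ 2 / 4 ≤ s → |f 2 s| ≤ β) :
    |pairTerm q pos Lx Ly (f 0) n x|
      ≤ (∑ j, |q j|) * (4 * D ^ 2 * (α + ‖latticeShift Lx Ly n‖ ^ 2 * β)) := by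
  set v := latticeShift Lx Ly n with hv
  -- Neutrality permits subtracting `2 * f 0 (‖v‖ ^ 2)`, the same for all charges.
  have e : pairTerm q pos Lx Ly (f 0) n x = 1 / 2 * ∑ j, q j *
      (f 0 (‖pos j - x + v‖ ^ 2) + f 0 (‖pos j - x - v‖ ^ 2) - 2 * f 0 (‖v‖ ^ 2)) := by
    unfold pairTerm
    simp only [mul_sub (q _), Finset.sum_sub_distrib, ← Finset.sum_mul, hq, zero_mul, sub_zero, hv]
  rw [e, abs_mul, abs_of_pos (by norm_num : (0 : ℝ) < 1 / 2)]
  have : |∑ j, q j * (f 0 (‖pos j - x + v‖ ^ 2) + f 0 (‖pos j - x - v‖ ^ 2)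
      - 2 * f 0 (‖v‖ ^ 2))| ≤ ∑ j, |q j| * (8 * D ^ 2 * (α + ‖v‖ ^ 2 * β)) := by
    refine (Finset.abs_sum_le_sum_abs _ _).trans (Finset.sum_le_sum fun j _ => ?_)
    rw [abs_mul]
    gcongr
    exact hf.second_difference_le (hD j) hn hn0 hα hβ
  rw [← Finset.sum_mul] at this
  linarith

lemma IsDerivChain.norm_pairGrad_le {f : ℕ → ℝ → ℝ} (hf : IsDerivChain f)
    {α β : ℝ} (hD : ∀ j, ‖pos j - x‖ ≤ D) (hn : 2 * D ≤ ‖latticeShift Lx Ly n‖)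
    (hn0 : 0 < ‖latticeShift Lx Ly n‖)
    (hα : ∀ s, ‖latticeShift Lx Ly n‖ ^ 2 / 4 ≤ s → |f 1 s| ≤ α)
    (hβ : ∀ s, ‖latticeShift Lx Ly n‖ ^ 2 / 4 ≤ s → |f 2 s| ≤ β) :
    ‖pairGrad q pos Lx Ly (f 1) n x‖
      ≤ (∑ j, |q j|) * (6 * D * (α + ‖latticeShift Lx Ly n‖ ^ 2 * β)) := by
  set v := latticeShift Lx Ly n with hv
  -- The reference vectors for `v` and `-v` cancel by oddness, so neutrality plays no role here.
  have e : pairGrad q pos Lx Ly (f 1) n x = ∑ j, q j •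
      ((f 1 (‖pos j - x + v‖ ^ 2) • (pos j - x + v) - f 1 (‖v‖ ^ 2) • v)
        + (f 1 (‖pos j - x + -v‖ ^ 2) • (pos j - x + -v) - f 1 (‖-v‖ ^ 2) • (-v))) := by
    unfold pairGrad
    refine Finset.sum_congr rfl fun j _ => ?_
    rw [norm_neg, smul_neg, ← sub_eq_add_neg, ← hv]
    congr 1
    abel
  rw [e, Finset.sum_mul]
  refine (norm_sum_le _ _).trans (Finset.sum_le_sum fun j _ => ?_)
  rw [norm_smul, Real.norm_eq_abs]
  gcongr
  refine (norm_add_le _ _).trans ?_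
  have h1 := hf.first_difference_le (hD j) hn hn0 hα hβ
  have h2 := hf.first_difference_le (n := -v) (hD j) (by rwa [norm_neg]) (by rwa [norm_neg])
    (by rwa [norm_neg]) (by rwa [norm_neg])
  rw [norm_neg] at h2
  rw [norm_neg]
  linarith

lemma IsDerivChain.hasFDerivAt_pairTerm {f : ℕ → ℝ → ℝ} (hf : IsDerivChain f) {S : ℝ} (hS : 0 < S)
    (h0 : f 0 S = 0) (h1 : f 1 S = 0) (n : ℤ × ℤ) (x : Space) :
    HasFDerivAt (pairTerm q pos Lx Ly (cutBelow (f 0) S) n)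
      (innerSL ℝ (pairGrad q pos Lx Ly (cutBelow (f 1) S) n x)) x := by
  have key : ∀ (j : Fin N) (v : Space), HasFDerivAt
      (fun y : Space => cutBelow (f 0) S (‖pos j - y + v‖ ^ 2))
      (innerSL ℝ ((2 * cutBelow (f 1) S (‖pos j - x + v‖ ^ 2)) • (pos j - x + v))) x := by
    intro j v
    have ha : HasFDerivAt (fun y : Space => pos j - y + v) (-ContinuousLinearMap.id ℝ Space) x :=
      ((hasFDerivAt_id x).const_sub (pos j)).add_const v
    have hb := ha.norm_sq
    have hc := (hf.hasDerivAt_cutBelow hS h0 h1 (‖pos j - x + v‖ ^ 2)).comp_hasFDerivAt x hb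
    refine hc.congr_fderiv ?_
    ext w
    simp
    ring
  unfold pairTerm
  have := (HasFDerivAt.fun_sum (u := Finset.univ) fun (j : Fin N) _ =>
    (((key j (latticeShift Lx Ly n)).add (key j (-latticeShift Lx Ly n))).const_mul (q j))).const_mul
      (1 / 2 : ℝ)
  simp only [← sub_eq_add_neg] at this
  refine this.congr_fderiv ?_
  unfold pairGrad
  ext w
  simp [Finset.mul_sum]
  refine Finset.sum_congr rfl fun j _ => ?_
  ring

end pointwise

/-- The index square is invariant under `n ↦ -n`, so the sum may be averaged with its reflection. -/
lemma errPotentialPartial_eq {b σ ω : ℝ} {M : ℕ} {rc : ℝ} (hrc : 0 < rc) (R : ℕ) (x : Space) :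
    errPotentialPartial q pos Lx Ly b σ ω M rc R x
      = ∑ n ∈ Finset.Icc (-(R : ℤ)) R ×ˢ Finset.Icc (-(R : ℤ)) R,
        pairTerm q pos Lx Ly (cutBelow (sogResidual b σ (farCoeff ω M) 0) (rc ^ 2)) n x := by
  set g := cutBelow (sogResidual b σ (farCoeff ω M) 0) (rc ^ 2) with hg
  set I := Finset.Icc (-(R : ℤ)) R ×ˢ Finset.Icc (-(R : ℤ)) R with hI
  have h1 : errPotentialPartial q pos Lx Ly b σ ω M rc R x
      = ∑ n ∈ I, ∑ j, q j * g (‖pos j - x + latticeShift Lx Ly n‖ ^ 2) := by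
    unfold errPotentialPartial
    refine Finset.sum_congr rfl fun n _ => Finset.sum_congr rfl fun j _ => ?_
    rw [errKernel_eq b σ ω M hrc (norm_nonneg _)]
  have h2 : ∑ n ∈ I, ∑ j, q j * g (‖pos j - x + latticeShift Lx Ly n‖ ^ 2)
      = ∑ n ∈ I, ∑ j, q j * g (‖pos j - x - latticeShift Lx Ly n‖ ^ 2) := by
    refine Finset.sum_equiv (Equiv.neg _) (fun n => ?_) fun n _ => ?_
    · simp only [hI, Finset.mem_product, Finset.mem_Icc, Equiv.neg_apply, Prod.fst_neg,
        Prod.snd_neg]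
      omega
    · rw [Equiv.neg_apply, latticeShift_neg]
      simp only [sub_neg_eq_add]
  have h3 : ∑ n ∈ I, pairTerm q pos Lx Ly g n x
      = 1 / 2 * (∑ n ∈ I, ∑ j, q j * g (‖pos j - x + latticeShift Lx Ly n‖ ^ 2)
        + ∑ n ∈ I, ∑ j, q j * g (‖pos j - x - latticeShift Lx Ly n‖ ^ 2)) := by
    unfold pairTerm
    rw [← Finset.mul_sum, ← Finset.sum_add_distrib]
    congr 1
    refine Finset.sum_congr rfl fun n _ => ?_
    rw [← Finset.sum_add_distrib]
    exact Finset.sum_congr rfl fun j _ => by ring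
  rw [h3, ← h2, h1]
  ring

lemma tendsto_square_atTop : Tendsto
    (fun R : ℕ => Finset.Icc (-(R : ℤ)) R ×ˢ Finset.Icc (-(R : ℤ)) R) atTop atTop := by
  refine tendsto_atTop_finset_of_monotone (fun R R' h => ?_) fun n => ?_
  · have : (R : ℤ) ≤ R' := by exact_mod_cast h
    exact Finset.product_subset_product (Finset.Icc_subset_Icc (by omega) this)
      (Finset.Icc_subset_Icc (by omega) this)
  · refine ⟨n.1.natAbs + n.2.natAbs, ?_⟩
    simp only [Finset.mem_product, Finset.mem_Icc]
    omega

end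

/-! ### Convergence and differentiability of the error potential -/

lemma invPow_quarter (m : ℕ) {r : ℝ} (hr : 0 < r) :
    invPow m (r ^ 2 / 4) = 2 ^ (2 * m + 1) / r ^ (2 * m + 1) := by
  have : r ^ 2 / 4 = (r / 2) ^ 2 := by ring
  rw [invPow, this, Real.sqrt_sq (by positivity), div_pow, inv_div]

/-- A crude bound whose constant depends on all parameters; it serves convergence only, not the
error estimate. -/
lemma exists_abs_sogResidual_farCoeff_le {b σ : ℝ} (hb : 1 < b) (hb1 : Real.log b < 1)
    (hσ : 0 < σ) (ω : ℝ) (M m : ℕ) : ∃ K : ℝ, 0 < K ∧ ∀ s, 0 < s →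
      |sogResidual b σ (farCoeff ω M) m s| ≤ K * invPow m s := by
  obtain ⟨C, hC, H⟩ := abs_sogResidual_one_le m
  obtain ⟨B, hB, hBle⟩ := (isBoundedCoeff_farCoeff ω M).pos_bound
  have hγ : 0 < halfGamma m := by
    unfold halfGamma
    have := Real.Gamma_pos_of_pos (s := m + 1 / 2) (by positivity)
    positivity
  have hh := Real.log_pos hb
  set e := C * ((Real.log b)⁻¹ ^ m * Real.exp (-(Real.pi ^ 2 / (2 * Real.log b)))) with he
  have he0 : 0 < e := by positivity
  refine ⟨halfGamma m + B * (halfGamma m + e), by positivity, fun s hs => ?_⟩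
  have hi := invPow_pos m hs
  have h1 := H b σ s hb hb1 hσ hs
  rw [← he] at h1
  have h2 : gaussSeries b σ (fun _ => 1) m s ≤ (halfGamma m + e) * invPow m s := by
    have h3 := neg_abs_le (sogResidual b σ (fun _ => 1) m s)
    have h4 : sogResidual b σ (fun _ => 1) m s
      = halfGamma m * invPow m s - gaussSeries b σ (fun _ => 1) m s := rfl
    linarith
  have h3 : |gaussSeries b σ (farCoeff ω M) m s| ≤ B * gaussSeries b σ (fun _ => 1) m s := by
    unfold gaussSeries
    rw [← Real.norm_eq_abs, ← tsum_mul_left]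
    refine tsum_of_norm_bounded
      ((summable_gaussTerm hb hσ isBoundedCoeff_one m hs).mul_left B).hasSum fun l => ?_
    have := gaussTerm_pos hb hσ m s l
    rw [Real.norm_eq_abs, abs_mul, abs_of_pos this, one_mul]
    gcongr
    exact hBle l
  unfold sogResidual
  refine (abs_sub _ _).trans ?_
  rw [abs_of_pos (by positivity)]
  have h4 : B * gaussSeries b σ (fun _ => 1) m s ≤ B * ((halfGamma m + e) * invPow m s) := by
    gcongr
  linarith

section
variable {N : ℕ} {q : Fin N → ℝ} {pos : Fin N → Space} {Lx Ly : ℝ}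

lemma eventually_le_norm_latticeShift (hLx : 0 < Lx) (hLy : 0 < Ly) (R : ℝ) :
    ∀ᶠ n : ℤ × ℤ in cofinite, R ≤ ‖latticeShift Lx Ly n‖ := by
  filter_upwards [(finite_norm_latticeShift_lt hLx hLy R).compl_mem_cofinite] with n hn
  simpa using hn

lemma summable_const_mul_inv_norm_pow (hLx : 0 < Lx) (hLy : 0 < Ly) (C : ℝ) :
    Summable fun n : ℤ × ℤ => C * (‖latticeShift Lx Ly n‖ ^ 3)⁻¹ := by
  refine Summable.mul_left C ((summable_norm_latticeShift_rpow hLx hLy (k := 3)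
    (by norm_num)).congr fun n => ?_)
  rw [Real.rpow_neg (norm_nonneg _)]
  norm_cast

lemma add_mul_invPow_quarter {K r : ℝ} (hr : 0 < r) :
    K * invPow 1 (r ^ 2 / 4) + r ^ 2 * (K * invPow 2 (r ^ 2 / 4)) = 40 * K * (r ^ 3)⁻¹ := by
  rw [invPow_quarter 1 hr, invPow_quarter 2 hr]
  field_simp
  norm_num
  ring

lemma norm_pos_sub_le (j : Fin N) (x : Space) : ‖pos j - x‖ ≤ ∑ j, ‖pos j‖ + ‖x‖ := by
  refine (norm_sub_le _ _).trans ?_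
  gcongr
  exact Finset.single_le_sum (f := fun j => ‖pos j‖) (fun i _ => norm_nonneg _)
    (Finset.mem_univ j)

variable {f : ℕ → ℝ → ℝ} {K S : ℝ}

lemma IsDerivChain.summable_pairTerm (hf : IsDerivChain f) (hq : ∑ j, q j = 0)
    (hLx : 0 < Lx) (hLy : 0 < Ly) (hK1 : ∀ s, 0 < s → |f 1 s| ≤ K * invPow 1 s)
    (hK2 : ∀ s, 0 < s → |f 2 s| ≤ K * invPow 2 s) (x : Space) :
    Summable fun n => pairTerm q pos Lx Ly (cutBelow (f 0) S) n x := by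
  have hK : 0 ≤ K :=
    nonneg_of_mul_nonneg_left ((abs_nonneg _).trans (hK1 1 one_pos)) (invPow_pos 1 one_pos)
  set D := ∑ j, ‖pos j‖ + ‖x‖ with hD
  refine Summable.of_norm_bounded_eventually (summable_const_mul_inv_norm_pow hLx hLy
    ((∑ j, |q j|) * (4 * D ^ 2) * (40 * K))) ?_
  filter_upwards [eventually_le_norm_latticeShift hLx hLy (2 * D),
    eventually_le_norm_latticeShift hLx hLy 1, eventually_le_norm_latticeShift hLx hLy (2 * √S)]
    with n h1 h2 h3
  have h0 : 0 < ‖latticeShift Lx Ly n‖ := by linarith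
  have hS : S ≤ ‖latticeShift Lx Ly n‖ ^ 2 / 4 := by
    have := Real.sqrt_le_iff.1 (show √S ≤ ‖latticeShift Lx Ly n‖ / 2 by linarith)
    linarith [this.2]
  rw [Real.norm_eq_abs, pairTerm_congr (fun j => norm_pos_sub_le j x) h1 (g' := f 0)
    fun s hs => cutBelow_of_le (hS.trans hs)]
  have hq4 : 0 < ‖latticeShift Lx Ly n‖ ^ 2 / 4 := by positivity
  refine (hf.abs_pairTerm_le hq (fun j => norm_pos_sub_le j x) h1 h0
    (fun s hs => (hK1 s (hq4.trans_le hs)).trans (mul_le_mul_of_nonneg_left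
      (invPow_anti 1 hq4 hs) hK))
    (fun s hs => (hK2 s (hq4.trans_le hs)).trans (mul_le_mul_of_nonneg_left
      (invPow_anti 2 hq4 hs) hK))).trans_eq ?_
  rw [add_mul_invPow_quarter h0]
  ring

lemma IsDerivChain.norm_pairGrad_cutBelow_far_le (hf : IsDerivChain f)
    (hK1 : ∀ s, 0 < s → |f 1 s| ≤ K * invPow 1 s) (hK2 : ∀ s, 0 < s → |f 2 s| ≤ K * invPow 2 s)
    {n : ℤ × ℤ} {y : Space} {D : ℝ} (hD : ∀ j, ‖pos j - y‖ ≤ D)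
    (h1 : 2 * D ≤ ‖latticeShift Lx Ly n‖) (h2 : 1 ≤ ‖latticeShift Lx Ly n‖)
    (h3 : 2 * √S ≤ ‖latticeShift Lx Ly n‖) :
    ‖pairGrad q pos Lx Ly (cutBelow (f 1) S) n y‖
      ≤ (∑ j, |q j|) * (6 * D) * (40 * K) * (‖latticeShift Lx Ly n‖ ^ 3)⁻¹ := by
  have hK : 0 ≤ K :=
    nonneg_of_mul_nonneg_left ((abs_nonneg _).trans (hK1 1 one_pos)) (invPow_pos 1 one_pos)
  have h0 : 0 < ‖latticeShift Lx Ly n‖ := by linarith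
  have hS' : S ≤ ‖latticeShift Lx Ly n‖ ^ 2 / 4 := by
    have := Real.sqrt_le_iff.1 (show √S ≤ ‖latticeShift Lx Ly n‖ / 2 by linarith)
    linarith [this.2]
  have hq4 : 0 < ‖latticeShift Lx Ly n‖ ^ 2 / 4 := by positivity
  rw [pairGrad_congr hD h1 (g' := f 1) fun s hs => cutBelow_of_le (hS'.trans hs)]
  refine (hf.norm_pairGrad_le hD h1 h0
    (fun s hs => (hK1 s (hq4.trans_le hs)).trans (mul_le_mul_of_nonneg_left
      (invPow_anti 1 hq4 hs) hK))
    (fun s hs => (hK2 s (hq4.trans_le hs)).trans (mul_le_mul_of_nonneg_left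
      (invPow_anti 2 hq4 hs) hK))).trans_eq ?_
  rw [add_mul_invPow_quarter h0]
  ring

lemma norm_pairGrad_cutBelow_le (hK1 : ∀ s, 0 < s → |f 1 s| ≤ K * invPow 1 s) (hS : 0 < S)
    {y : Space} {D : ℝ} (hD : ∀ j, ‖pos j - y‖ ≤ D) (n : ℤ × ℤ) :
    ‖pairGrad q pos Lx Ly (cutBelow (f 1) S) n y‖
      ≤ (∑ j, |q j|) * (2 * (K * invPow 1 S * (D + ‖latticeShift Lx Ly n‖))) := by
  have hK : 0 ≤ K :=
    nonneg_of_mul_nonneg_left ((abs_nonneg _).trans (hK1 1 one_pos)) (invPow_pos 1 one_pos)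
  refine norm_pairGrad_le_of_bound fun j v hv => ?_
  have hvn : ‖v‖ ≤ D + ‖latticeShift Lx Ly n‖ := by
    have := hD j
    rcases hv with rfl | rfl
    · exact (norm_add_le _ _).trans (by gcongr)
    · exact (norm_sub_le _ _).trans (by gcongr)
  have hi := invPow_pos 1 hS
  have hc : |cutBelow (f 1) S (‖v‖ ^ 2)| ≤ K * invPow 1 S := by
    unfold cutBelow
    split_ifs with hlt
    · rw [abs_zero]; positivity
    · have hle := not_lt.1 hlt
      exact (hK1 _ (hS.trans_le hle)).trans (by gcongr; exact invPow_anti 1 hS hle)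
  gcongr

/-- The error potential is differentiable, with gradient the sum of the gradients. -/
lemma IsDerivChain.hasFDerivAt_tsum_pairTerm (hf : IsDerivChain f) (hq : ∑ j, q j = 0)
    (hLx : 0 < Lx) (hLy : 0 < Ly) (hK1 : ∀ s, 0 < s → |f 1 s| ≤ K * invPow 1 s)
    (hK2 : ∀ s, 0 < s → |f 2 s| ≤ K * invPow 2 s) (hS : 0 < S) (hS0 : f 0 S = 0)
    (hS1 : f 1 S = 0) (x : Space) :
    Summable (fun n => pairGrad q pos Lx Ly (cutBelow (f 1) S) n x) ∧
    HasFDerivAt (fun y => ∑' n, pairTerm q pos Lx Ly (cutBelow (f 0) S) n y)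
      (∑' n, innerSL ℝ (pairGrad q pos Lx Ly (cutBelow (f 1) S) n x)) x := by
  have hK : 0 ≤ K :=
    nonneg_of_mul_nonneg_left ((abs_nonneg _).trans (hK1 1 one_pos)) (invPow_pos 1 one_pos)
  set D := ∑ j, ‖pos j‖ + (‖x‖ + 1) with hD
  have hD0 : 0 ≤ D := by positivity
  have hDle : ∀ y ∈ Metric.ball (0 : Space) (‖x‖ + 1), ∀ j, ‖pos j - y‖ ≤ D := by
    intro y hy j
    rw [mem_ball_zero_iff] at hy
    exact (norm_pos_sub_le j y).trans (by rw [hD]; gcongr)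
  set Q := ∑ j, |q j| with hQ
  have hQ0 : 0 ≤ Q := Finset.sum_nonneg fun j _ => abs_nonneg _
  set P : ℤ × ℤ → Prop := fun n => 2 * D ≤ ‖latticeShift Lx Ly n‖ ∧
    1 ≤ ‖latticeShift Lx Ly n‖ ∧ 2 * √S ≤ ‖latticeShift Lx Ly n‖ with hP
  classical
  -- A majorant valid on a whole ball around the origin containing `x`: cubic decay for all but
  -- finitely many `n`, and a crude bound for the others.
  set u : ℤ × ℤ → ℝ := fun n => if P n then Q * (6 * D) * (40 * K) *
    (‖latticeShift Lx Ly n‖ ^ 3)⁻¹ else Q * (2 * (K * invPow 1 S *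
      (D + ‖latticeShift Lx Ly n‖))) with hu
  have hus : Summable u := by
    refine Summable.of_norm_bounded_eventually (summable_const_mul_inv_norm_pow hLx hLy
      (Q * (6 * D) * (40 * K))) ?_
    filter_upwards [eventually_le_norm_latticeShift hLx hLy (2 * D),
      eventually_le_norm_latticeShift hLx hLy 1,
      eventually_le_norm_latticeShift hLx hLy (2 * √S)] with n h1 h2 h3
    have : P n := ⟨h1, h2, h3⟩
    have hun : u n = Q * (6 * D) * (40 * K) * (‖latticeShift Lx Ly n‖ ^ 3)⁻¹ := if_pos this
    rw [hun]
    refine (Real.norm_of_nonneg ?_).le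
    have h4 : 0 ≤ (‖latticeShift Lx Ly n‖ ^ 3)⁻¹ := by positivity
    exact mul_nonneg (mul_nonneg (mul_nonneg hQ0 (by linarith)) (by linarith)) h4
  have hbound : ∀ n, ∀ y ∈ Metric.ball (0 : Space) (‖x‖ + 1),
      ‖pairGrad q pos Lx Ly (cutBelow (f 1) S) n y‖ ≤ u n := by
    intro n y hy
    simp only [hu]
    split_ifs with h
    · exact hf.norm_pairGrad_cutBelow_far_le hK1 hK2 (hDle y hy) h.1 h.2.1 h.2.2
    · exact norm_pairGrad_cutBelow_le hK1 hS (hDle y hy) n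
  have hx : x ∈ Metric.ball (0 : Space) (‖x‖ + 1) := by
    rw [mem_ball_zero_iff]; linarith
  refine ⟨Summable.of_norm_bounded hus fun n => hbound n x hx, ?_⟩
  refine hasFDerivAt_tsum_of_isPreconnected (𝕜 := ℝ) (u := u) hus Metric.isOpen_ball
    (convex_ball (0 : Space) (‖x‖ + 1)).isPreconnected
    (f := fun n y => pairTerm q pos Lx Ly (cutBelow (f 0) S) n y)
    (f' := fun n y => innerSL ℝ (pairGrad q pos Lx Ly (cutBelow (f 1) S) n y))
    (fun n y _ => hf.hasFDerivAt_pairTerm hS hS0 hS1 n y)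
    (fun n y hy => ?_) hx (hf.summable_pairTerm hq hLx hLy hK1 hK2 x) hx
  rw [innerSL_apply_norm]
  exact hbound n y hy

end

/-- The error potential of an admissible splitting exists and is differentiable. -/
lemma errPotential_regular {N : ℕ} {q : Fin N → ℝ} (hq : ∑ j, q j = 0) (pos : Fin N → Space)
    {Lx Ly : ℝ} (hLx : 0 < Lx) (hLy : 0 < Ly) {Λ rmin b σ ω rc : ℝ} {M : ℕ} (hrmin : 0 < rmin)
    (h : IsAdmissible Λ rmin b σ ω rc M) (x : Space) :
    Tendsto (fun R : ℕ => errPotentialPartial q pos Lx Ly b σ ω M rc R x) atTop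
      (𝓝 (errPotential q pos Lx Ly b σ ω M rc x)) ∧
    DifferentiableAt ℝ (errPotential q pos Lx Ly b σ ω M rc) x ∧
    (∀ B : ℝ, (∀ F : Finset (ℤ × ℤ), ∑ n ∈ F, |pairTerm q pos Lx Ly
      (cutBelow (sogResidual b σ (farCoeff ω M) 0) (rc ^ 2)) n x| ≤ B) →
      |errPotential q pos Lx Ly b σ ω M rc x| ≤ B) ∧
    (∀ B : ℝ, (∀ F : Finset (ℤ × ℤ), ∑ n ∈ F, ‖pairGrad q pos Lx Ly
      (cutBelow (sogResidual b σ (farCoeff ω M) 1) (rc ^ 2)) n x‖ ≤ B) →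
      ‖gradient (errPotential q pos Lx Ly b σ ω M rc) x‖ ≤ B) := by
  have hb := h.one_lt
  have hσ := h.pos
  have hrc : 0 < rc := hrmin.trans_le h.rmin_le
  obtain ⟨K1, hK1, H1⟩ := exists_abs_sogResidual_farCoeff_le hb h.log_lt_one hσ ω M 1
  obtain ⟨K2, hK2, H2⟩ := exists_abs_sogResidual_farCoeff_le hb h.log_lt_one hσ ω M 2
  obtain ⟨z0, z1⟩ := h.c1.sogResidual_eq_zero hb hσ hrc
  have hf := isDerivChain_sogResidual hb hσ (isBoundedCoeff_farCoeff ω M)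
  have H1' : ∀ s, 0 < s → |sogResidual b σ (farCoeff ω M) 1 s| ≤ (K1 + K2) * invPow 1 s :=
    fun s hs => (H1 s hs).trans (by have := invPow_pos 1 hs; gcongr; linarith)
  have H2' : ∀ s, 0 < s → |sogResidual b σ (farCoeff ω M) 2 s| ≤ (K1 + K2) * invPow 2 s :=
    fun s hs => (H2 s hs).trans (by have := invPow_pos 2 hs; gcongr; linarith)
  have hsum := fun y => hf.summable_pairTerm (S := rc ^ 2) (pos := pos) hq hLx hLy H1' H2' y
  have hlim : ∀ y, Tendsto (fun R : ℕ => errPotentialPartial q pos Lx Ly b σ ω M rc R y) atTop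
      (𝓝 (∑' n, pairTerm q pos Lx Ly
        (cutBelow (sogResidual b σ (farCoeff ω M) 0) (rc ^ 2)) n y)) := by
    intro y
    simp only [errPotentialPartial_eq hrc]
    exact (hsum y).hasSum.comp tendsto_square_atTop
  have hpot : errPotential q pos Lx Ly b σ ω M rc = fun y => ∑' n, pairTerm q pos Lx Ly
      (cutBelow (sogResidual b σ (farCoeff ω M) 0) (rc ^ 2)) n y := by
    funext y
    exact (hlim y).limUnder_eq
  obtain ⟨hg, hd⟩ := hf.hasFDerivAt_tsum_pairTerm (pos := pos) hq hLx hLy H1' H2'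
    (S := rc ^ 2) (by positivity) z0 z1 x
  rw [hpot]
  refine ⟨hlim x, hd.differentiableAt, fun B hB => ?_, fun B hB => ?_⟩
  · rw [← Real.norm_eq_abs]
    exact (norm_tsum_le_tsum_norm (hsum x).norm).trans
      ((hsum x).norm.tsum_le_of_sum_le fun F => by simpa [Real.norm_eq_abs] using hB F)
  · rw [gradient, LinearIsometryEquiv.norm_map, hd.fderiv]
    have hs : Summable fun n => ‖innerSL ℝ (pairGrad q pos Lx Ly
        (cutBelow (sogResidual b σ (farCoeff ω M) 1) (rc ^ 2)) n x)‖ := by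
      simpa only [innerSL_apply_norm] using hg.norm
    exact (norm_tsum_le_tsum_norm hs).trans
      (hs.tsum_le_of_sum_le fun F => by simpa only [innerSL_apply_norm] using hB F)

/-! ### Uniform bounds on the contributions of the images -/

/-- With `w = 1 / (r log b)` the two hypotheses carry the factors `w` and `1`, and the conclusion
carries their geometric mean `√w`: the second serves for `w ≥ 1`, the first for `w ≤ 1`. This
produces the exponent `-3/2` of `log b`, while `r ^ (-5/2)` is still summable over a plane lattice.
-/
lemma le_quadSize_mul_rpow {b r A x : ℝ} (hb : 1 < b) (hr : 0 < r) (hA : 0 ≤ A)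
    (h1 : x ≤ A * ((Real.log b)⁻¹ ^ 2 * Real.exp (-(Real.pi ^ 2 / (2 * Real.log b)))) * (r ^ 3)⁻¹)
    (h2 : Real.log b * r ≤ 1 →
      x ≤ A * ((Real.log b)⁻¹ * Real.exp (-(Real.pi ^ 2 / (2 * Real.log b)))) * (r ^ 2)⁻¹) :
    x ≤ A * (quadSize b * r ^ (-(5 / 2) : ℝ)) := by
  have hh := Real.log_pos hb
  unfold quadSize
  set h := Real.log b
  set η := Real.exp (-(Real.pi ^ 2 / (2 * h)))
  have hη : 0 < η := Real.exp_pos _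
  set u := h⁻¹ with hu
  set v := r⁻¹ with hv
  have hu0 : 0 < u := by positivity
  have hv0 : 0 < v := by positivity
  have e1 : h ^ (-(3 / 2) : ℝ) = u * √u := by
    rw [Real.rpow_neg hh.le, ← Real.inv_rpow hh.le, ← hu, Real.sqrt_eq_rpow]
    nth_rewrite 2 [← Real.rpow_one u]
    rw [← Real.rpow_add hu0]; norm_num
  have e2 : r ^ (-(5 / 2) : ℝ) = v ^ 2 * √v := by
    rw [Real.rpow_neg hr.le, ← Real.inv_rpow hr.le, ← hv, Real.sqrt_eq_rpow, ← Real.rpow_natCast,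
      ← Real.rpow_add hv0]
    norm_num
  have e3 : h ^ (-(3 / 2) : ℝ) * η * r ^ (-(5 / 2) : ℝ) = u * v ^ 2 * η * √(u * v) := by
    rw [e1, e2, Real.sqrt_mul hu0.le]; ring
  rw [e3]
  rw [← inv_pow, ← hv] at h1 h2
  have hw0 : 0 < u * v := by positivity
  rcases le_total (h * r) 1 with hc | hc
  · have : 1 ≤ √(u * v) := by
      rw [Real.one_le_sqrt, hu, hv, ← mul_inv]
      exact (one_le_inv₀ (by positivity)).2 hc
    calc x ≤ A * (u * v ^ 2 * η * 1) := (h2 hc).trans_eq (by ring)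
      _ ≤ _ := by gcongr
  · have hw1 : u * v ≤ 1 := by
      rw [hu, hv, ← mul_inv]
      exact inv_le_one_of_one_le₀ hc
    have : u * v ≤ √(u * v) := by
      apply Real.le_sqrt_of_sq_le
      nlinarith
    calc x ≤ A * (u * v ^ 2 * η * (u * v)) := h1.trans_eq (by ring)
      _ ≤ _ := by gcongr

/-- The bound on the second differences of the tail at a lattice vector of length `r`. -/
def tailSize (b σ : ℝ) (M : ℕ) (r : ℝ) : ℝ :=
  gaussSeries b σ (tailCoeff M) 1 (r ^ 2 / 4) + r ^ 2 * gaussSeries b σ (tailCoeff M) 2 (r ^ 2 / 4)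

lemma IsAdmissible.rate_tail_mul_le {Λ rmin b σ ω rc : ℝ} {M : ℕ} (hΛ : 0 < Λ)
    (h : IsAdmissible Λ rmin b σ ω rc M) {l : ℤ} (hl : (M : ℤ) < l) :
    sogRate b σ l * Λ ^ 2 ≤ 1 := by
  have h1 := sogRate_le h.one_lt h.pos (show (M : ℤ) + 1 ≤ l by omega)
  have h2 := h.le_width
  have hw := sogWidth_pos h.one_lt h.pos ((M : ℤ) + 1)
  calc _ ≤ sogRate b σ (M + 1) * Λ ^ 2 := by gcongr
    _ ≤ sogRate b σ (M + 1) * sogWidth b σ (M + 1) ^ 2 := by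
      have := sogRate_pos h.one_lt h.pos ((M : ℤ) + 1)
      gcongr
    _ = 1 := by unfold sogRate; field_simp

lemma exists_sum_tailSize_le {Lx Ly : ℝ} (hLx : 0 < Lx) (hLy : 0 < Ly) {rmin : ℝ}
    (hrmin : 0 < rmin) : ∃ C : ℝ, 0 < C ∧
    ∀ (b σ ω rc : ℝ) (M : ℕ), IsAdmissible (max Lx Ly) rmin b σ ω rc M →
      ∀ F : Finset (ℤ × ℤ), (∀ n ∈ F, 0 < ‖latticeShift Lx Ly n‖) →
        ∑ n ∈ F, tailSize b σ M ‖latticeShift Lx Ly n‖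
          ≤ C * gaussSeries b σ (tailCoeff M) 0 (rc ^ 2) := by
  obtain ⟨C, hC, H⟩ := exists_sum_exp_neg_mul_norm_latticeShift_le hLx hLy
  refine ⟨9 * C * Real.exp 1, by positivity, ?_⟩
  intro b σ ω rc M h F hF
  have hb := h.one_lt
  have hσ := h.pos
  have hrc : 0 < rc := hrmin.trans_le h.rmin_le
  have hΛ : 0 < max Lx Ly := lt_max_of_lt_left hLx
  have hT := isBoundedCoeff_tailCoeff M
  set r : ℤ × ℤ → ℝ := fun n => ‖latticeShift Lx Ly n‖ with hr
  have hs : ∀ n ∈ F, 0 < r n ^ 2 / 4 := fun n hn => by have := hF n hn; positivity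
  have hsum : ∀ n ∈ F, HasSum (fun l => tailCoeff M l * gaussTerm b σ 1 (r n ^ 2 / 4) l
      + r n ^ 2 * (tailCoeff M l * gaussTerm b σ 2 (r n ^ 2 / 4) l)) (tailSize b σ M (r n)) :=
    fun n hn => (summable_gaussTerm hb hσ hT 1 (hs n hn)).hasSum.add
      ((summable_gaussTerm hb hσ hT 2 (hs n hn)).hasSum.mul_left _)
  refine hasSum_le (fun l => ?_) (hasSum_sum hsum)
    ((summable_gaussTerm hb hσ hT 0 (s := rc ^ 2) (by positivity)).hasSum.mul_left _)
  unfold tailCoeff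
  split_ifs with hl
  · simp only [one_mul]
    have hw := sogWeight_pos hb hσ l
    have ht := sogRate_pos hb hσ l
    have htΛ := h.rate_tail_mul_le hΛ hl
    set t := sogRate b σ l with htdef
    have hterm : ∀ n ∈ F, gaussTerm b σ 1 (r n ^ 2 / 4) l + r n ^ 2 * gaussTerm b σ 2 (r n ^ 2 / 4) l
        ≤ 9 * sogWeight b σ l * (t * Real.exp (-(r n ^ 2 * t / 8))) := by
      intro n hn
      have h0 := hF n hn
      set y := r n ^ 2 * t with hy
      have hy0 : 0 ≤ y := by positivity
      -- Half of the exponent `y / 4` absorbs the polynomial; the other half is kept for the lattice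
      -- sum.
      have h1 : (1 + y) * Real.exp (-(y / 8)) ≤ 9 := by
        rw [Real.exp_neg, ← div_eq_mul_inv, div_le_iff₀ (Real.exp_pos _)]
        have := Real.add_one_le_exp (y / 8)
        linarith
      have e : gaussTerm b σ 1 (r n ^ 2 / 4) l + r n ^ 2 * gaussTerm b σ 2 (r n ^ 2 / 4) l
          = sogWeight b σ l * t * ((1 + y) * Real.exp (-(y / 8))) * Real.exp (-(y / 8)) := by
        unfold gaussTerm
        rw [← htdef, mul_assoc (sogWeight b σ l * t), mul_assoc (1 + y), ← Real.exp_add,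
          show r n ^ 2 / 4 * t = y / 4 by rw [hy]; ring,
          show -(y / 8) + -(y / 8) = -(y / 4) by ring, hy]
        ring
      rw [e]
      calc _ ≤ sogWeight b σ l * t * 9 * Real.exp (-(y / 8)) := by gcongr
        _ = _ := by ring
    refine (Finset.sum_le_sum hterm).trans ?_
    rw [← Finset.mul_sum]
    have h1 := H t ht htΛ F
    -- Tail Gaussians are wider than the cell, hence nearly constant up to `rc`; this ties the
    -- lattice sum to the tail at the cutoff.
    have h2 : sogWeight b σ l ≤ Real.exp 1 * gaussTerm b σ 0 (rc ^ 2) l := by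
      have h3 : 1 ≤ Real.exp 1 * Real.exp (-(rc ^ 2 * t)) := by
        rw [← Real.exp_add]
        apply Real.one_le_exp
        have : rc ^ 2 * t ≤ max Lx Ly ^ 2 * t := by
          have : rc ≤ max Lx Ly := by linarith [h.cutoff_le]
          gcongr
        linarith
      unfold gaussTerm
      rw [← htdef, pow_zero, mul_one]
      calc _ ≤ sogWeight b σ l * (Real.exp 1 * Real.exp (-(rc ^ 2 * t))) :=
            le_mul_of_one_le_right hw.le h3
        _ = _ := by ring
    calc _ ≤ 9 * sogWeight b σ l * C := by gcongr
      _ ≤ 9 * (Real.exp 1 * gaussTerm b σ 0 (rc ^ 2) l) * C := by gcongr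
      _ = _ := by ring
  · simp

/-- Because `s₀ < rc`, the decay factor is at most `exp (1 - s / rc²)`; a quadratic power of it is
enough for the lattice sums and has a constant depending on `Λ` alone. -/
lemma IsAdmissible.abs_gaussSeries_narrowCoeff_le {Λ rmin b σ ω rc : ℝ} {M : ℕ} (hrmin : 0 < rmin)
    (h : IsAdmissible Λ rmin b σ ω rc M) (m : ℕ) {s : ℝ} (hs : rc ^ 2 ≤ s) :
    |gaussSeries b σ (narrowCoeff ω) m s|
      ≤ narrowSize b σ ω m (rc ^ 2) * (2 * Real.exp 1 * Λ ^ 4 / s ^ 2) := by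
  have hb := h.one_lt
  have hσ := h.pos
  have hrc : 0 < rc := hrmin.trans_le h.rmin_le
  have hs0 : 0 < s := (by positivity : 0 < rc ^ 2).trans_le hs
  refine (_root_.abs_gaussSeries_narrowCoeff_le hb hσ ω m (by positivity) hs).trans ?_
  have hn := narrowSize_nonneg hb hσ ω m (rc ^ 2)
  gcongr
  have ht : (rc ^ 2)⁻¹ ≤ sogRate b σ 0 := by
    have := sogWidth_pos hb hσ 0
    have := h.width_lt
    unfold sogRate
    gcongr
  set y := s / rc ^ 2 with hy
  have hy0 : 0 < y := by positivity
  have h1 : Real.exp (-((s - rc ^ 2) * sogRate b σ 0)) ≤ Real.exp 1 * Real.exp (-y) := by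
    rw [← Real.exp_add]
    apply Real.exp_le_exp.2
    have h2 : (s - rc ^ 2) * (rc ^ 2)⁻¹ ≤ (s - rc ^ 2) * sogRate b σ 0 :=
      mul_le_mul_of_nonneg_left ht (by linarith)
    have h3 : (s - rc ^ 2) * (rc ^ 2)⁻¹ = y - 1 := by rw [hy]; field_simp
    linarith
  have h4 := pow_mul_exp_neg_le 2 hy0.le
  have h5 : Real.exp (-y) ≤ 2 * Λ ^ 4 / s ^ 2 := by
    rw [le_div_iff₀ (by positivity)]
    have e : s = y * rc ^ 2 := by rw [hy]; field_simp
    have hrΛ : rc ≤ Λ := by linarith [h.cutoff_le]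
    calc Real.exp (-y) * s ^ 2 = (y ^ 2 * Real.exp (-y)) * rc ^ 4 := by
          have e2 : s ^ 2 = (y * rc ^ 2) ^ 2 := by rw [← e]
          rw [e2]; ring
      _ ≤ (2 : ℕ).factorial * Λ ^ 4 := by gcongr
      _ = _ := by norm_num
  calc _ ≤ Real.exp 1 * (2 * Λ ^ 4 / s ^ 2) := h1.trans (by gcongr)
    _ = _ := by ring

lemma inv_pow_le_rpow {r : ℝ} (hr : 1 ≤ r) {k : ℕ} (hk : 3 ≤ k) :
    (r ^ k)⁻¹ ≤ r ^ (-(5 / 2) : ℝ) := by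
  rw [← Real.rpow_natCast, ← Real.rpow_neg (by linarith)]
  apply Real.rpow_le_rpow_of_exponent_le hr
  have : (3 : ℝ) ≤ k := by exact_mod_cast hk
  linarith

section
variable {N : ℕ} {q : Fin N → ℝ} {pos : Fin N → Space} {Lx Ly : ℝ} {n : ℤ × ℤ} {x : Space} {D : ℝ}

lemma quarter_le_norm_image_sq (hD : ∀ j, ‖pos j - x‖ ≤ D) (hn : 2 * D ≤ ‖latticeShift Lx Ly n‖)
    (j : Fin N) {v : Space} (hv : v = pos j - x + latticeShift Lx Ly n ∨
      v = pos j - x - latticeShift Lx Ly n) : ‖latticeShift Lx Ly n‖ ^ 2 / 4 ≤ ‖v‖ ^ 2 := by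
  rcases hv with rfl | rfl
  · exact quarter_le_norm_add_sq (hD j) hn
  · rw [sub_eq_add_neg, ← norm_neg (latticeShift Lx Ly n)]
    exact quarter_le_norm_add_sq (hD j) (by rwa [norm_neg])

lemma exists_quadrature_pair_le (hq : ∑ j, q j = 0) (hD0 : 0 ≤ D) : ∃ C : ℝ, 0 < C ∧
    ∀ b σ : ℝ, 1 < b → Real.log b < 1 → 0 < σ → ∀ (x : Space), (∀ j, ‖pos j - x‖ ≤ D) →
      ∀ n : ℤ × ℤ, 2 * D ≤ ‖latticeShift Lx Ly n‖ → 1 ≤ ‖latticeShift Lx Ly n‖ →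
      |pairTerm q pos Lx Ly (sogResidual b σ (fun _ => 1) 0) n x|
        ≤ C * (quadSize b * ‖latticeShift Lx Ly n‖ ^ (-(5 / 2) : ℝ)) ∧
      ‖pairGrad q pos Lx Ly (sogResidual b σ (fun _ => 1) 1) n x‖
        ≤ C * (quadSize b * ‖latticeShift Lx Ly n‖ ^ (-(5 / 2) : ℝ)) := by
  obtain ⟨C0, hC0, H0⟩ := abs_sogResidual_one_le 0
  obtain ⟨C1, hC1, H1⟩ := abs_sogResidual_one_le 1
  obtain ⟨C2, hC2, H2⟩ := abs_sogResidual_one_le 2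
  set Q := ∑ j, |q j| with hQ
  have hQ0 : 0 ≤ Q := Finset.sum_nonneg fun j _ => abs_nonneg _
  set A := Q * (4 * D ^ 2 + 6 * D) * (40 * (C1 + C2)) + Q * (2 * C0 + 8 * C1) + 1 with hA
  have hA0 : 0 < A := by positivity
  have hA1 : Q * (4 * D ^ 2) * (40 * (C1 + C2)) ≤ A := by
    have : 0 ≤ Q * (6 * D) * (40 * (C1 + C2)) := by positivity
    have : 0 ≤ Q * (2 * C0 + 8 * C1) := by positivity
    rw [hA]; linarith
  have hA2 : Q * (6 * D) * (40 * (C1 + C2)) ≤ A := by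
    have : 0 ≤ Q * (4 * D ^ 2) * (40 * (C1 + C2)) := by positivity
    have : 0 ≤ Q * (2 * C0 + 8 * C1) := by positivity
    rw [hA]; linarith
  have hA3 : Q * (2 * C0) ≤ A := by
    have : 0 ≤ Q * (4 * D ^ 2 + 6 * D) * (40 * (C1 + C2)) := by positivity
    have : 0 ≤ Q * (8 * C1) := by positivity
    rw [hA]; linarith
  have hA4 : Q * (8 * C1) ≤ A := by
    have : 0 ≤ Q * (4 * D ^ 2 + 6 * D) * (40 * (C1 + C2)) := by positivity
    have : 0 ≤ Q * (2 * C0) := by positivity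
    rw [hA]; linarith
  refine ⟨A, hA0, ?_⟩
  intro b σ hb hb1 hσ x hD n hn1 hn2
  have hh := Real.log_pos hb
  have hf := isDerivChain_sogResidual hb hσ isBoundedCoeff_one
  set r := ‖latticeShift Lx Ly n‖ with hr
  have hr0 : 0 < r := by linarith
  have hq4 : 0 < r ^ 2 / 4 := by positivity
  have H0' := fun s => H0 b σ s hb hb1 hσ
  have H1' := fun s => H1 b σ s hb hb1 hσ
  have H2' := fun s => H2 b σ s hb hb1 hσ
  simp only [pow_zero, pow_one, one_mul] at H0' H1'
  set u := (Real.log b)⁻¹ with hu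
  set η := Real.exp (-(Real.pi ^ 2 / (2 * Real.log b))) with hη
  have hη0 : 0 < η := Real.exp_pos _
  have hu1 : 1 ≤ u := (one_le_inv₀ hh).2 hb1.le
  have hα : ∀ s, r ^ 2 / 4 ≤ s → |sogResidual b σ (fun _ => 1) 1 s|
      ≤ (C1 + C2) * (u ^ 2 * η) * invPow 1 (r ^ 2 / 4) := by
    intro s hs
    have h1 := invPow_pos 1 hq4
    have h2 := invPow_pos 1 (hq4.trans_le hs)
    refine (H1' s (hq4.trans_le hs)).trans ?_
    gcongr
    · linarith
    · nlinarith
    · exact invPow_anti 1 hq4 hs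
  have hβ : ∀ s, r ^ 2 / 4 ≤ s → |sogResidual b σ (fun _ => 1) 2 s|
      ≤ (C1 + C2) * (u ^ 2 * η) * invPow 2 (r ^ 2 / 4) := by
    intro s hs
    have h1 := invPow_pos 2 hq4
    have h2 := invPow_pos 2 (hq4.trans_le hs)
    refine (H2' s (hq4.trans_le hs)).trans ?_
    gcongr
    · linarith
    · exact invPow_anti 2 hq4 hs
  constructor
  · refine le_quadSize_mul_rpow hb hr0 hA0.le ?_ ?_
    · refine (hf.abs_pairTerm_le hq hD hn1 hr0 hα hβ).trans ?_
      rw [add_mul_invPow_quarter hr0]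
      calc _ = Q * (4 * D ^ 2) * (40 * (C1 + C2)) * (u ^ 2 * η) * (r ^ 3)⁻¹ := by ring
        _ ≤ _ := by gcongr
    -- When `r log b ≤ 1` no cancellation is needed: the pointwise size of order `1 / r` is already
    -- below `(log b)⁻¹ / r²`.
    · intro hle
      have : |pairTerm q pos Lx Ly (sogResidual b σ (fun _ => 1) 0) n x|
          ≤ Q * (C0 * η * (2 / r)) := by
        refine abs_pairTerm_le_of_bound fun j v hv => ?_
        have hv4 := quarter_le_norm_image_sq hD hn1 j hv
        refine (H0' _ (hq4.trans_le hv4)).trans ?_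
        gcongr
        refine (invPow_anti 0 hq4 hv4).trans_eq ?_
        rw [invPow_quarter 0 hr0]; simp
      have h3 : r⁻¹ ≤ u * (r ^ 2)⁻¹ := by
        have e : r⁻¹ = Real.log b * r * (u * (r ^ 2)⁻¹) := by rw [hu]; field_simp
        rw [e]
        exact mul_le_of_le_one_left (by positivity) hle
      calc _ ≤ Q * (C0 * η * (2 / r)) := this
        _ = Q * (2 * C0) * η * r⁻¹ := by ring
        _ ≤ A * η * (u * (r ^ 2)⁻¹) := by gcongr
        _ = _ := by ring
  · refine le_quadSize_mul_rpow hb hr0 hA0.le ?_ fun _ => ?_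
    · refine (hf.norm_pairGrad_le hD hn1 hr0 hα hβ).trans ?_
      rw [add_mul_invPow_quarter hr0]
      calc _ = Q * (6 * D) * (40 * (C1 + C2)) * (u ^ 2 * η) * (r ^ 3)⁻¹ := by ring
        _ ≤ _ := by gcongr
    · have : ‖pairGrad q pos Lx Ly (sogResidual b σ (fun _ => 1) 1) n x‖
          ≤ Q * (2 * (C1 * (u * η) * (4 / r ^ 2))) := by
        refine norm_pairGrad_le_of_bound fun j v hv => ?_
        have hv4 := quarter_le_norm_image_sq hD hn1 j hv
        have hv0 : 0 < ‖v‖ := by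
          have : 0 < ‖v‖ ^ 2 := hq4.trans_le hv4
          rcases (norm_nonneg v).lt_or_eq with h | h
          · exact h
          · rw [← h] at this; norm_num at this
        have h5 := H1' (‖v‖ ^ 2) (hq4.trans_le hv4)
        have h6 : invPow 1 (‖v‖ ^ 2) * ‖v‖ ≤ 4 / r ^ 2 := by
          rw [invPow, Real.sqrt_sq hv0.le]
          rw [show (‖v‖ ^ (2 * 1 + 1))⁻¹ * ‖v‖ = (‖v‖ ^ 2)⁻¹ by field_simp,
            show 4 / r ^ 2 = (r ^ 2 / 4)⁻¹ by rw [inv_div]]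
          exact inv_anti₀ hq4 hv4
        calc _ ≤ C1 * (u * η) * invPow 1 (‖v‖ ^ 2) * ‖v‖ := by gcongr
          _ = C1 * (u * η) * (invPow 1 (‖v‖ ^ 2) * ‖v‖) := by ring
          _ ≤ _ := by gcongr
      calc _ ≤ _ := this
        _ = Q * (8 * C1) * (u * η) * (r ^ 2)⁻¹ := by ring
        _ ≤ _ := by gcongr

end

lemma gaussSeries_anti {b σ : ℝ} (hb : 1 < b) (hσ : 0 < σ) {c : ℤ → ℝ} (hc : IsBoundedCoeff c)
    (hc0 : ∀ l, 0 ≤ c l) (m : ℕ) {s s' : ℝ} (hs : 0 < s) (h : s ≤ s') :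
    gaussSeries b σ c m s' ≤ gaussSeries b σ c m s :=
  (summable_gaussTerm hb hσ hc m (hs.trans_le h)).tsum_le_tsum
    (fun l => mul_le_mul_of_nonneg_left (gaussTerm_anti hb hσ m h l) (hc0 l))
    (summable_gaussTerm hb hσ hc m hs)

lemma tailSize_nonneg {b σ : ℝ} (hb : 1 < b) (hσ : 0 < σ) (M : ℕ) (r : ℝ) :
    0 ≤ tailSize b σ M r := by
  have h1 := gaussSeries_nonneg hb hσ (tailCoeff_nonneg M) 1 (r ^ 2 / 4)
  have h2 := gaussSeries_nonneg hb hσ (tailCoeff_nonneg M) 2 (r ^ 2 / 4)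
  unfold tailSize; positivity

/-- Below the cutoff the kernel vanishes. Beyond it, tail and narrow part are controlled by their
sizes at `rc`, so the bounds there propagate to every distance. This handles the near images. -/
lemma exists_abs_cutBelow_sogResidual_le {rmin : ℝ} (hrmin : 0 < rmin) {Λ : ℝ} (hΛ : 0 < Λ) :
    ∃ C : ℝ, 0 < C ∧ ∀ (b σ ω rc : ℝ) (M : ℕ), IsAdmissible Λ rmin b σ ω rc M → ∀ m ≤ 1, ∀ s : ℝ,
      |cutBelow (sogResidual b σ (farCoeff ω M) m) (rc ^ 2) s| ≤ C * errScale b σ ω m (rc ^ 2) := by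
  obtain ⟨c, hc, H⟩ := exists_size_bounds hrmin hΛ
  obtain ⟨C0, hC0, H0⟩ := abs_sogResidual_one_le 0
  obtain ⟨C1, hC1, H1⟩ := abs_sogResidual_one_le 1
  set I := invPow 0 (rmin ^ 2) + invPow 1 (rmin ^ 2) with hI
  have hi0 := invPow_pos 0 (s := rmin ^ 2) (by positivity)
  have hi1 := invPow_pos 1 (s := rmin ^ 2) (by positivity)
  have hI0 : 0 < I := by positivity
  refine ⟨(C0 + C1) * I + c + c * (2 * Real.exp 1 * Λ ^ 4 / (rmin ^ 2) ^ 2), by positivity, ?_⟩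
  intro b σ ω rc M h m hm s
  have hb := h.one_lt
  have hσ := h.pos
  have hrc : 0 < rc := hrmin.trans_le h.rmin_le
  have hq := quadSize_pos hb
  have hS := hq.trans_le (quadSize_le_errScale b σ ω m (rc ^ 2))
  unfold cutBelow
  split_ifs with hlt
  · rw [abs_zero]; positivity
  have hs : rc ^ 2 ≤ s := not_lt.1 hlt
  have hs0 : 0 < s := (by positivity : 0 < rc ^ 2).trans_le hs
  have hrs : rmin ^ 2 ≤ s := le_trans (by have := h.rmin_le; gcongr) hs
  obtain ⟨-, hT, hN⟩ := H b σ ω rc M h m hm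
  have hε : |sogResidual b σ (fun _ => 1) m s| ≤ (C0 + C1) * I * errScale b σ ω m (rc ^ 2) := by
    have h1 := inv_log_pow_mul_le hb h.log_lt_one hm
    have h2 := quadSize_le_errScale b σ ω m (rc ^ 2)
    have h3 : invPow m s ≤ I := by
      refine (invPow_anti m (by positivity) hrs).trans ?_
      interval_cases m <;> linarith
    have h4 : |sogResidual b σ (fun _ => 1) m s|
        ≤ (C0 + C1) * ((Real.log b)⁻¹ ^ m * Real.exp (-(Real.pi ^ 2 / (2 * Real.log b))))
          * invPow m s := by
      have hi := invPow_pos m hs0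
      have hh := Real.log_pos hb
      interval_cases m
      · refine (H0 b σ s hb h.log_lt_one hσ hs0).trans ?_
        gcongr; linarith
      · refine (H1 b σ s hb h.log_lt_one hσ hs0).trans ?_
        gcongr; linarith
    have hi := invPow_pos m hs0
    calc _ ≤ _ := h4
      _ ≤ (C0 + C1) * errScale b σ ω m (rc ^ 2) * I := by
        gcongr
        exact h1.trans h2
      _ = _ := by ring
  have hTs : |gaussSeries b σ (tailCoeff M) m s| ≤ c * errScale b σ ω m (rc ^ 2) := by
    rw [abs_of_nonneg (gaussSeries_nonneg hb hσ (tailCoeff_nonneg M) m s)]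
    exact (gaussSeries_anti hb hσ (isBoundedCoeff_tailCoeff M) (tailCoeff_nonneg M) m
      (by positivity) hs).trans hT
  have hNs : |gaussSeries b σ (narrowCoeff ω) m s|
      ≤ c * (2 * Real.exp 1 * Λ ^ 4 / (rmin ^ 2) ^ 2) * errScale b σ ω m (rc ^ 2) := by
    refine (h.abs_gaussSeries_narrowCoeff_le hrmin m hs).trans ?_
    calc _ ≤ c * errScale b σ ω m (rc ^ 2) * (2 * Real.exp 1 * Λ ^ 4 / (rmin ^ 2) ^ 2) := by
          gcongr
      _ = _ := by ring
  rw [sogResidual_farCoeff hb hσ ω M m hs0]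
  refine (abs_add_le _ _).trans ?_
  have := abs_add_le (sogResidual b σ (fun _ => 1) m s) (gaussSeries b σ (tailCoeff M) m s)
  linarith

section
variable {N : ℕ} {q : Fin N → ℝ} {pos : Fin N → Space} {Lx Ly : ℝ} {n : ℤ × ℤ} {x : Space} {D : ℝ}

lemma narrow_pair_le {Λ rmin b σ ω rc : ℝ} {M : ℕ} (hrmin : 0 < rmin)
    (h : IsAdmissible Λ rmin b σ ω rc M) (hD : ∀ j, ‖pos j - x‖ ≤ D)
    (hn1 : 2 * D ≤ ‖latticeShift Lx Ly n‖) (hn2 : 1 ≤ ‖latticeShift Lx Ly n‖)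
    (hn3 : Λ ≤ ‖latticeShift Lx Ly n‖) :
    |pairTerm q pos Lx Ly (gaussSeries b σ (narrowCoeff ω) 0) n x|
      ≤ (∑ j, |q j|) * (32 * Real.exp 1 * Λ ^ 4) *
        (narrowSize b σ ω 0 (rc ^ 2) * ‖latticeShift Lx Ly n‖ ^ (-(5 / 2) : ℝ)) ∧
    ‖pairGrad q pos Lx Ly (gaussSeries b σ (narrowCoeff ω) 1) n x‖
      ≤ (∑ j, |q j|) * (32 * Real.exp 1 * Λ ^ 4) *
        (narrowSize b σ ω 1 (rc ^ 2) * ‖latticeShift Lx Ly n‖ ^ (-(5 / 2) : ℝ)) := by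
  set r := ‖latticeShift Lx Ly n‖ with hr
  have hr0 : 0 < r := by linarith
  have hrc : 0 < rc := hrmin.trans_le h.rmin_le
  have hQ0 : 0 ≤ ∑ j, |q j| := Finset.sum_nonneg fun j _ => abs_nonneg _
  have hrcr : rc ^ 2 ≤ r ^ 2 / 4 := by
    have : rc ≤ r / 2 := by linarith [h.cutoff_le]
    calc rc ^ 2 ≤ (r / 2) ^ 2 := by gcongr
      _ = _ := by ring
  have hN0 := narrowSize_nonneg h.one_lt h.pos ω 0 (rc ^ 2)
  have hN1 := narrowSize_nonneg h.one_lt h.pos ω 1 (rc ^ 2)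
  constructor
  · have : |pairTerm q pos Lx Ly (gaussSeries b σ (narrowCoeff ω) 0) n x|
        ≤ (∑ j, |q j|) * (narrowSize b σ ω 0 (rc ^ 2) *
          (2 * Real.exp 1 * Λ ^ 4 / (r ^ 2 / 4) ^ 2)) := by
      refine abs_pairTerm_le_of_bound fun j v hv => ?_
      have hv4 := quarter_le_norm_image_sq hD hn1 j hv
      refine (h.abs_gaussSeries_narrowCoeff_le hrmin 0 (hrcr.trans hv4)).trans ?_
      gcongr
    calc _ ≤ _ := this
      _ = (∑ j, |q j|) * (32 * Real.exp 1 * Λ ^ 4) *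
          (narrowSize b σ ω 0 (rc ^ 2) * (r ^ 4)⁻¹) := by field_simp; ring
      _ ≤ _ := by gcongr; exact inv_pow_le_rpow hn2 (by norm_num)
  · have : ‖pairGrad q pos Lx Ly (gaussSeries b σ (narrowCoeff ω) 1) n x‖
        ≤ (∑ j, |q j|) * (2 * (narrowSize b σ ω 1 (rc ^ 2) *
          (2 * Real.exp 1 * Λ ^ 4 * (8 * (r ^ 3)⁻¹)))) := by
      refine norm_pairGrad_le_of_bound fun j v hv => ?_
      have hv4 := quarter_le_norm_image_sq hD hn1 j hv
      have hv2 : r / 2 ≤ ‖v‖ := by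
        refine le_of_sq_le_sq ?_ (norm_nonneg v)
        calc (r / 2) ^ 2 = r ^ 2 / 4 := by ring
          _ ≤ _ := hv4
      have hv0 : 0 < ‖v‖ := by linarith
      have h1 := h.abs_gaussSeries_narrowCoeff_le hrmin 1 (hrcr.trans hv4)
      have h2 : (‖v‖ ^ 3)⁻¹ ≤ 8 * (r ^ 3)⁻¹ := by
        calc (‖v‖ ^ 3)⁻¹ ≤ ((r / 2) ^ 3)⁻¹ := by gcongr
          _ = _ := by field_simp; norm_num
      calc _ ≤ narrowSize b σ ω 1 (rc ^ 2) * (2 * Real.exp 1 * Λ ^ 4 / (‖v‖ ^ 2) ^ 2) * ‖v‖ := by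
            gcongr
        _ = narrowSize b σ ω 1 (rc ^ 2) * (2 * Real.exp 1 * Λ ^ 4 * (‖v‖ ^ 3)⁻¹) := by
            field_simp
        _ ≤ _ := by gcongr
    calc _ ≤ _ := this
      _ = (∑ j, |q j|) * (32 * Real.exp 1 * Λ ^ 4) *
          (narrowSize b σ ω 1 (rc ^ 2) * (r ^ 3)⁻¹) := by ring
      _ ≤ _ := by gcongr; exact inv_pow_le_rpow hn2 le_rfl

lemma tail_pair_le (hq : ∑ j, q j = 0) {b σ : ℝ} (hb : 1 < b) (hσ : 0 < σ) (M : ℕ)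
    (hD : ∀ j, ‖pos j - x‖ ≤ D) (hn1 : 2 * D ≤ ‖latticeShift Lx Ly n‖)
    (hn2 : 1 ≤ ‖latticeShift Lx Ly n‖) :
    |pairTerm q pos Lx Ly (gaussSeries b σ (tailCoeff M) 0) n x|
      ≤ (∑ j, |q j|) * (4 * D ^ 2 * tailSize b σ M ‖latticeShift Lx Ly n‖) ∧
    ‖pairGrad q pos Lx Ly (gaussSeries b σ (tailCoeff M) 1) n x‖
      ≤ (∑ j, |q j|) * (6 * D * tailSize b σ M ‖latticeShift Lx Ly n‖) := by
  have hr0 : 0 < ‖latticeShift Lx Ly n‖ := by linarith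
  have hf := isDerivChain_gaussSeries hb hσ (isBoundedCoeff_tailCoeff M)
  have hle : ∀ m s, ‖latticeShift Lx Ly n‖ ^ 2 / 4 ≤ s → |gaussSeries b σ (tailCoeff M) m s|
      ≤ gaussSeries b σ (tailCoeff M) m (‖latticeShift Lx Ly n‖ ^ 2 / 4) := by
    intro m s hs
    rw [abs_of_nonneg (gaussSeries_nonneg hb hσ (tailCoeff_nonneg M) m s)]
    exact gaussSeries_anti hb hσ (isBoundedCoeff_tailCoeff M) (tailCoeff_nonneg M) m
      (by positivity) hs
  exact ⟨hf.abs_pairTerm_le hq hD hn1 hr0 (hle 1) (hle 2),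
    hf.norm_pairGrad_le hD hn1 hr0 (hle 1) (hle 2)⟩

/-- The contribution of distant images. -/
lemma exists_far_pair_le (q : Fin N → ℝ) (pos : Fin N → Space) (Lx Ly : ℝ)
    (hq : ∑ j, q j = 0) (hD0 : 0 ≤ D) {Λ rmin : ℝ} (hrmin : 0 < rmin) :
    ∃ C : ℝ, 0 < C ∧ ∀ (b σ ω rc : ℝ) (M : ℕ), IsAdmissible Λ rmin b σ ω rc M →
      ∀ x : Space, (∀ j, ‖pos j - x‖ ≤ D) → ∀ n : ℤ × ℤ, 2 * D ≤ ‖latticeShift Lx Ly n‖ →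
      1 ≤ ‖latticeShift Lx Ly n‖ → Λ ≤ ‖latticeShift Lx Ly n‖ →
      |pairTerm q pos Lx Ly (cutBelow (sogResidual b σ (farCoeff ω M) 0) (rc ^ 2)) n x|
        ≤ C * ((quadSize b + narrowSize b σ ω 0 (rc ^ 2)) *
          ‖latticeShift Lx Ly n‖ ^ (-(5 / 2) : ℝ) + tailSize b σ M ‖latticeShift Lx Ly n‖) ∧
      ‖pairGrad q pos Lx Ly (cutBelow (sogResidual b σ (farCoeff ω M) 1) (rc ^ 2)) n x‖
        ≤ C * ((quadSize b + narrowSize b σ ω 1 (rc ^ 2)) *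
          ‖latticeShift Lx Ly n‖ ^ (-(5 / 2) : ℝ) + tailSize b σ M ‖latticeShift Lx Ly n‖) := by
  obtain ⟨A, hA, HA⟩ := exists_quadrature_pair_le (q := q) (pos := pos) (Lx := Lx) (Ly := Ly) hq hD0
  set Q := ∑ j, |q j| with hQ
  have hQ0 : 0 ≤ Q := Finset.sum_nonneg fun j _ => abs_nonneg _
  have hB1 : 0 ≤ Q * (32 * Real.exp 1 * Λ ^ 4) := by positivity
  have hB2 : 0 ≤ Q * (4 * D ^ 2) := by positivity
  have hB3 : 0 ≤ Q * (6 * D) := by positivity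
  refine ⟨A + Q * (32 * Real.exp 1 * Λ ^ 4) + Q * (4 * D ^ 2) + Q * (6 * D), by positivity, ?_⟩
  intro b σ ω rc M h x hD n hn1 hn2 hn3
  have hb := h.one_lt
  have hσ := h.pos
  have hrc : 0 < rc := hrmin.trans_le h.rmin_le
  obtain ⟨a0, a1⟩ := HA b σ hb h.log_lt_one hσ x hD n hn1 hn2
  obtain ⟨t0, t1⟩ := tail_pair_le (q := q) (pos := pos) (Lx := Lx) (Ly := Ly) hq hb hσ M hD hn1 hn2
  obtain ⟨w0, w1⟩ := narrow_pair_le (q := q) (pos := pos) (Lx := Lx) (Ly := Ly) hrmin h hD hn1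
    hn2 hn3
  rw [← hQ] at t0 t1 w0 w1
  have hN0 := narrowSize_nonneg hb hσ ω 0 (rc ^ 2)
  have hN1 := narrowSize_nonneg hb hσ ω 1 (rc ^ 2)
  have hT := tailSize_nonneg hb hσ M ‖latticeShift Lx Ly n‖
  have hcut : ∀ m s, ‖latticeShift Lx Ly n‖ ^ 2 / 4 ≤ s →
      cutBelow (sogResidual b σ (farCoeff ω M) m) (rc ^ 2) s = sogResidual b σ (fun _ => 1) m s
        + gaussSeries b σ (tailCoeff M) m s + gaussSeries b σ (narrowCoeff ω) m s := by
    intro m s hs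
    -- Here `2 * rc ≤ Λ ≤ ‖latticeShift Lx Ly n‖` is used: all distant images lie beyond the cutoff,
    -- so the splitting applies to them.
    have hrcs : rc ^ 2 ≤ s := by
      have : rc ≤ ‖latticeShift Lx Ly n‖ / 2 := by linarith [h.cutoff_le]
      calc rc ^ 2 ≤ (‖latticeShift Lx Ly n‖ / 2) ^ 2 := by gcongr
        _ ≤ _ := by linarith
    rw [cutBelow_of_le hrcs,
      sogResidual_farCoeff hb hσ ω M m ((by positivity : 0 < rc ^ 2).trans_le hrcs)]
  have hq0 := quadSize_pos hb
  set ρ := ‖latticeShift Lx Ly n‖ ^ (-(5 / 2) : ℝ) with hρ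
  have hρ0 : 0 ≤ ρ := by positivity
  have comb : ∀ R : ℝ, 0 ≤ R → ∀ G : ℝ, (G = Q * (4 * D ^ 2) ∨ G = Q * (6 * D)) →
      A * (quadSize b * ρ) + G * tailSize b σ M ‖latticeShift Lx Ly n‖
        + Q * (32 * Real.exp 1 * Λ ^ 4) * (R * ρ)
      ≤ (A + Q * (32 * Real.exp 1 * Λ ^ 4) + Q * (4 * D ^ 2) + Q * (6 * D)) *
        ((quadSize b + R) * ρ + tailSize b σ M ‖latticeShift Lx Ly n‖) := by
    intro R hR G hG
    set B := A + Q * (32 * Real.exp 1 * Λ ^ 4) + Q * (4 * D ^ 2) + Q * (6 * D) with hB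
    have hG' : G ≤ B := by rcases hG with rfl | rfl <;> linarith
    have hA' : A ≤ B := by linarith
    have hW' : Q * (32 * Real.exp 1 * Λ ^ 4) ≤ B := by linarith
    calc _ ≤ B * (quadSize b * ρ) + B * tailSize b σ M ‖latticeShift Lx Ly n‖ + B * (R * ρ) := by
          gcongr
      _ = _ := by ring
  constructor
  · rw [pairTerm_congr hD hn1 (hcut 0), pairTerm_add, pairTerm_add]
    refine le_trans ?_ (comb _ hN0 _ (Or.inl rfl))
    refine (abs_add_le _ _).trans (add_le_add ((abs_add_le _ _).trans (add_le_add a0 ?_)) w0)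
    exact t0.trans_eq (by ring)
  · rw [pairGrad_congr hD hn1 (hcut 1), pairGrad_add, pairGrad_add]
    refine le_trans ?_ (comb _ hN1 _ (Or.inr rfl))
    refine (norm_add_le _ _).trans (add_le_add ((norm_add_le _ _).trans (add_le_add a1 ?_)) w1)
    exact t1.trans_eq (by ring)

end

/-! ### Summation over the lattice and conclusion -/

/-- Summation of a lattice function with finitely many exceptional terms. -/
lemma exists_lattice_sum_le {Lx Ly : ℝ} (hLx : 0 < Lx) (hLy : 0 < Ly) {rmin : ℝ}
    (hrmin : 0 < rmin) (R₀ : ℝ) (hR₀ : 0 < R₀) {A C : ℝ} (hA : 0 < A) (hC : 0 < C) :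
    ∃ B : ℝ, 0 < B ∧ ∀ (b σ ω rc : ℝ) (M : ℕ), IsAdmissible (max Lx Ly) rmin b σ ω rc M →
      ∀ m ≤ 1, ∀ X : ℤ × ℤ → ℝ,
      (∀ n, ‖latticeShift Lx Ly n‖ < R₀ → X n ≤ A * errScale b σ ω m (rc ^ 2)) →
      (∀ n, R₀ ≤ ‖latticeShift Lx Ly n‖ → X n ≤
        C * ((quadSize b + narrowSize b σ ω m (rc ^ 2)) *
          ‖latticeShift Lx Ly n‖ ^ (-(5 / 2) : ℝ) + tailSize b σ M ‖latticeShift Lx Ly n‖)) →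
      ∀ F : Finset (ℤ × ℤ), ∑ n ∈ F, X n ≤ B * errScale b σ ω m (rc ^ 2) := by
  obtain ⟨c, hc, H⟩ := exists_size_bounds hrmin (lt_max_of_lt_left hLx : 0 < max Lx Ly)
  obtain ⟨T, hT, HT⟩ := exists_sum_tailSize_le hLx hLy hrmin
  have hfin := finite_norm_latticeShift_lt hLx hLy R₀
  have hZs := summable_norm_latticeShift_rpow hLx hLy (k := 5 / 2) (by norm_num)
  set Z := ∑' n, ‖latticeShift Lx Ly n‖ ^ (-(5 / 2) : ℝ) with hZ
  have hZ0 : 0 ≤ Z := tsum_nonneg fun n => by positivity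
  set k : ℝ := (hfin.toFinset.card : ℝ) with hk
  refine ⟨k * A + C * ((1 + c) * Z + T * c), by positivity, ?_⟩
  intro b σ ω rc M h m hm X hX1 hX2 F
  have hb := h.one_lt
  have hq := quadSize_pos hb
  have hqS := quadSize_le_errScale b σ ω m (rc ^ 2)
  have hS := hq.trans_le hqS
  obtain ⟨hT0, -, hN⟩ := H b σ ω rc M h m hm
  have hN0 := narrowSize_nonneg hb h.pos ω m (rc ^ 2)
  set E := errScale b σ ω m (rc ^ 2) with hE
  classical
  rw [← Finset.sum_filter_add_sum_filter_not F (fun n => ‖latticeShift Lx Ly n‖ < R₀)]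
  have h1 : ∑ n ∈ F with ‖latticeShift Lx Ly n‖ < R₀, X n ≤ k * A * E := by
    refine (Finset.sum_le_card_nsmul _ _ (A * E) fun n hn =>
      hX1 n (Finset.mem_filter.1 hn).2).trans ?_
    rw [nsmul_eq_mul, mul_assoc]
    gcongr
    rw [hk]
    exact_mod_cast Finset.card_le_card fun n hn => by
      simpa using (Finset.mem_filter.1 hn).2
  have h2 : ∑ n ∈ F with ¬ ‖latticeShift Lx Ly n‖ < R₀, X n
      ≤ C * ((1 + c) * Z + T * c) * E := by
    set G := F.filter fun n => ¬ ‖latticeShift Lx Ly n‖ < R₀ with hG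
    have hGm : ∀ n ∈ G, R₀ ≤ ‖latticeShift Lx Ly n‖ := fun n hn =>
      not_lt.1 (Finset.mem_filter.1 hn).2
    have h3 := HT b σ ω rc M h G fun n hn => hR₀.trans_le (hGm n hn)
    have h4 : ∑ n ∈ G, ‖latticeShift Lx Ly n‖ ^ (-(5 / 2) : ℝ) ≤ Z :=
      hZs.sum_le_tsum G fun n _ => by positivity
    calc _ ≤ ∑ n ∈ G, C * ((quadSize b + narrowSize b σ ω m (rc ^ 2)) *
          ‖latticeShift Lx Ly n‖ ^ (-(5 / 2) : ℝ) + tailSize b σ M ‖latticeShift Lx Ly n‖) :=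
          Finset.sum_le_sum fun n hn => hX2 n (hGm n hn)
      _ = C * ((quadSize b + narrowSize b σ ω m (rc ^ 2)) *
          (∑ n ∈ G, ‖latticeShift Lx Ly n‖ ^ (-(5 / 2) : ℝ)) +
          ∑ n ∈ G, tailSize b σ M ‖latticeShift Lx Ly n‖) := by
          rw [← Finset.mul_sum, Finset.sum_add_distrib, ← Finset.mul_sum]
      _ ≤ C * ((E + c * E) * Z + T * (c * E)) := by
          gcongr
          exact h3.trans (by gcongr)
      _ = _ := by ring
  linarith

/-- The sums of the image contributions to the potential and to its gradient. -/
lemma exists_sum_pair_le {N : ℕ} {q : Fin N → ℝ} (hq : ∑ j, q j = 0) (pos : Fin N → Space)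
    {Lx Ly : ℝ} (hLx : 0 < Lx) (hLy : 0 < Ly) {rmin : ℝ} (hrmin : 0 < rmin) {D : ℝ} (hD0 : 0 ≤ D) :
    ∃ C : ℝ, 0 < C ∧ ∀ (b σ ω rc : ℝ) (M : ℕ), IsAdmissible (max Lx Ly) rmin b σ ω rc M →
      ∀ x : Space, (∀ j, ‖pos j - x‖ ≤ D) → ∀ F : Finset (ℤ × ℤ),
      ∑ n ∈ F, |pairTerm q pos Lx Ly
        (cutBelow (sogResidual b σ (farCoeff ω M) 0) (rc ^ 2)) n x|
          ≤ C * errScale b σ ω 0 (rc ^ 2) ∧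
      ∑ n ∈ F, ‖pairGrad q pos Lx Ly
        (cutBelow (sogResidual b σ (farCoeff ω M) 1) (rc ^ 2)) n x‖
          ≤ C * errScale b σ ω 1 (rc ^ 2) := by
  have hΛ : 0 < max Lx Ly := lt_max_of_lt_left hLx
  obtain ⟨A, hA, HA⟩ := exists_abs_cutBelow_sogResidual_le hrmin hΛ
  obtain ⟨C, hC, HC⟩ := exists_far_pair_le q pos Lx Ly hq hD0 (Λ := max Lx Ly) hrmin
  set Q := ∑ j, |q j| with hQ
  have hQ0 : 0 ≤ Q := Finset.sum_nonneg fun j _ => abs_nonneg _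
  -- Beyond this radius all three conditions of `exists_far_pair_le` hold, and it does not depend on
  -- the splitting parameters.
  set R₀ := 2 * D + 1 + max Lx Ly with hR
  have hR0 : 0 < R₀ := by positivity
  obtain ⟨B, hB, HB⟩ := exists_lattice_sum_le hLx hLy hrmin R₀ hR0
    (A := Q * A + Q * (2 * (A * (D + R₀))) + 1) (by positivity) hC
  refine ⟨B, hB, fun b σ ω rc M h x hD F => ⟨?_, ?_⟩⟩
  · have hS := (quadSize_pos h.one_lt).trans_le (quadSize_le_errScale b σ ω 0 (rc ^ 2))
    refine HB b σ ω rc M h 0 (by norm_num) (fun n => |pairTerm q pos Lx Ly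
        (cutBelow (sogResidual b σ (farCoeff ω M) 0) (rc ^ 2)) n x|) (fun n hn => ?_)
      (fun n hn => (HC b σ ω rc M h x hD n (by linarith) (by linarith) (by linarith)).1) F
    refine (abs_pairTerm_le_of_bound fun j v _ => HA b σ ω rc M h 0 (by norm_num) _).trans ?_
    rw [← mul_assoc]
    gcongr
    have : 0 ≤ Q * (2 * (A * (D + R₀))) := by positivity
    linarith
  · have hS := (quadSize_pos h.one_lt).trans_le (quadSize_le_errScale b σ ω 1 (rc ^ 2))
    refine HB b σ ω rc M h 1 le_rfl (fun n => ‖pairGrad q pos Lx Ly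
        (cutBelow (sogResidual b σ (farCoeff ω M) 1) (rc ^ 2)) n x‖) (fun n hn => ?_)
      (fun n hn => (HC b σ ω rc M h x hD n (by linarith) (by linarith) (by linarith)).2) F
    have : ‖pairGrad q pos Lx Ly (cutBelow (sogResidual b σ (farCoeff ω M) 1) (rc ^ 2)) n x‖
        ≤ Q * (2 * (A * errScale b σ ω 1 (rc ^ 2) * (D + R₀))) := by
      refine norm_pairGrad_le_of_bound fun j v hv => ?_
      have hvn : ‖v‖ ≤ D + R₀ := by
        have := hD j
        rcases hv with rfl | rfl
        · exact (norm_add_le _ _).trans (by linarith)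
        · exact (norm_sub_le _ _).trans (by linarith)
      have := HA b σ ω rc M h 1 le_rfl (‖v‖ ^ 2)
      gcongr
    calc _ ≤ _ := this
      _ = (Q * (2 * (A * (D + R₀)))) * errScale b σ ω 1 (rc ^ 2) := by ring
      _ ≤ _ := by
        gcongr
        have : 0 ≤ Q * A := by positivity
        linarith

end

theorem mainTheorem3
    (N : ℕ) (q : Fin N → ℝ) (hneutral : ∑ i, q i = 0)
    (Lx Ly Lz : ℝ) (hLx : 0 < Lx) (hLy : 0 < Ly) (hLz : 0 < Lz)
    (pos : Fin N → Space)
    (hbox : ∀ i, |pos i 0| ≤ Lx / 2 ∧ |pos i 1| ≤ Ly / 2 ∧ |pos i 2| ≤ Lz / 2)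
    (rmin : ℝ) (hrmin : 0 < rmin) :
    ∃ C b₀ : ℝ, 0 < C ∧ 1 < b₀ ∧
      ∀ (b σ ω rc : ℝ) (M : ℕ), 1 < b → b < b₀ → 0 < σ →
        IsC1Splitting b σ ω M rc →
        sogWidth b σ 0 < rc → rmin ≤ rc → 2 * rc ≤ max Lx Ly →
        max Lx Ly ≤ sogWidth b σ (M + 1) →
        (∀ x : Space, Tendsto (fun R : ℕ => errPotentialPartial q pos Lx Ly b σ ω M rc R x)
            atTop (𝓝 (errPotential q pos Lx Ly b σ ω M rc x))) ∧
        (∀ x : Space, DifferentiableAt ℝ (errPotential q pos Lx Ly b σ ω M rc) x) ∧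
        |errEnergy q pos Lx Ly b σ ω M rc| ≤ C * energyBound b σ ω M rc ∧
        ∀ i, ‖errForce q pos Lx Ly b σ ω M rc i‖ ≤ C * forceBound b σ ω M rc := by
  -- Energy and forces evaluate the potential and its gradient only at the charges, so a bound on
  -- their mutual distances suffices.
  set D := 2 * ∑ j, ‖pos j‖ with hDdef
  have hD0 : 0 ≤ D := by positivity
  have hD : ∀ i j, ‖pos j - pos i‖ ≤ D := fun i j => by
    have h1 := norm_pos_sub_le j (pos i) (pos := pos)
    have h2 := Finset.single_le_sum (f := fun j => ‖pos j‖) (fun i _ => norm_nonneg _)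
      (Finset.mem_univ i)
    linarith
  obtain ⟨C, hC, H⟩ := exists_sum_pair_le hneutral pos hLx hLy hrmin hD0
  set Q := ∑ j, |q j| with hQ
  have hQ0 : 0 ≤ Q := Finset.sum_nonneg fun j _ => abs_nonneg _
  -- The choice `b₀ = 2` gives `log b < 1`; the summand `1` keeps the constant positive when all
  -- charges vanish.
  refine ⟨(Q + 1) * C, 2, by positivity, by norm_num, ?_⟩
  intro b σ ω rc M hb hb2 hσ hc1 hw hr hcut hM
  have h : IsAdmissible (max Lx Ly) rmin b σ ω rc M := ⟨hb, hb2, hσ, hc1, hw, hr, hcut, hM⟩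
  have reg := errPotential_regular hneutral pos hLx hLy hrmin h
  have hS0 := errScale_zero_le (σ := σ) (ω := ω) (rc := rc) (M := M) hb
  have hS1 := errScale_one_le (σ := σ) (ω := ω) (rc := rc) (M := M) hb
  have hE0 := ((quadSize_pos hb).trans_le (quadSize_le_errScale b σ ω 0 (rc ^ 2))).trans_le hS0
  have hE1 := ((quadSize_pos hb).trans_le (quadSize_le_errScale b σ ω 1 (rc ^ 2))).trans_le hS1
  refine ⟨fun x => (reg x).1, fun x => (reg x).2.1, ?_, fun i => ?_⟩
  · have hpot : ∀ i, |errPotential q pos Lx Ly b σ ω M rc (pos i)|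
        ≤ C * energyBound b σ ω M rc := fun i =>
      (reg (pos i)).2.2.1 _ fun F =>
        ((H b σ ω rc M h (pos i) (hD i) F).1).trans (by gcongr)
    unfold errEnergy
    rw [abs_mul, abs_of_pos (by norm_num : (0 : ℝ) < 1 / 2)]
    have : |∑ i, q i * errPotential q pos Lx Ly b σ ω M rc (pos i)|
        ≤ Q * (C * energyBound b σ ω M rc) := by
      rw [hQ, Finset.sum_mul]
      refine (Finset.abs_sum_le_sum_abs _ _).trans (Finset.sum_le_sum fun i _ => ?_)
      rw [abs_mul]
      gcongr
      exact hpot i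
    have h1 : 0 ≤ Q * (C * energyBound b σ ω M rc) := by positivity
    have h2 : 0 ≤ C * energyBound b σ ω M rc := by positivity
    linarith
  · have hgrad : ‖gradient (errPotential q pos Lx Ly b σ ω M rc) (pos i)‖
        ≤ C * forceBound b σ ω M rc :=
      (reg (pos i)).2.2.2 _ fun F =>
        ((H b σ ω rc M h (pos i) (hD i) F).2).trans (by gcongr)
    have hqi : |q i| ≤ Q := Finset.single_le_sum (f := fun j => |q j|)
      (fun j _ => abs_nonneg _) (Finset.mem_univ i)
    unfold errForce
    rw [norm_neg, norm_smul, Real.norm_eq_abs]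
    calc _ ≤ Q * (C * forceBound b σ ω M rc) := by gcongr
      _ ≤ (Q + 1) * (C * forceBound b σ ω M rc) := by gcongr; linarith
      _ = _ := by ring
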